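/- **Theorem (hitting sets for known-shape low-width UPT circuits).** *Circuits.* A non-commutative arithmetic circuit over a field $\mathbb{F}$ in the variables $x_1,\dots,x_n$ is a directed acyclic graph with one output gate (the root), whose leaves are variables $x_i$ or constants from $\mathbb{F}$ and whose internal gates are $+$ gates (computing a linear combination of their children, with scalars on the edges) and $\times$ gates (computing the product of their children in order); fan-in is arbitrary. A *parse tree* of a circuit is obtained by starting at the root, choosing exactly one child at every $+$ gate, and all children, in order, at every $\times$ gate. The *shape* of a parse tree is the ordered tree that remains when only the kind ($+$, $\times$, variable leaf, constant leaf) of each node is kept. A circuit is a *UPT circuit with shape $T$* if all its parse trees have shape $T$. Its *preimage-width* is the maximum over the nodes $\tau$ of $T$ of the number of gates that occur at position $\tau$ in some parse tree. *The class.* For $n,d,w\ge 1$ and a shape $T$, let $\mathcal{C}_{n,d,T,w}(\mathbb{F})$ be the class of homogeneous polynomials of degree $d$ in $\mathbb{F}\langle x_1,\dots,x_n\rangle$ that are computable by UPT circuits with shape $T$ and preimage-width at most $w$. A set $\mathcal{H}$ of $n$-tuples of $(d+1)\times(d+1)$ matrices over $\mathbb{F}$ is a *hitting set* for $\mathcal{C}_{n,d,T,w}(\mathbb{F})$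 if every nonzero $f\in\mathcal{C}_{n,d,T,w}(\mathbb{F})$ satisfies $f(A_1,\dots,A_n)\neq 0$ for some $(A_1,\dots,A_n)\in\mathcal{H}$. *Claim.* There are a deterministic algorithm and constants $a,b,c\in\mathbb{N}$ such that the following holds for all $n,d,w\ge 1$ and every shape $T$. Put $$B(n,d,w)=a\,(nd)^{b}\,w^{c\lfloor\log_2 d\rfloor}=w^{O(\log d)}\operatorname{poly}(nd).$$ On input $(n,d,T,w)$ the algorithm outputs, in at most $a\,(n\,d\,w\,|T|)^{b}\,w^{c\lfloor\log_2 d\rfloor}$ steps, where $|T|$ is the number of nodes of $T$, a list of at most $B(n,d,w)$ $n$-tuples of $(d+1)\times(d+1)$ matrices of natural numbers; and for every field $\mathbb{F}$ with $\operatorname{char}\mathbb{F}=0$ or $\operatorname{char}\mathbb{F}>B(n,d,w)$, the images of these tuples over $\mathbb{F}$ form a hitting set $\mathcal{H}_{n,d,T,w}$ for $\mathcal{C}_{n,d,T,w}(\mathbb{F})$. (Algorithms are programs on binary trees with natural numbers at the leaves, built from projections, pairing, arithmetic, branching, counted loops and structural recursion. Pointer operations cost one step, the sum, truncated difference and product of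 $k$- and $l$-bit numbers cost $1+k+l$, $1+k+l$ and $(1+k)(1+l)$ steps, and every round of a loop or recursion is charged.) -/

import Mathlib

namespace UPT

/-! ### Ordered labelled trees -/

/-- Finite rooted ordered trees whose nodes are labelled by elements of `α`. -/
inductive RTree (α : Type*) where
  | node (label : α) (children : List (RTree α)) : RTree α

namespace RTree

/-- The label of the root. -/
def root {α : Type*} : RTree α → α
  | node a _ => a

mutual
/-- Relabel all nodes of a tree by `f`. -/
def map {α β : Type*} (f : α → β) : RTree α → RTree β
  | node a ts => node (f a) (mapList f ts)
/-- Relabel all nodes of a list of trees by `f`. -/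
def mapList {α β : Type*} (f : α → β) : List (RTree α) → List (RTree β)
  | [] => []
  | t :: ts => map f t :: mapList f ts
end

mutual
/-- The number of nodes of a tree. -/
def size {α : Type*} : RTree α → ℕ
  | node _ ts => 1 + sizeList ts
/-- The total number of nodes of a list of trees. -/
def sizeList {α : Type*} : List (RTree α) → ℕ
  | [] => 0
  | t :: ts => size t + sizeList ts
end

/-- The label at a position of a tree. A position is the list of child indices on the way down from
the root; the result is `none` if the tree has no such position. -/
def labelAt {α : Type*} : List ℕ → RTree α → Option α
  | [], node a _ => some a
  | i :: p, node _ ts =>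
    match ts[i]? with
    | none => none
    | some t => labelAt p t

end RTree

/-! ### Non-commutative arithmetic circuits -/

/-- A gate of a non-commutative circuit in the variables `x_0, …, x_{n-1}` over `F`, whose children
are among the gates `0, …, s-1`. Addition and multiplication gates have arbitrary fan-in, the
children of a multiplication gate are ordered, and the edges into an addition gate carry scalars
(the unweighted addition gate has all scalars equal to `1`). -/
inductive Gate (F : Type*) (n s : ℕ) where
  | var (i : Fin n) : Gate F n s
  | const (c : F) : Gate F n s
  | plus (l : List (F × Fin s)) : Gate F n s
  | times (l : List (Fin s)) : Gate F n s

/-- The kind of a gate; the leaves of a circuit are variables or constants. -/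
inductive Kind where
  | var : Kind
  | const : Kind
  | plus : Kind
  | times : Kind

namespace Gate

/-- The children of a gate. -/
def children {F : Type*} {n s : ℕ} : Gate F n s → List (Fin s)
  | var _ => []
  | const _ => []
  | plus l => l.map Prod.snd
  | times l => l

/-- The kind of a gate. -/
def kind {F : Type*} {n s : ℕ} : Gate F n s → Kind
  | var _ => .var
  | const _ => .const
  | plus _ => .plus
  | times _ => .times

end Gate

/-- A non-commutative arithmetic circuit: a directed acyclic graph of gates, numbered in a
topological order, with a distinguished output gate (its root). -/
structure Circuit (F : Type*) (n : ℕ) where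
  numGates : ℕ
  gate : Fin numGates → Gate F n numGates
  acyclic : ∀ g, ∀ h ∈ (gate g).children, h < g
  output : Fin numGates

namespace Circuit

/-- The non-commutative polynomial computed at a gate. -/
noncomputable def value {F : Type*} [Field F] {n : ℕ} (C : Circuit F n) (g : Fin C.numGates) :
    FreeAlgebra F (Fin n) :=
  match hg : C.gate g with
  | .var i => FreeAlgebra.ι F i
  | .const c => algebraMap F (FreeAlgebra F (Fin n)) c
  | .plus l => (l.attach.map fun e => e.1.1 • C.value e.1.2).sum
  | .times l => (l.attach.map fun h => C.value h.1).prod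
termination_by g
decreasing_by
  · refine C.acyclic g _ ?_
    rw [hg]
    exact List.mem_map.2 ⟨e.1, e.2, rfl⟩
  · refine C.acyclic g _ ?_
    rw [hg]
    exact h.2

theorem value_var {F : Type*} [Field F] {n : ℕ} (C : Circuit F n) {g : Fin C.numGates}
    {i : Fin n} (hg : C.gate g = .var i) : C.value g = FreeAlgebra.ι F i := by
  unfold value
  split <;> simp_all

theorem value_const {F : Type*} [Field F] {n : ℕ} (C : Circuit F n) {g : Fin C.numGates}
    {c : F} (hg : C.gate g = .const c) :
    C.value g = algebraMap F (FreeAlgebra F (Fin n)) c := by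
  unfold value
  split <;> simp_all

theorem value_plus {F : Type*} [Field F] {n : ℕ} (C : Circuit F n) {g : Fin C.numGates}
    {l : List (F × Fin C.numGates)} (hg : C.gate g = .plus l) :
    C.value g = (l.map fun e => e.1 • C.value e.2).sum := by
  rw [value]
  split <;> rename_i h <;> rw [hg] at h <;> cases h
  exact congrArg List.sum (List.attach_map_val (f := fun e : F × _ => e.1 • C.value e.2))

theorem value_times {F : Type*} [Field F] {n : ℕ} (C : Circuit F n) {g : Fin C.numGates}
    {l : List (Fin C.numGates)} (hg : C.gate g = .times l) :
    C.value g = (l.map C.value).prod := by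
  rw [value]
  split <;> rename_i h <;> rw [hg] at h <;> cases h
  exact congrArg List.prod (List.attach_map_val (f := C.value))

/-- Trees of gates that start at an arbitrary gate, take exactly one child of each addition gate and
all the children, in order, of each multiplication gate, and end in leaves of the circuit. -/
inductive IsPartialParseTree {F : Type*} {n : ℕ} (C : Circuit F n) :
    RTree (Fin C.numGates) → Prop
  | var {g : Fin C.numGates} {i : Fin n} (hg : C.gate g = .var i) :
      IsPartialParseTree C (.node g [])
  | const {g : Fin C.numGates} {c : F} (hg : C.gate g = .const c) :
      IsPartialParseTree C (.node g [])
  | plus {g : Fin C.numGates} {l : List (F × Fin C.numGates)} (hg : C.gate g = .plus l)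
      {t : RTree (Fin C.numGates)} (hl : t.root ∈ l.map Prod.snd)
      (ht : IsPartialParseTree C t) : IsPartialParseTree C (.node g [t])
  | times {g : Fin C.numGates} {l : List (Fin C.numGates)} (hg : C.gate g = .times l)
      {ts : List (RTree (Fin C.numGates))} (hl : ts.map RTree.root = l)
      (hts : ∀ t ∈ ts, IsPartialParseTree C t) : IsPartialParseTree C (.node g ts)

/-- The parse trees of a circuit, with nodes labelled by gates. -/
def IsParseTree {F : Type*} {n : ℕ} (C : Circuit F n) (t : RTree (Fin C.numGates)) : Prop :=
  C.IsPartialParseTree t ∧ t.root = C.output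

/-- The shape of a tree of gates: names of gates, variables and constants are forgotten, and only
the kind of each node is kept. -/
def shape {F : Type*} {n : ℕ} (C : Circuit F n) (t : RTree (Fin C.numGates)) : RTree Kind :=
  t.map fun g => (C.gate g).kind

/-- `C` is a unique-parse-tree circuit with underlying parse-tree shape `T`. -/
def IsUPT {F : Type*} {n : ℕ} (C : Circuit F n) (T : RTree Kind) : Prop :=
  ∀ t, C.IsParseTree t → C.shape t = T

/-- The preimages of the position `τ`: the gates that occupy it in some parse tree. -/
def preimages {F : Type*} {n : ℕ} (C : Circuit F n) (τ : List ℕ) : Set (Fin C.numGates) :=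
  {g | ∃ t, C.IsParseTree t ∧ t.labelAt τ = some g}

/-- The preimage-width of `C`, the largest number of preimages of a position, is at most `w`. -/
def PreimageWidthLE {F : Type*} {n : ℕ} (C : Circuit F n) (w : ℕ) : Prop :=
  ∀ τ : List ℕ, (C.preimages τ).ncard ≤ w

end Circuit

/-- The space of non-commutative polynomials that are homogeneous of degree `d`. -/
noncomputable def homogeneous (F : Type*) [Field F] (n d : ℕ) :
    Submodule F (FreeAlgebra F (Fin n)) :=
  Submodule.span F {m | ∃ u : List (Fin n), u.length = d ∧ m = (u.map (FreeAlgebra.ι F)).prod}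

/-- The class of `n`-variate degree `d` non-commutative polynomials that are computable by UPT
circuits of preimage-width at most `w` with underlying parse-tree shape `T`. -/
def uptClass (F : Type*) [Field F] (n d : ℕ) (T : RTree Kind) (w : ℕ) :
    Set (FreeAlgebra F (Fin n)) :=
  {f | f ∈ homogeneous F n d ∧
    ∃ C : Circuit F n, C.IsUPT T ∧ C.PreimageWidthLE w ∧ C.value C.output = f}

/-- A set `H` of `n`-tuples of `m × m` matrices is a hitting set for a class of non-commutative
polynomials if each nonzero polynomial of the class is nonzero at some point of `H`. -/
def IsHittingSet {F : Type*} [Field F] {n m : ℕ} (H : Set (Fin n → Matrix (Fin m) (Fin m) F))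
    (𝒞 : Set (FreeAlgebra F (Fin n))) : Prop :=
  ∀ f ∈ 𝒞, f ≠ 0 → ∃ A ∈ H, FreeAlgebra.lift F A f ≠ 0

/-! ### A programming language with a step count

Data are binary trees of natural numbers, held in memory as pointers to cells. Pointer operations
cost one step, arithmetic is charged by the binary lengths of its operands, and all loops and
recursions are charged for each of their rounds. So a run of cost `t` is simulated by a Turing
machine in time polynomial in `t` and the length of the input. All programs terminate. -/

/-- Binary trees with natural numbers at the leaves. -/
inductive Data where
  | num (k : ℕ) : Data
  | pair (a b : Data) : Data

namespace Data

/-- The number held by a leaf (`0` for a pair). -/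
def toNat : Data → ℕ
  | num k => k
  | pair _ _ => 0

/-- First component of a pair (a leaf is unchanged). -/
def fst : Data → Data
  | num k => num k
  | pair a _ => a

/-- Second component of a pair (a leaf is unchanged). -/
def snd : Data → Data
  | num k => num k
  | pair _ b => b

/-- `1` for a pair and `0` for a number. -/
def isPair : Data → Data
  | num _ => num 0
  | pair _ _ => num 1

/-- Structural recursion with parameter `e`, base case `f` and step `g`. The step sees the
parameter, the pair at hand, and the results for its two components. -/
def fold (f g : Data → Data) (e : Data) : Data → Data
  | num k => f (pair e (num k))
  | pair a b => g (pair e (pair (pair a b) (pair (fold f g e a) (fold f g e b))))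

/-- The cost of a structural recursion, where `cf` and `cg` are the costs of `f` and `g`. -/
def foldCost (f g : Data → Data) (cf cg : Data → ℕ) (e : Data) : Data → ℕ
  | num k => 1 + cf (pair e (num k))
  | pair a b => 1 + foldCost f g cf cg e a + foldCost f g cf cg e b +
      cg (pair e (pair (pair a b) (pair (fold f g e a) (fold f g e b))))

/-- Lists as data. -/
def ofList : List Data → Data
  | [] => num 0
  | a :: l => pair a (ofList l)

end Data

/-- Programs, each of which transforms one datum into another. -/
inductive Prog where
  | id : Prog
  | const (k : ℕ) : Prog
  | fst : Prog
  | snd : Prog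
  | isPair : Prog
  | add : Prog
  | sub : Prog
  | mul : Prog
  | comp (p q : Prog) : Prog
  | pair (p q : Prog) : Prog
  | cond (c p q : Prog) : Prog
  | loop (p : Prog) : Prog
  | fold (p q : Prog) : Prog

namespace Prog

/-- The output of a program. Here `comp p q` runs `p` first, `cond c p q` runs `p` if `c` yields a
nonzero number and `q` otherwise, `loop p` on `(k, s)` applies `p` to `s` for `k` rounds, and
`fold p q` on `(e, x)` is structural recursion along `x`; `sub` is truncated subtraction. -/
def eval : Prog → Data → Data
  | id, x => x
  | const k, _ => .num k
  | fst, x => x.fst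
  | snd, x => x.snd
  | isPair, x => x.isPair
  | add, x => .num (x.fst.toNat + x.snd.toNat)
  | sub, x => .num (x.fst.toNat - x.snd.toNat)
  | mul, x => .num (x.fst.toNat * x.snd.toNat)
  | comp p q, x => q.eval (p.eval x)
  | pair p q, x => .pair (p.eval x) (q.eval x)
  | cond c p q, x => if (c.eval x).toNat ≠ 0 then p.eval x else q.eval x
  | loop p, x => p.eval^[x.fst.toNat] x.snd
  | fold p q, x => x.snd.fold p.eval q.eval x.fst

/-- The number of steps of a program; `Nat.size` is the length of the binary expansion. -/
def cost : Prog → Data → ℕ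
  | id, _ => 1
  | const _, _ => 1
  | fst, _ => 1
  | snd, _ => 1
  | isPair, _ => 1
  | add, x => 1 + x.fst.toNat.size + x.snd.toNat.size
  | sub, x => 1 + x.fst.toNat.size + x.snd.toNat.size
  | mul, x => (1 + x.fst.toNat.size) * (1 + x.snd.toNat.size)
  | comp p q, x => 1 + p.cost x + q.cost (p.eval x)
  | pair p q, x => 1 + p.cost x + q.cost x
  | cond c p q, x => 1 + c.cost x + if (c.eval x).toNat ≠ 0 then p.cost x else q.cost x
  | loop p, x => 1 + ∑ i ∈ Finset.range x.fst.toNat, (1 + p.cost (p.eval^[i] x.snd))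
  | fold p q, x => 1 + x.snd.foldCost p.eval q.eval p.cost q.cost x.fst

end Prog

/-! ### Inputs and outputs -/

/-- Kinds as data. -/
def Kind.encode : Kind → Data
  | var => .num 0
  | const => .num 1
  | plus => .num 2
  | times => .num 3

mutual
/-- Shapes as data: the kind of the root, paired with the list of the encoded children. -/
def encodeShape : RTree Kind → Data
  | .node k ts => .pair k.encode (encodeShapes ts)
/-- Lists of shapes as data. -/
def encodeShapes : List (RTree Kind) → Data
  | [] => .num 0
  | t :: ts => .pair (encodeShape t) (encodeShapes ts)
end

/-- The input `(n, d, T, w)`. -/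
def encodeInput (n d : ℕ) (T : RTree Kind) (w : ℕ) : Data :=
  .pair (.num n) (.pair (.num d) (.pair (encodeShape T) (.num w)))

/-- A matrix of natural numbers as the list of its rows. -/
def encodeMatrix {m : ℕ} (A : Matrix (Fin m) (Fin m) ℕ) : Data :=
  .ofList (List.ofFn fun i => .ofList (List.ofFn fun j => .num (A i j)))

/-- A list of `n`-tuples of matrices of natural numbers. -/
def encodePoints {n m : ℕ} (H : List (Fin n → Matrix (Fin m) (Fin m) ℕ)) : Data :=
  .ofList (H.map fun A => .ofList (List.ofFn fun i => encodeMatrix (A i)))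

/-- The points over `F` that are given by a list of tuples of matrices of natural numbers. -/
def pointsOver (F : Type*) [Field F] {n m : ℕ} (H : List (Fin n → Matrix (Fin m) (Fin m) ℕ)) :
    Set (Fin n → Matrix (Fin m) (Fin m) F) :=
  {B | ∃ A ∈ H, B = fun i => (A i).map (Nat.cast : ℕ → F)}

end UPT

set_option linter.unusedSimpArgs false

-- Clustering the leaves of a binary tree with logarithmic depth.

namespace UPT

-- Reduction to commutative polynomials. A gate at a node of the shape computes a homogeneous
-- polynomial whose degree is the number of variable leaves below that node (`HasShape.value_mem`).
-- So the variable leaves are `d` places, and the word `k_0 ... k_(d-1)` can be replaced by the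
-- commutative monomial with exponent `k_p` at the place variable `y_p`. Words of equal length give
-- different monomials, so a nonzero `f` becomes a nonzero `R` (`placePoly_ne_zero`), and matrices
-- with powers of the `y_p` above the diagonal evaluate `R` at `y` (`lift_stepMatrix`). It remains
-- to find points `y` with `R(y) ≠ 0`.
--
-- What the width gives. The gates at a node span a space of dimension at most `w`, contained in a
-- product of such spaces for the subtrees (`hasDecomposition_shape`). Hence, if `S` is the
-- difference of the leaf sets of two nested subtrees, `R` is a sum of at most `W = w * w` products
-- of a polynomial in the variables from `S` and one in the others
-- (`HasDecomposition.exists_of_dif`).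
--
-- Merging two variables. A nonzero bivariate polynomial of rank at most `W` stays nonzero under `X
-- ↦ Z ^ W`, `Y ↦ Z ^ W * (1 + Z)` (`mergeHom_ne_zero`). Its lowest homogeneous part, of degree `D`
-- say, has at most `W` terms (`card_antidiagonal_le`) and turns into `Z ^ (W * D) * h (1 + Z)` with
-- an equally sparse `h`, while all other terms are divisible by `Z ^ (W * (D + 1))`. A sparse
-- nonzero polynomial cannot vanish at `1` to order `W` if its exponents differ in the field
-- (`eq_zero_of_pow_dvd_of_card_support_le`), so nothing cancels it.
--
-- Iteration. If the places are merged along a binary scheme all of whose clusters are differences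
-- of nested subtrees, then every `y_p` becomes a polynomial `codeVal` in one variable
-- (`exists_replaceOn_ne_zero`). A merge multiplies degrees by at most `W + 1`, so the scheme must
-- have depth `O(log d)` although the shape may be deep. Such a scheme comes from binary counters
-- (`balanced`): the leaves of a tree are split into blocks whose levels are one-bits of the number
-- of leaves. When a lighter tree joins a heavier one, let `E` be the highest bit that this addition
-- changes in the larger count; the lighter tree and the heavy blocks below `E` form a new block of
-- level `E`. Code lengths are paid for by the growth of the levels and by the doubling of the count
-- of the lighter tree.
--
-- Finally `R` becomes a nonzero polynomial in one variable of degree at most `M = n * d * (W + 1) ^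
-- (5 * log d)`, and one of the values `0, ..., M` is not a root. The program computes the codes by
-- recursion along the encoded shape and tabulates the matrices; the matrix entries are large
-- numbers, but their binary lengths obey the required bound.

/-- Binary trees in which some of the leaves are marked. -/
inductive BT where
  | nil : BT
  | leaf : BT
  | br (a b : BT) : BT

/-- The number of marked leaves. -/
def BT.cnt : BT → ℕ
  | nil => 0
  | leaf => 1
  | br a b => a.cnt + b.cnt

/-- One more than the position of the highest binary digit in which `x` and `y` differ, and `0` if
they are equal. -/
def hb (x y : ℕ) : ℕ := if x = y then 0 else hb (x / 2) (y / 2) + 1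
termination_by x + y
decreasing_by omega

theorem hb_self (x : ℕ) : hb x x = 0 := by
  rw [hb]; simp

theorem hb_of_ne {x y : ℕ} (h : x ≠ y) : hb x y = hb (x / 2) (y / 2) + 1 := by
  rw [hb, if_neg h]

theorem hb_le {x y : ℕ} : hb x y ≤ x + y := by
  induction h : x + y using Nat.strong_induction_on generalizing x y with
  | _ n ih =>
    by_cases hxy : x = y
    · subst hxy; simp [hb_self]
    · rw [hb_of_ne hxy]
      have := ih (x / 2 + y / 2) (by omega) rfl
      omega

/-- Halving deletes the lowest bit, and the recursion stops once the numbers agree. Since `x < y`,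
the last distinct pair has the form `2 * q`, `2 * q + 1`. -/
theorem hb_spec {x y : ℕ} (h : x < y) :
    (∀ i, hb x y ≤ i → x.testBit i = y.testBit i) ∧
      x.testBit (hb x y - 1) = false ∧ y.testBit (hb x y - 1) = true := by
  induction hn : y using Nat.strong_induction_on generalizing x y with
  | _ n ih =>
    subst hn
    rw [hb_of_ne h.ne]
    by_cases hxy : x / 2 = y / 2
    · rw [hxy, hb_self]
      refine ⟨fun i hi => ?_, ?_, ?_⟩
      · obtain ⟨i, rfl⟩ : ∃ j, i = j + 1 := ⟨i - 1, by omega⟩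
        rw [Nat.testBit_succ, Nat.testBit_succ, hxy]
      · simp [Nat.testBit_zero]; omega
      · simp [Nat.testBit_zero]; omega
    · obtain ⟨h1, h2, h3⟩ := ih (y / 2) (by omega) (x := x / 2) (y := y / 2) (by omega) rfl
      have hp : hb (x / 2) (y / 2) = hb (x / 2) (y / 2) - 1 + 1 := by
        rw [hb_of_ne hxy]; rfl
      refine ⟨fun i hi => ?_, ?_, ?_⟩
      · obtain ⟨i, rfl⟩ : ∃ j, i = j + 1 := ⟨i - 1, by omega⟩
        rw [Nat.testBit_succ, Nat.testBit_succ]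
        exact h1 i (by omega)
      · rw [Nat.add_sub_cancel, hp, Nat.testBit_succ]; exact h2
      · rw [Nat.add_sub_cancel, hp, Nat.testBit_succ]; exact h3

/-- A gap of `2 ^ K` halves at worst to a gap of `2 ^ (K - 1)`, so the numbers still differ after
`K` halvings. -/
theorem le_hb {x y K : ℕ} (h : x + 2 ^ K ≤ y) : K + 1 ≤ hb x y := by
  have hlt : x < y := lt_of_lt_of_le (Nat.lt_add_of_pos_right (Nat.two_pow_pos K)) h
  induction K generalizing x y with
  | zero => rw [hb_of_ne hlt.ne]; omega
  | succ K ih =>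
    rw [hb_of_ne hlt.ne]
    have : x / 2 + 2 ^ K ≤ y / 2 := by rw [pow_succ] at h; omega
    have := ih this (lt_of_lt_of_le (Nat.lt_add_of_pos_right (Nat.two_pow_pos K)) this)
    omega

/-- Lets the program for `hb` serve as a program for binary logarithms. -/
theorem hb_zero_left {d : ℕ} (hd : d ≠ 0) : hb 0 d = Nat.log 2 d + 1 := by
  induction d using Nat.strong_induction_on with
  | _ d ih =>
    rw [hb_of_ne hd.symm]
    by_cases h : d / 2 = 0
    · have : d = 1 := by omega
      subst this; simp [hb_self]
    · have := ih (d / 2) (by omega) h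
      rw [Nat.zero_div, this, Nat.log_div_base]
      have : 0 < Nat.log 2 d := Nat.log_pos (by omega) (by omega)
      omega

/-- A marked leaf belongs to a block, named by its level, and has a binary code in it. -/
abbrev Rec := ℕ × List Bool

/-- The code that results when all blocks up to level `e` are merged, the lowest first. -/
def flat : ℕ → Rec → List Bool
  | 0, r => r.2
  | e + 1, r => if r.1 ≤ e then true :: flat e r else false :: r.2

/-- How a record changes when a lighter tree is put next to it and forms a block of level `e`. -/
def heavyRec (e : ℕ) (r : Rec) : Rec := if r.1 < e then (e, false :: flat (e - 1) r) else r

/-- How the records of the lighter tree change. -/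
def lightRec (e : ℕ) (r : Rec) : Rec := (e, true :: flat e r)

/-- The level of the block that arises when trees with `m` and `k` marked leaves are joined. -/
def joinLevel (m k : ℕ) : ℕ := hb (max m k) (m + k) - 1

/-- The records of the marked leaves, from left to right. -/
def recs : BT → List Rec
  | .nil => []
  | .leaf => [(0, [])]
  | .br a b =>
    if b.cnt ≤ a.cnt then
      (recs a).map (heavyRec (joinLevel a.cnt b.cnt)) ++
        (recs b).map (lightRec (joinLevel a.cnt b.cnt))
    else
      (recs a).map (lightRec (joinLevel a.cnt b.cnt)) ++
        (recs b).map (heavyRec (joinLevel a.cnt b.cnt))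

theorem length_recs (t : BT) : (recs t).length = t.cnt := by
  induction t with
  | nil => rfl
  | leaf => rfl
  | br a b iha ihb => rw [recs]; split <;> simp [iha, ihb, BT.cnt]

/-- The places of the marked leaves of a tree whose first marked leaf has place `p`. -/
def BT.places (t : BT) (p : ℕ) : Set ℕ := Set.Ico p (p + t.cnt)

/-- The sets that remain when the leaves of a subtree are removed from the leaves of `t`. -/
inductive Seg : BT → ℕ → Set ℕ → Prop
  | empty (t p) : Seg t p ∅
  | full (t : BT) (p) : Seg t p (t.places p)
  | left {a b p S} (h : Seg a p S) : Seg (.br a b) p (S ∪ b.places (p + a.cnt))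
  | right {a b p S} (h : Seg b (p + a.cnt) S) : Seg (.br a b) p (S ∪ a.places p)

/-- The differences of the leaf sets of two nested subtrees. -/
inductive Dif : BT → ℕ → Set ℕ → Prop
  | seg {t p S} (h : Seg t p S) : Dif t p S
  | left {a b p S} (h : Dif a p S) : Dif (.br a b) p S
  | right {a b p S} (h : Dif b (p + a.cnt) S) : Dif (.br a b) p S

theorem Dif.empty (t p) : Dif t p ∅ := .seg (.empty t p)

/-- The places of the records with property `P` in a list that starts at place `p`. -/
def cl (l : List Rec) (p : ℕ) (P : Rec → Prop) : Set ℕ :=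
  {i | ∃ k r, l[k]? = some r ∧ P r ∧ i = p + k}

theorem cl_append (l₁ l₂ : List Rec) (p : ℕ) (P : Rec → Prop) :
    cl (l₁ ++ l₂) p P = cl l₁ p P ∪ cl l₂ (p + l₁.length) P := by
  ext i
  simp only [cl, Set.mem_ofPred_eq, Set.mem_union]
  constructor
  · rintro ⟨k, r, hk, hr, rfl⟩
    rw [List.getElem?_append] at hk
    split at hk
    · exact .inl ⟨k, r, hk, hr, rfl⟩
    · exact .inr ⟨k - l₁.length, r, hk, hr, by omega⟩
  · rintro (⟨k, r, hk, hr, rfl⟩ | ⟨k, r, hk, hr, rfl⟩)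
    · refine ⟨k, r, ?_, hr, rfl⟩
      rw [List.getElem?_append_left (List.getElem?_eq_some_iff.1 hk).1, hk]
    · refine ⟨l₁.length + k, r, ?_, hr, by omega⟩
      rw [List.getElem?_append_right (by omega), Nat.add_sub_cancel_left, hk]

theorem cl_map (l : List Rec) (f : Rec → Rec) (p : ℕ) (P : Rec → Prop) :
    cl (l.map f) p P = cl l p fun r => P (f r) := by
  ext i
  constructor
  · rintro ⟨k, r, hk, hr, rfl⟩
    rw [List.getElem?_map, Option.map_eq_some_iff] at hk
    obtain ⟨s, hs, rfl⟩ := hk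
    exact ⟨k, s, hs, hr, rfl⟩
  · rintro ⟨k, r, hk, hr, rfl⟩
    exact ⟨k, f r, by rw [List.getElem?_map, hk]; rfl, hr, rfl⟩

theorem cl_congr {l : List Rec} {p : ℕ} {P Q : Rec → Prop} (h : ∀ r ∈ l, (P r ↔ Q r)) :
    cl l p P = cl l p Q := by
  ext i
  constructor <;> rintro ⟨k, r, hk, hr, rfl⟩
  · exact ⟨k, r, hk, (h r (List.mem_of_getElem? hk)).1 hr, rfl⟩
  · exact ⟨k, r, hk, (h r (List.mem_of_getElem? hk)).2 hr, rfl⟩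

theorem cl_false {l : List Rec} {p : ℕ} {P : Rec → Prop} (h : ∀ r ∈ l, ¬ P r) :
    cl l p P = ∅ := by
  ext i
  simp only [Set.mem_empty_iff_false, iff_false]
  rintro ⟨k, r, hk, hr, rfl⟩
  exact h r (List.mem_of_getElem? hk) hr

theorem cl_true {l : List Rec} {p : ℕ} {P : Rec → Prop} (h : ∀ r ∈ l, P r) :
    cl l p P = Set.Ico p (p + l.length) := by
  ext i
  constructor
  · rintro ⟨k, r, hk, hr, rfl⟩
    have := (List.getElem?_eq_some_iff.1 hk).1
    simp [this]
  · rintro ⟨h1, h2⟩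
    have : i - p < l.length := by omega
    exact ⟨i - p, l[i - p], List.getElem?_eq_getElem this, h _ (List.getElem_mem _), by omega⟩

/-- The records describe a system of blocks that are differences of nested subtrees. -/
structure Balanced (t : BT) : Prop where
  bit : ∀ r ∈ recs t, t.cnt.testBit r.1 = true
  seg : ∀ p e, Seg t p (cl (recs t) p fun r => r.1 ≤ e)
  dif : ∀ p e u, Dif t p (cl (recs t) p fun r => r.1 = e ∧ u <+: r.2)
  pf : (recs t).Pairwise fun r s => r.1 = s.1 → ¬ r.2 <+: s.2 ∧ ¬ s.2 <+: r.2
  dep : ∀ r ∈ recs t, r.2.length ≤ 2 * r.1 + 2 * Nat.log 2 t.cnt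

theorem Balanced.le_log {t : BT} (h : Balanced t) {r : Rec} (hr : r ∈ recs t) :
    r.1 ≤ Nat.log 2 t.cnt :=
  Nat.le_log_of_pow_le (by norm_num) (Nat.ge_two_pow_of_testBit (h.bit r hr))

/-- A flattened code descends from the highest level: `false` enters the block at hand, `true`
passes to the blocks below. So a prefix selects either all blocks up to some level, or a part of a
single block; level `0` is entered without a mark. -/
theorem Balanced.dif_flat {t : BT} (h : Balanced t) (p e : ℕ) (u : List Bool) :
    Dif t p (cl (recs t) p fun r => r.1 ≤ e ∧ u <+: flat e r) := by
  induction e generalizing u with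
  | zero => simpa [flat] using h.dif p 0 u
  | succ e ih =>
    rcases u with _ | ⟨_ | _, u⟩
    · simpa using Dif.seg (h.seg p (e + 1))
    · convert h.dif p (e + 1) u using 1
      refine cl_congr fun r _ => ?_
      rw [flat]
      split
      · simp; omega
      · simp; omega
    · convert ih u using 1
      refine cl_congr fun r _ => ?_
      rw [flat]
      split
      · simp; omega
      · simp; omega

theorem flat_pf {r s : Rec} (h : r.1 = s.1 → ¬ r.2 <+: s.2 ∧ ¬ s.2 <+: r.2) {e : ℕ}
    (hr : r.1 ≤ e) (hs : s.1 ≤ e) : ¬ flat e r <+: flat e s ∧ ¬ flat e s <+: flat e r := by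
  induction e with
  | zero => exact h (by omega)
  | succ e ih =>
    simp only [flat]
    split <;> split
    · simpa using ih ‹_› ‹_›
    · simp
    · simp
    · simpa using h (by omega)

/-- The last summand is the letter `false` on entering the block, which level `0` does not need. -/
theorem length_flat {r : Rec} {e : ℕ} (hr : r.1 ≤ e) :
    (flat e r).length = r.2.length + (e - r.1) + min r.1 1 := by
  induction e with
  | zero => simp [flat]; omega
  | succ e ih =>
    rw [flat]
    split
    · rw [List.length_cons, ih ‹_›]; omega
    · rw [List.length_cons]; omega

theorem Balanced.length_flat_le {t : BT} (h : Balanced t) {r : Rec} (hr : r ∈ recs t) :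
    (flat (Nat.log 2 t.cnt) r).length ≤ 5 * Nat.log 2 t.cnt := by
  rw [length_flat (h.le_log hr)]
  have := h.dep r hr
  have := h.le_log hr
  omega

/-- The effect of the addition on a binary counter: bits above the level stay, and at the level a
`0` turns into a `1`. Since `2 ^ log k ≤ k`, the level is at least as high as every block of the
lighter tree. -/
theorem joinLevel_spec {m k : ℕ} (hk : 0 < k) (hkm : k ≤ m) :
    (∀ i, joinLevel m k < i → m.testBit i = (m + k).testBit i) ∧
      m.testBit (joinLevel m k) = false ∧ (m + k).testBit (joinLevel m k) = true ∧
      Nat.log 2 k ≤ joinLevel m k := by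
  rw [joinLevel, max_eq_left hkm]
  obtain ⟨h1, h2, h3⟩ := hb_spec (x := m) (y := m + k) (by omega)
  have h4 : Nat.log 2 k + 1 ≤ hb m (m + k) :=
    le_hb (Nat.add_le_add_left (Nat.pow_log_le_self 2 hk.ne') m)
  exact ⟨fun i hi => h1 i (by omega), h2, h3, by omega⟩

theorem joinLevel_comm (m k : ℕ) : joinLevel m k = joinLevel k m := by
  rw [joinLevel, joinLevel, max_comm, add_comm]

/-- The inductive step for `Balanced`, for a heavier tree `x` and a lighter tree `y`. -/
theorem balanced_join {t x y : BT} {f g : ℕ → ℕ} (hx : Balanced x) (hy : Balanced y)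
    (hyx : y.cnt ≤ x.cnt) (hcnt : t.cnt = x.cnt + y.cnt)
    (hmem : ∀ r, r ∈ recs t ↔ r ∈ (recs x).map (heavyRec (joinLevel x.cnt y.cnt)) ∨
      r ∈ (recs y).map (lightRec (joinLevel x.cnt y.cnt)))
    (hcl : ∀ p P, cl (recs t) p P =
      cl ((recs x).map (heavyRec (joinLevel x.cnt y.cnt))) (f p) P ∪
        cl ((recs y).map (lightRec (joinLevel x.cnt y.cnt))) (g p) P)
    (hperm : (recs t).Perm ((recs x).map (heavyRec (joinLevel x.cnt y.cnt)) ++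
        (recs y).map (lightRec (joinLevel x.cnt y.cnt))))
    (hseg : ∀ p S, Seg x (f p) S → Seg t p (S ∪ y.places (g p)))
    (hdx : ∀ p S, Dif x (f p) S → Dif t p S) (hdy : ∀ p S, Dif y (g p) S → Dif t p S) :
    Balanced t := by
  -- If the lighter tree has no marked leaves, the level is `0` by truncated subtraction, and
  -- `heavyRec 0` changes no record.
  rcases Nat.eq_zero_or_pos y.cnt with hy0 | hy0
  · have hny : recs y = [] := List.length_eq_zero_iff.1 (by rw [length_recs, hy0])
    have hh : (heavyRec (joinLevel x.cnt y.cnt)) = fun r => r := by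
      rw [hy0, joinLevel, add_zero, max_eq_left (Nat.zero_le _), hb_self]
      funext r; simp [heavyRec]
    have he : ∀ p, y.places (g p) = ∅ := fun p => by simp [BT.places, hy0]
    simp only [hh, hny, List.map_id', List.map_nil, List.append_nil, List.not_mem_nil,
      or_false] at hmem hcl hperm
    have hcl' : ∀ p P, cl (recs t) p P = cl (recs x) (f p) P := fun p P => by
      rw [hcl, cl_false (l := []) (by simp), Set.union_empty]
    rw [hy0, add_zero] at hcnt
    refine ⟨fun r hr => ?_, fun p e => ?_, fun p e u => ?_, ?_, fun r hr => ?_⟩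
    · rw [hcnt]; exact hx.bit r ((hmem r).1 hr)
    · rw [hcl']; simpa [he] using hseg p _ (hx.seg (f p) e)
    · rw [hcl']; exact hdx p _ (hx.dif (f p) e u)
    · exact (hperm.pairwise_iff (fun {a b} h h' => (h h'.symm).symm)).2 hx.pf
    · rw [hcnt]; exact hx.dep r ((hmem r).1 hr)
  obtain ⟨hb1, hb2, hb3, hb4⟩ := joinLevel_spec hy0 hyx
  set E := joinLevel x.cnt y.cnt with hE
  -- Bit `E` of the larger count is `0`, so the level of the new block is not taken.
  have hxE : ∀ r ∈ recs x, r.1 ≠ E := fun r hr h => by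
    have := hx.bit r hr
    rw [h, hb2] at this
    exact Bool.noConfusion this
  have hyE : ∀ r ∈ recs y, r.1 ≤ E := fun r hr => (hy.le_log hr).trans hb4
  have hlogx : Nat.log 2 x.cnt ≤ Nat.log 2 t.cnt := Nat.log_mono_right (by omega)
  -- Joining at least doubles the count of the lighter tree. The bound in `dep` thereby gains two
  -- letters for light records.
  have hlogy : Nat.log 2 y.cnt + 1 ≤ Nat.log 2 t.cnt := by
    rw [← Nat.log_mul_base (by norm_num) hy0.ne']
    exact Nat.log_mono_right (by omega)
  refine ⟨fun r hr => ?_, fun p e => ?_, fun p e u => ?_, ?_, fun r hr => ?_⟩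
  · rw [hcnt]
    rcases (hmem r).1 hr with h | h <;> obtain ⟨s, hs, rfl⟩ := List.mem_map.1 h
    · rw [heavyRec]
      split
      · exact hb3
      · rw [← hb1 _ (by have := hxE s hs; omega)]
        exact hx.bit s hs
    · exact hb3
  · rw [hcl, cl_map, cl_map]
    -- Below `E` no block is left. From `E` on, the lighter tree is contained as a whole, next to a
    -- segment of the heavier one.
    by_cases he : e < E
    · rw [cl_false, cl_false]
      · simpa using Seg.empty t p
      · intro r _; simp [lightRec]; omega
      · intro r _; rw [heavyRec]; split <;> simp <;> omega
    · rw [cl_true (l := recs y) (fun r _ => by simp [lightRec]; omega), length_recs]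
      change Seg t p (_ ∪ y.places (g p))
      convert hseg p _ (hx.seg (f p) e) using 2
      refine cl_congr fun r hr => ?_
      rw [heavyRec]; split <;> simp; omega
  · rw [hcl, cl_map, cl_map]
    by_cases he : e = E
    · subst he
      -- In the new block, the empty prefix selects everything, the letter `false` the heavy part,
      -- and `true` the light part.
      rcases u with _ | ⟨_ | _, u⟩
      · rw [cl_true (l := recs y) (fun r _ => by simp [lightRec]), length_recs]
        change Dif t p (_ ∪ y.places (g p))
        -- If `E = 0`, no heavy block lies below it, and `E - 1` would not mean the level
        -- underneath.
        by_cases hE0 : E = 0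
        · rw [cl_false (l := recs x)]
          · exact .seg (hseg p _ (.empty _ _))
          · intro r hr
            have := hxE r hr
            simp [heavyRec, hE0]; omega
        · convert Dif.seg (hseg p _ (hx.seg (f p) (E - 1))) using 2
          refine cl_congr fun r hr => ?_
          have := hxE r hr
          rw [heavyRec]; split <;> simp <;> omega
      · rw [cl_false (l := recs y) (fun r _ => by simp [lightRec]), Set.union_empty]
        by_cases hE0 : E = 0
        · rw [cl_false (l := recs x)]
          · exact Dif.empty _ _
          · intro r hr
            have := hxE r hr
            simp [heavyRec, hE0]; omega
        · convert hdx p _ (hx.dif_flat (f p) (E - 1) u) using 1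
          refine cl_congr fun r hr => ?_
          have := hxE r hr
          rw [heavyRec]
          split
          · simp; omega
          · constructor
            · intro h; omega
            · intro h; omega
      · rw [cl_false (l := recs x), Set.empty_union]
        · convert hdy p _ (hy.dif_flat (g p) E u) using 1
          refine cl_congr fun r hr => ?_
          simp [lightRec, hyE r hr]
        · intro r hr
          have := hxE r hr
          rw [heavyRec]; split <;> simp; omega
    · rw [cl_false (l := recs y) (fun r _ => by simp [lightRec]; omega), Set.union_empty]
      by_cases he' : e < E
      · rw [cl_false (l := recs x)]
        · exact Dif.empty _ _
        · intro r hr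
          rw [heavyRec]; split <;> simp <;> omega
      · convert hdx p _ (hx.dif (f p) e u) using 1
        refine cl_congr fun r hr => ?_
        rw [heavyRec]; split
        · simp; omega
        · rfl
  · refine (hperm.pairwise_iff (fun {a b} h h' => (h h'.symm).symm)).2 ?_
    rw [List.pairwise_append, List.pairwise_map, List.pairwise_map]
    refine ⟨hx.pf.imp_of_mem ?_, hy.pf.imp_of_mem ?_, ?_⟩
    · intro r s hr hs h
      have := hxE r hr
      have := hxE s hs
      simp only [heavyRec]
      split <;> split
      · simpa using flat_pf h (e := E - 1) (by omega) (by omega)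
      · intro h'; exact absurd h'.symm (hxE s hs)
      · intro h'; exact absurd h' (hxE r hr)
      · exact h
    · intro r s hr hs h
      simpa [lightRec] using flat_pf h (hyE r hr) (hyE s hs)
    · intro r hr s hs
      obtain ⟨r, hr', rfl⟩ := List.mem_map.1 hr
      obtain ⟨s, hs', rfl⟩ := List.mem_map.1 hs
      rw [heavyRec, lightRec]
      split
      · simp
      · intro h'; exact absurd h' (hxE r hr')
  -- A heavy record that moves up to level `E` gains at most `E - r.1 + 1` letters, which twice the
  -- rise of its level covers. A light record may gain two more than its rise; these are paid by
  -- `hlogy`.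
  · rcases (hmem r).1 hr with h | h <;> obtain ⟨s, hs, rfl⟩ := List.mem_map.1 h
    · have := hx.dep s hs
      rw [heavyRec]
      split
      · rw [List.length_cons, length_flat (by omega)]
        dsimp only
        omega
      · omega
    · have := hy.dep s hs
      have := hyE s hs
      rw [lightRec, List.length_cons, length_flat (hyE s hs)]
      dsimp only
      omega

theorem balanced (t : BT) : Balanced t := by
  induction t with
  | nil =>
    refine ⟨by simp [recs], fun p e => ?_, fun p e u => ?_, by simp [recs], by simp [recs]⟩
    · rw [cl_false (by simp [recs])]; exact .empty _ _
    · rw [cl_false (by simp [recs])]; exact .empty _ _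
  | leaf =>
    refine ⟨by simp [recs, BT.cnt], fun p e => ?_, fun p e u => ?_, by simp [recs],
      by simp [recs]⟩
    · rw [cl_true (by simp [recs])]; exact .full _ _
    · by_cases h : e = 0 ∧ u = []
      · rw [cl_true (by simp [recs, h])]; exact .seg (.full _ _)
      · rw [cl_false (by simp [recs]; grind)]; exact .empty _ _
  | br a b iha ihb =>
    by_cases h : b.cnt ≤ a.cnt
    · have hr : recs (.br a b) = (recs a).map (heavyRec (joinLevel a.cnt b.cnt)) ++
        (recs b).map (lightRec (joinLevel a.cnt b.cnt)) := by rw [recs, if_pos h]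
      refine balanced_join (x := a) (y := b) (f := fun p => p) (g := fun p => p + a.cnt)
        iha ihb h rfl ?_ ?_ ?_ (fun p S hS => hS.left) (fun p S hS => hS.left)
        (fun p S hS => hS.right)
      · intro r; rw [hr, List.mem_append]
      · intro p P; rw [hr, cl_append, List.length_map, length_recs]
      · rw [hr]
    · have hr : recs (.br a b) = (recs a).map (lightRec (joinLevel b.cnt a.cnt)) ++
        (recs b).map (heavyRec (joinLevel b.cnt a.cnt)) := by
        rw [recs, if_neg h, joinLevel_comm]
      refine balanced_join (x := b) (y := a) (f := fun p => p + a.cnt) (g := fun p => p)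
        ihb iha (by omega) (by rw [BT.cnt, add_comm]) ?_ ?_ ?_ (fun p S hS => hS.right)
        (fun p S hS => hS.right) (fun p S hS => hS.left)
      · intro r; rw [hr, List.mem_append, or_comm]
      · intro p P; rw [hr, cl_append, List.length_map, length_recs, Set.union_comm]
      · rw [hr]; exact List.perm_append_comm

end UPT

-- Merging the two variables of a bivariate polynomial of low rank.

namespace UPT
open Polynomial

section Merge
variable {K : Type*} [Field K]

theorem pow_dvd_X_mul_derivative {m : ℕ} {h : K[X]} (hd : (X - 1) ^ (m + 1) ∣ h) :
    (X - 1) ^ m ∣ X * derivative h := by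
  obtain ⟨q, rfl⟩ := hd
  refine Dvd.dvd.mul_left ?_ _
  rw [derivative_mul, derivative_pow]
  refine dvd_add ?_ ?_
  · rw [Nat.add_sub_cancel]
    exact ((Dvd.intro_left _ rfl).mul_right _).mul_right _
  · exact (pow_dvd_pow _ (Nat.le_succ m)).mul_right _

/-- The operator `X * d/dX` multiplies the coefficient of `X ^ j` by `j` and lowers the order of
vanishing at `1` by at most one. After `k < W` applications the polynomial still vanishes at `1`. -/
theorem sum_coeff_mul_pow_eq_zero {W k : ℕ} {h : K[X]} (hd : (X - 1) ^ W ∣ h) (hk : k < W) :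
    ∑ j ∈ h.support, h.coeff j * (j : K) ^ k = 0 := by
  have key : ∀ k ≤ W, ∃ g : K[X], (X - 1) ^ (W - k) ∣ g ∧
      ∀ j, g.coeff j = h.coeff j * (j : K) ^ k := by
    intro k
    induction k with
    | zero => exact fun _ => ⟨h, hd, by simp⟩
    | succ k ih =>
      intro hk
      obtain ⟨g, hg, hc⟩ := ih (by omega)
      refine ⟨X * derivative g, pow_dvd_X_mul_derivative ?_, fun j => ?_⟩
      · rwa [show W - (k + 1) + 1 = W - k by omega]
      · cases j with
        | zero => simp
        | succ j => rw [coeff_X_mul, coeff_derivative, hc]; push_cast; ring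
  obtain ⟨g, hg, hc⟩ := key k hk.le
  have h1 : g.eval 1 = 0 := by
    refine eval_eq_zero_of_dvd_of_eval_eq_zero ((dvd_pow_self _ (by omega)).trans hg) (by simp)
  rw [eval_eq_sum, sum_def] at h1
  simp only [one_pow, mul_one] at h1
  rw [← h1]
  refine (Finset.sum_congr rfl fun j _ => (hc j).symm).trans (Finset.sum_subset ?_ ?_).symm
  · intro j hj
    rw [mem_support_iff, hc] at hj
    exact mem_support_iff.2 (left_ne_zero_of_mul hj)
  · intro j _ hj
    exact notMem_support_iff.1 hj

/-- A sparse polynomial does not vanish at `1` to a high order. -/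
theorem eq_zero_of_pow_dvd_of_card_support_le {W : ℕ} {h : K[X]} (hd : (X - 1) ^ W ∣ h)
    (hc : h.support.card ≤ W) (hinj : Set.InjOn (Nat.cast : ℕ → K) h.support) : h = 0 := by
  classical
  by_contra hne
  obtain ⟨j₀, hj₀⟩ := Polynomial.support_nonempty.2 hne
  -- The moments of the coefficients of order less than `W` vanish, so `h.coeff` is orthogonal to
  -- `g`. As `g` is zero at all exponents other than `j₀`, only one term of that pairing survives.
  set g : K[X] := ∏ j ∈ h.support.erase j₀, (X - C (j : K)) with hg
  have hdeg : g.natDegree < W := by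
    rw [hg, natDegree_prod_of_monic _ _ fun j _ => monic_X_sub_C _]
    simp only [natDegree_X_sub_C, Finset.sum_const, smul_eq_mul, mul_one]
    exact lt_of_lt_of_le (Finset.card_erase_lt_of_mem hj₀) hc
  have h0 : ∑ j ∈ h.support, h.coeff j * g.eval (j : K) = 0 := by
    simp only [eval_eq_sum_range' hdeg, Finset.mul_sum]
    rw [Finset.sum_comm]
    refine Finset.sum_eq_zero fun k hk => ?_
    have := sum_coeff_mul_pow_eq_zero hd (Finset.mem_range.1 hk)
    rw [← mul_zero (g.coeff k), ← this, Finset.mul_sum]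
    exact Finset.sum_congr rfl fun j _ => by ring
  rw [Finset.sum_eq_single_of_mem j₀ hj₀] at h0
  · rcases mul_eq_zero.1 h0 with h1 | h1
    · exact mem_support_iff.1 hj₀ h1
    · rw [hg, eval_prod, Finset.prod_eq_zero_iff] at h1
      obtain ⟨j, hj, h2⟩ := h1
      rw [Finset.mem_erase] at hj
      simp only [eval_sub, eval_X, eval_C, sub_eq_zero] at h2
      exact hj.1 (hinj hj.2 hj₀ h2.symm)
  · intro j hj hne
    rw [hg, eval_prod, Finset.prod_eq_zero (Finset.mem_erase.2 ⟨hne, hj⟩) (by simp), mul_zero]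

/-- The lowest antidiagonal of a matrix of rank at most `W` has at most `W` nonzero entries. -/
theorem card_antidiagonal_le {ι : Type*} [Fintype ι] {c : ℕ → ℕ → K} {α β : ι → ℕ → K}
    (hc : ∀ i j, c i j = ∑ r, α r i * β r j) {D : ℕ} (hD : ∀ i j, i + j < D → c i j = 0)
    (J : Finset ℕ) (hJD : ∀ j ∈ J, j ≤ D) (hJ : ∀ j ∈ J, c (D - j) j ≠ 0) :
    J.card ≤ Fintype.card ι := by
  classical
  -- The entry at `(j, j')` lies on the antidiagonal `D - j + j'`, which is below `D` for `j' < j`.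
  -- So the matrix is triangular with a nonzero diagonal, while its rank is at most the size of `ι`.
  let M : Matrix J J K := Matrix.of fun j j' => c (D - j) j'
  have hM : M = (Matrix.of fun (j : J) r => α r (D - j)) * (Matrix.of fun r (j : J) => β r j) := by
    ext j j'
    simp [M, Matrix.mul_apply, hc]
  have hdet : M.det ≠ 0 := by
    rw [Matrix.det_of_isUpperTriangular]
    · exact Finset.prod_ne_zero_iff.2 fun j _ => hJ j j.2
    · intro j j' hlt
      have h1 : (j' : ℕ) < j := hlt
      have h2 := hJD j j.2
      exact hD _ _ (by omega)
  have hr : M.rank = Fintype.card J :=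
    Matrix.rank_of_isUnit M ((Matrix.isUnit_iff_isUnit_det M).2 (isUnit_iff_ne_zero.2 hdet))
  rw [← Fintype.card_coe J, ← hr, hM]
  exact (Matrix.rank_mul_le_left _ _).trans (Matrix.rank_le_card_width _)

/-- The substitution `X ↦ Z ^ W`, `Y ↦ Z ^ W * (1 + Z)`. -/
noncomputable def mergeHom (K : Type*) [Field K] (W : ℕ) : K[X][X] →+* K[X] :=
  eval₂RingHom (aeval (X ^ W : K[X])).toRingHom (X ^ W * (1 + X))

theorem mergeHom_apply (W : ℕ) (B : K[X][X]) {N : ℕ} (hN : B.natDegree < N)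
    (hN' : ∀ j, (B.coeff j).natDegree < N) :
    mergeHom K W B = ∑ j ∈ Finset.range N, ∑ i ∈ Finset.range N,
      C ((B.coeff j).coeff i) * X ^ (W * (i + j)) * (1 + X) ^ j := by
  rw [mergeHom, coe_eval₂RingHom, eval₂_eq_sum_range' _ hN]
  refine Finset.sum_congr rfl fun j _ => ?_
  change aeval (X ^ W) (B.coeff j) * _ = _
  rw [aeval_eq_sum_range' (hN' j), Finset.sum_mul]
  refine Finset.sum_congr rfl fun i _ => ?_
  rw [smul_eq_C_mul, mul_pow]
  ring

/-- The factor `X ^ W` in both substituted values separates the total degrees of `B` by `W` orders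
of vanishing at `0`; the factor `1 + X` then tells apart the at most `W` monomials of lowest degree.
The exponents to be distinguished are those of the outer variable only, hence the form of `hinj`. -/
theorem mergeHom_ne_zero {ι : Type*} [Fintype ι] {W : ℕ} (hW : Fintype.card ι ≤ W)
    {B : K[X][X]} (hB : B ≠ 0) (a b : ι → K[X]) (hab : B = ∑ r, C (a r) * (b r).map C)
    (hinj : Set.InjOn (Nat.cast : ℕ → K) (Set.Iic B.natDegree)) : mergeHom K W B ≠ 0 := by
  classical
  intro h0
  set c : ℕ → ℕ → K := fun i j => (B.coeff j).coeff i with hcdef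
  have hc : ∀ i j, c i j = ∑ r, (a r).coeff i * (b r).coeff j := by
    intro i j
    simp only [hcdef, hab, finsetSum_coeff, coeff_C_mul, coeff_map, coeff_mul_C]
  have hex : ∃ D, ∃ i j, i + j = D ∧ c i j ≠ 0 := by
    obtain ⟨j, hj⟩ := Polynomial.support_nonempty.2 hB
    obtain ⟨i, hi⟩ := Polynomial.support_nonempty.2 (mem_support_iff.1 hj)
    exact ⟨_, i, j, rfl, mem_support_iff.1 hi⟩
  obtain ⟨i₀, j₀, hij, hne⟩ := Nat.find_spec hex
  have hD : ∀ i j, i + j < Nat.find hex → c i j = 0 := by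
    intro i j hlt
    by_contra hne
    exact Nat.find_min hex hlt ⟨i, j, rfl, hne⟩
  set D := Nat.find hex
  -- The dehomogenised lowest part of `B`.
  set h : K[X] := ∑ j ∈ Finset.range (D + 1), C (c (D - j) j) * X ^ j with hh
  have hcoef : ∀ j, h.coeff j = if j ≤ D then c (D - j) j else 0 := by
    intro j
    simp only [hh, finsetSum_coeff, coeff_C_mul_X_pow]
    simp
  have hsup : ∀ j ∈ h.support, j ≤ D ∧ c (D - j) j ≠ 0 := by
    intro j hj
    rw [mem_support_iff, hcoef] at hj
    by_cases hjD : j ≤ D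
    · exact ⟨hjD, by simpa [hjD] using hj⟩
    · simp [hjD] at hj
  have hh0 : h ≠ 0 := by
    intro h1
    have := hcoef j₀
    rw [h1, if_pos (by omega), show D - j₀ = i₀ by omega] at this
    exact hne this.symm
  have hjdeg : ∀ j ∈ h.support, j ≤ B.natDegree := by
    intro j hj
    refine le_natDegree_of_ne_zero fun h1 => (hsup j hj).2 ?_
    simp [hcdef, h1]
  refine hh0 (eq_zero_of_pow_dvd_of_card_support_le (W := W) ?_ ?_ ?_)
  · obtain ⟨N, hN, hN', hND⟩ : ∃ N, B.natDegree < N ∧ (∀ j, (B.coeff j).natDegree < N) ∧ D < N := by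
      refine ⟨B.natDegree + 1 + (B.support.sup fun j => (B.coeff j).natDegree) + D + 1, by omega,
        fun j => ?_, by omega⟩
      by_cases hj : j ∈ B.support
      · have := Finset.le_sup (f := fun j => (B.coeff j).natDegree) hj
        omega
      · rw [notMem_support_iff.1 hj, natDegree_zero]; omega
    rw [mergeHom_apply W B hN hN'] at h0
    have hlow : (X : K[X]) ^ (W * D) * h.comp (1 + X) = ∑ j ∈ Finset.range N,
        ∑ i ∈ Finset.range N, if i + j = D then
          C (c i j) * X ^ (W * (i + j)) * (1 + X) ^ j else 0 := by
      have : h.comp (1 + X) = ∑ j ∈ Finset.range N,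
          if j ≤ D then C (c (D - j) j) * (1 + X) ^ j else 0 := by
        rw [hh, Polynomial.sum_comp, ← Finset.sum_filter]
        refine Finset.sum_congr ?_ fun j _ => by simp
        ext j; simp; omega
      rw [this, Finset.mul_sum]
      refine Finset.sum_congr rfl fun j _ => ?_
      split
      · rw [Finset.sum_eq_single (D - j)]
        · rw [if_pos (by omega), show D - j + j = D by omega]; ring
        · intro i _ hi
          rw [if_neg (by omega)]
        · intro hi
          exact absurd (Finset.mem_range.2 (by omega)) hi
      · rw [mul_zero, Finset.sum_eq_zero]
        intro i _
        rw [if_neg (by omega)]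
    -- As the whole sum is zero, the lowest part is the negative of the rest; there the coefficients
    -- with `i + j < D` vanish and all other terms have the factor `X ^ (W * (D + 1))`.
    have hdvd : (X : K[X]) ^ (W * D) * X ^ W ∣ X ^ (W * D) * h.comp (1 + X) := by
      rw [← dvd_neg, ← zero_sub]
      nth_rewrite 1 [← h0]
      rw [hlow, ← Finset.sum_sub_distrib]
      refine Finset.dvd_sum fun j _ => ?_
      rw [← Finset.sum_sub_distrib]
      refine Finset.dvd_sum fun i _ => ?_
      split
      · exact ⟨0, by simp [hcdef]⟩
      · rcases lt_or_ge (i + j) D with hlt | hge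
        · have := hD i j hlt
          simp only [hcdef] at this
          simp [this]
        · rw [sub_zero, ← pow_add, ← Nat.mul_succ]
          refine (Dvd.dvd.mul_left (pow_dvd_pow _ (Nat.mul_le_mul_left _ (by omega))) _).mul_right _
    have hX := (mul_dvd_mul_iff_left (pow_ne_zero _ X_ne_zero)).1 hdvd
    obtain ⟨q, hq⟩ := hX
    -- Shifting `0` back to `1` turns divisibility by `X ^ W` into divisibility by `(X - 1) ^ W`.
    refine ⟨q.comp (X - 1), ?_⟩
    have := congrArg (fun p : K[X] => p.comp (X - 1)) hq
    simpa [comp_assoc] using this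
  · refine (card_antidiagonal_le (c := c) hc hD h.support (fun j hj => (hsup j hj).1)
      fun j hj => (hsup j hj).2).trans hW
  · intro j hj k hk hjk
    exact hinj (hjdeg j hj) (hjdeg k hk) hjk

end Merge

-- Iterated merging along a binary scheme.

/-- The value at a leaf with a given code, when the value at the root of the merging is `v`. -/
def codeVal {A : Type*} [CommSemiring A] (W : ℕ) : A → List Bool → A
  | v, [] => v
  | v, b :: u => codeVal W (v ^ W * (if b then 1 + v else 1)) u

/-- The same code is evaluated at numbers, at field elements and at polynomial variables; this
compares the results. -/
theorem map_codeVal {A B G : Type*} [CommSemiring A] [CommSemiring B] [FunLike G A B]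
    [RingHomClass G A B] (φ : G) (W : ℕ) (v : A) (u : List Bool) :
    φ (codeVal W v u) = codeVal W (φ v) u := by
  induction u generalizing v with
  | nil => rfl
  | cons b u ih => cases b <;> simp [codeVal, ih]

theorem natDegree_codeVal_le {A : Type*} [CommRing A] (W : ℕ) (v : A[X]) (u : List Bool) :
    (codeVal W v u).natDegree ≤ v.natDegree * (W + 1) ^ u.length := by
  induction u generalizing v with
  | nil => simp [codeVal]
  | cons b u ih =>
    refine (ih _).trans ?_
    rw [List.length_cons, pow_succ', ← mul_assoc]
    refine Nat.mul_le_mul_right _ ?_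
    refine natDegree_mul_le.trans ?_
    rw [mul_add, mul_one, mul_comm _ W]
    refine add_le_add natDegree_pow_le ?_
    split
    · refine (natDegree_add_le _ _).trans ?_
      simp
    · simp

theorem natDegree_aeval_le {F A : Type*} [Field F] [CommRing A] [Algebra F A]
    {R : MvPolynomial ℕ F} {n d : ℕ} (hv : (R.vars : Set ℕ) ⊆ Set.Iio d)
    (hn : ∀ i, R.degreeOf i ≤ n) (g : ℕ → A[X]) :
    (MvPolynomial.aeval g R).natDegree ≤ ∑ i ∈ Finset.range d, n * (g i).natDegree := by
  rw [MvPolynomial.aeval_def, MvPolynomial.eval₂_eq]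
  refine natDegree_sum_le_of_forall_le _ _ fun m hm => ?_
  rw [IsScalarTower.algebraMap_apply F A A[X]]
  refine (natDegree_C_mul_le _ _).trans ((natDegree_prod_le _ _).trans ?_)
  have hsub : m.support ⊆ Finset.range d := by
    intro i hi
    exact Finset.mem_range.2 (hv (MvPolynomial.mem_vars_iff_mem_support i |>.2 ⟨m, hm, hi⟩))
  refine (Finset.sum_le_sum_of_subset hsub).trans (Finset.sum_le_sum fun i _ => ?_)
  refine natDegree_pow_le.trans (Nat.mul_le_mul_right _ ?_)
  exact (MvPolynomial.monomial_le_degreeOf i hm).trans (hn i)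

/-- The rank of `R` with respect to the partition of the variables into `S` and its complement is
at most `W`. -/
def CutRank {F : Type*} [Field F] (W : ℕ) (S : Set ℕ) (R : MvPolynomial ℕ F) : Prop :=
  ∃ A : Finset (MvPolynomial ℕ F), A.card ≤ W ∧ (∀ a ∈ A, a ∈ MvPolynomial.supported F S) ∧
    R ∈ Submodule.span F (A : Set (MvPolynomial ℕ F)) *
      Subalgebra.toSubmodule (MvPolynomial.supported F Sᶜ)

theorem mem_span_finset_mul {F A : Type*} [Field F] [CommRing A] [Algebra F A] {s : Finset A}
    {P : Submodule F A} {x : A} (hx : x ∈ Submodule.span F (s : Set A) * P) :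
    ∃ b : s → A, (∀ r, b r ∈ P) ∧ x = ∑ r : s, (r : A) * b r := by
  classical
  refine Submodule.mul_induction_on hx ?_ ?_
  · intro m hm p hp
    obtain ⟨f, rfl⟩ := (Submodule.mem_span_finset').1 hm
    refine ⟨fun r => f r • p, fun r => P.smul_mem _ hp, ?_⟩
    rw [Finset.sum_mul]
    exact Finset.sum_congr rfl fun r _ => by rw [smul_mul_assoc, mul_smul_comm]
  · rintro x y ⟨b, hb, rfl⟩ ⟨b', hb', rfl⟩
    exact ⟨fun r => b r + b' r, fun r => P.add_mem (hb r) (hb' r), by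
      simp only [mul_add, Finset.sum_add_distrib]⟩

theorem aeval_congr_of_supported {F A : Type*} [Field F] [CommRing A] [Algebra F A] {S : Set ℕ}
    {p : MvPolynomial ℕ F} (hp : p ∈ MvPolynomial.supported F S) {f g : ℕ → A}
    (h : ∀ i ∈ S, f i = g i) : MvPolynomial.aeval f p = MvPolynomial.aeval g p :=
  MvPolynomial.eval₂Hom_congr' rfl
    (fun _ hi _ => h _ (MvPolynomial.mem_supported.1 hp hi)) rfl

/-- The two substituted values are what `codeVal` makes of `X` on the letters `false` and `true`. So
a merge turns codes relative to the halves into codes relative to the whole cluster. -/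
theorem mergeHom_C_codeVal {K : Type*} [Field K] (W : ℕ) (u : List Bool) :
    mergeHom K W (C (codeVal W X u)) = codeVal W X (false :: u) := by
  rw [← RingHom.comp_apply, map_codeVal]
  simp [mergeHom, codeVal]

theorem mergeHom_codeVal_X {K : Type*} [Field K] (W : ℕ) (u : List Bool) :
    mergeHom K W (codeVal W X u) = codeVal W (X ^ W * (1 + X)) u := by
  rw [map_codeVal]
  simp [mergeHom]

/-- The places below `d` whose code starts with `u`. -/
def cluster (d : ℕ) (c : ℕ → List Bool) (u : List Bool) : Set ℕ := {i | i < d ∧ u <+: c i}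

theorem cluster_split {d : ℕ} {c : ℕ → List Bool} {u : List Bool}
    (h : ∀ i ∈ cluster d c u, c i ≠ u) :
    cluster d c u = cluster d c (u ++ [false]) ∪ cluster d c (u ++ [true]) := by
  ext i
  constructor
  · intro hi
    obtain ⟨v, hv⟩ := hi.2
    rcases v with _ | ⟨_ | _, v⟩
    · exact absurd (by simpa using hv.symm) (h i hi)
    · exact .inl ⟨hi.1, v, by simpa using hv⟩
    · exact .inr ⟨hi.1, v, by simpa using hv⟩
  · rintro (hi | hi) <;> exact ⟨hi.1, (List.prefix_append _ _).trans hi.2⟩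

theorem cluster_disjoint {d : ℕ} {c : ℕ → List Bool} {u : List Bool} {i : ℕ}
    (h0 : i ∈ cluster d c (u ++ [false])) : i ∉ cluster d c (u ++ [true]) := by
  intro h1
  obtain ⟨v, hv⟩ := h0.2
  obtain ⟨v', hv'⟩ := h1.2
  rw [← hv] at hv'
  simp at hv'

theorem drop_of_mem_cluster {d : ℕ} {c : ℕ → List Bool} {u : List Bool} {i : ℕ} {b : Bool}
    (h : i ∈ cluster d c (u ++ [b])) :
    (c i).drop u.length = b :: (c i).drop (u ++ [b]).length := by
  obtain ⟨v, hv⟩ := h.2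
  rw [← hv]
  simp

section Nonvanishing
variable {F K : Type*} [Field F] [Field K] [Algebra F K]

open Classical in
/-- The point `y`, changed on the cluster `u` into the values that come from the value `z` at the
root of that cluster. -/
noncomputable def replaceOn {A : Type*} [CommSemiring A] (W d : ℕ) (c : ℕ → List Bool)
    (u : List Bool) (y : ℕ → A) (z : A) (i : ℕ) : A :=
  if i ∈ cluster d c u then codeVal W z ((c i).drop u.length) else y i

theorem replaceOn_mem {A : Type*} [CommSemiring A] {W d : ℕ} {c : ℕ → List Bool}
    {u : List Bool} {y : ℕ → A} {z : A} {i : ℕ} (h : i ∈ cluster d c u) :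
    replaceOn W d c u y z i = codeVal W z ((c i).drop u.length) := if_pos h

theorem replaceOn_not_mem {A : Type*} [CommSemiring A] {W d : ℕ} {c : ℕ → List Bool}
    {u : List Bool} {y : ℕ → A} {z : A} {i : ℕ} (h : i ∉ cluster d c u) :
    replaceOn W d c u y z i = y i := if_neg h

theorem map_replaceOn {A B G : Type*} [CommSemiring A] [CommSemiring B] [FunLike G A B]
    [RingHomClass G A B] (φ : G) (W d : ℕ) (c : ℕ → List Bool) (u : List Bool) (y : ℕ → A)
    (z : A) (i : ℕ) :
    φ (replaceOn W d c u y z i) = replaceOn W d c u (fun i => φ (y i)) (φ z) i := by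
  unfold replaceOn
  split
  · exact map_codeVal φ W z _
  · rfl

/-- The two halves of a cluster can be merged. -/
theorem exists_merge [Infinite K] {W d n M : ℕ} {c : ℕ → List Bool} {R : MvPolynomial ℕ F}
    (hv : (R.vars : Set ℕ) ⊆ Set.Iio d) (hn : ∀ i, R.degreeOf i ≤ n)
    (hM : ∑ i ∈ Finset.range d, n * (W + 1) ^ (c i).length ≤ M)
    (hinj : Set.InjOn (Nat.cast : ℕ → K) (Set.Iic M)) {u : List Bool}
    (hcut : CutRank W (cluster d c (u ++ [false])) R)
    (hsplit : cluster d c u = cluster d c (u ++ [false]) ∪ cluster d c (u ++ [true]))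
    {y : ℕ → K} {z₀ z₁ : K}
    (hne : MvPolynomial.aeval (replaceOn W d c (u ++ [true])
      (replaceOn W d c (u ++ [false]) y z₀) z₁) R ≠ 0) :
    ∃ z, MvPolynomial.aeval (replaceOn W d c u y z) R ≠ 0 := by
  classical
  obtain ⟨A, hA, hAS, hRA⟩ := hcut
  obtain ⟨b, hb, hR⟩ := mem_span_finset_mul hRA
  set y₀ : ℕ → K[X] := replaceOn W d c (u ++ [false]) (fun i => C (y i)) X with hy₀
  set y₁ : ℕ → K[X] := replaceOn W d c (u ++ [true]) (fun i => C (y i)) X with hy₁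
  -- The inner variable is the value at the root of the half `false`, the outer one that at the root
  -- of the half `true`; the remaining places keep their constants.
  set g : ℕ → K[X][X] := replaceOn W d c (u ++ [true]) (fun i => C (y₀ i)) X with hg
  have hg0 : ∀ i ∈ cluster d c (u ++ [false]), g i = C (y₀ i) := fun i hi =>
    replaceOn_not_mem (cluster_disjoint hi)
  have hg1 : ∀ i ∈ (cluster d c (u ++ [false]))ᶜ, g i = (y₁ i).map C := by
    intro i hi
    rw [hg, hy₁, ← coe_mapRingHom, map_replaceOn]
    unfold replaceOn
    split
    · simp
    · simp only [hy₀]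
      rw [replaceOn_not_mem hi]; simp
  set B : K[X][X] := MvPolynomial.aeval g R with hB
  have hmap : ∀ {A' : Type _} [CommRing A'] [Algebra F A'] (φ : K[X][X] →+* A')
      (_ : ∀ x : F, φ (algebraMap F K[X][X] x) = algebraMap F A' x),
      φ B = MvPolynomial.aeval (fun i => φ (g i)) R := by
    intro A' _ _ φ hφ
    let φ' : K[X][X] →ₐ[F] A' := { φ with commutes' := hφ }
    change φ' (MvPolynomial.aeval g R) = _
    rw [← AlgHom.comp_apply, MvPolynomial.comp_aeval]
    rfl
  -- Specialising the outer variable to `z₁` and the inner one to `z₀` gives the nonzero value in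
  -- `hne`.
  have hB0 : B ≠ 0 := by
    intro h0
    refine hne ?_
    have := hmap ((evalRingHom z₀).comp (evalRingHom (C z₁))) (fun x => by
      rw [IsScalarTower.algebraMap_apply F K[X] K[X][X], IsScalarTower.algebraMap_apply F K K[X]]
      simp)
    rw [h0, map_zero] at this
    rw [this]
    congr 2
    funext i
    rw [hg, map_replaceOn, RingHom.comp_apply]
    congr 1
    · funext i
      rw [RingHom.comp_apply, coe_evalRingHom, coe_evalRingHom, eval_C, hy₀, ← coe_evalRingHom,
        map_replaceOn]
      simp
    · simp
  -- The first factors depend only on the half `false`, hence on the inner variable. The second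
  -- factors do not see that half, so they are polynomials in the outer variable with constant
  -- coefficients. Thus the rank of the cut bounds the rank of `B`.
  have hab : B = ∑ r : A, C (MvPolynomial.aeval y₀ (r : MvPolynomial ℕ F)) *
      (MvPolynomial.aeval y₁ (b r)).map C := by
    rw [hB, hR, map_sum]
    refine Finset.sum_congr rfl fun r _ => ?_
    rw [map_mul]
    congr 1
    · rw [aeval_congr_of_supported (hAS r r.2) hg0]
      let φ : K[X] →ₐ[F] K[X][X] := { (C : K[X] →+* K[X][X]) with commutes' := fun x => rfl }
      exact (MvPolynomial.comp_aeval_apply _ φ _).symm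
    · rw [aeval_congr_of_supported (hb r) hg1]
      let φ : K[X] →ₐ[F] K[X][X] := { mapRingHom (C : K →+* K[X]) with
        commutes' := fun x => by
          change mapRingHom C (algebraMap F K[X] x) = algebraMap F K[X][X] x
          rw [IsScalarTower.algebraMap_apply F K K[X], coe_mapRingHom,
            ← C_eq_algebraMap, map_C]
          rfl }
      exact (MvPolynomial.comp_aeval_apply _ φ _).symm
  have hBdeg : B.natDegree ≤ M := by
    refine (natDegree_aeval_le hv hn g).trans (le_trans ?_ hM)
    refine Finset.sum_le_sum fun i _ => Nat.mul_le_mul_left _ ?_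
    by_cases hi : i ∈ cluster d c (u ++ [true])
    · rw [hg, replaceOn_mem hi]
      refine (natDegree_codeVal_le W _ _).trans ?_
      rw [natDegree_X, one_mul]
      exact Nat.pow_le_pow_right (by omega) (by rw [List.length_drop]; omega)
    · rw [hg, replaceOn_not_mem hi, natDegree_C]; omega
  have hQ : mergeHom K W B ≠ 0 := by
    refine mergeHom_ne_zero (ι := A) (by simpa using hA) hB0 _ _ hab (hinj.mono ?_)
    exact Set.Iic_subset_Iic.2 hBdeg
  have hQ' : mergeHom K W B = MvPolynomial.aeval
      (replaceOn W d c u (fun i => C (y i)) X) R := by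
    rw [hmap (mergeHom K W) (fun x => by
      rw [IsScalarTower.algebraMap_apply F K[X] K[X][X], IsScalarTower.algebraMap_apply F K K[X]]
      simp [mergeHom])]
    congr 2
    funext i
    by_cases h1 : i ∈ cluster d c (u ++ [true])
    · rw [hg, replaceOn_mem h1, mergeHom_codeVal_X,
        replaceOn_mem (show i ∈ cluster d c u by rw [hsplit]; exact .inr h1),
        drop_of_mem_cluster h1]
      simp [codeVal]
    · rw [hg, replaceOn_not_mem h1]
      by_cases h0 : i ∈ cluster d c (u ++ [false])
      · rw [hy₀, replaceOn_mem h0, mergeHom_C_codeVal,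
          replaceOn_mem (show i ∈ cluster d c u by rw [hsplit]; exact .inl h0),
          drop_of_mem_cluster h0]
      · rw [hy₀, replaceOn_not_mem h0,
          replaceOn_not_mem (by rw [hsplit]; rintro (h | h) <;> contradiction)]
        simp [mergeHom]
  -- A nonzero polynomial has a non-root in the infinite field `K`.
  obtain ⟨z, hz⟩ : ∃ z, (mergeHom K W B).eval z ≠ 0 := by
    by_contra! h
    exact hQ (Polynomial.funext fun z => by rw [h z, eval_zero])
  refine ⟨z, fun h0 => hz ?_⟩
  rw [hQ', ← h0]
  let φ : K[X] →ₐ[F] K := { evalRingHom z with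
    commutes' := fun x => by
      rw [IsScalarTower.algebraMap_apply F K K[X]]
      simp }
  refine (MvPolynomial.comp_aeval_apply _ φ _).trans ?_
  congr 2
  funext i
  change evalRingHom z _ = _
  rw [map_replaceOn]
  simp

/-- A nonzero point stays nonzero when the values on a cluster are replaced by suitable values that
come from one value at its root. -/
theorem exists_replaceOn_ne_zero [Infinite K] {W d n M L : ℕ} {c : ℕ → List Bool}
    {R : MvPolynomial ℕ F}
    (hv : (R.vars : Set ℕ) ⊆ Set.Iio d) (hn : ∀ i, R.degreeOf i ≤ n)
    (hM : ∑ i ∈ Finset.range d, n * (W + 1) ^ (c i).length ≤ M)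
    (hinj : Set.InjOn (Nat.cast : ℕ → K) (Set.Iic M))
    (hL : ∀ i < d, (c i).length ≤ L)
    (hpf : ∀ i < d, ∀ j < d, i ≠ j → ¬ c i <+: c j)
    (hcut : ∀ u, CutRank W (cluster d c u) R) (k : ℕ) (u : List Bool) (hk : L < u.length + k)
    {y : ℕ → K} (hy : MvPolynomial.aeval y R ≠ 0) :
    ∃ z, MvPolynomial.aeval (replaceOn W d c u y z) R ≠ 0 := by
  induction k generalizing u y with
  | zero =>
    -- The name `u` is longer than all codes, so the cluster is empty and any value will do.
    refine ⟨0, ?_⟩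
    convert hy using 3
    funext i
    refine replaceOn_not_mem fun hi => ?_
    have := hi.2.length_le
    have := hL i hi.1
    omega
  | succ k ih =>
    by_cases h : ∀ i ∈ cluster d c u, c i ≠ u
    · obtain ⟨z₀, h₀⟩ := ih (u ++ [false]) (by simp; omega) hy
      obtain ⟨z₁, h₁⟩ := ih (u ++ [true]) (by simp; omega) h₀
      exact exists_merge hv hn hM hinj (hcut _) (cluster_split h) h₁
    -- Some code equals `u`. Codes are prefix-free, so the cluster is a single place, which keeps
    -- its value.
    · push Not at h
      obtain ⟨i, hi, rfl⟩ := h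
      refine ⟨y i, ?_⟩
      convert hy using 3
      funext j
      by_cases hj : j ∈ cluster d c (c i)
      · have : i = j := by
          by_contra hij
          exact hpf i hi.1 j hj.1 hij hj.2
        subst this
        rw [replaceOn_mem hj]
        simp [codeVal]
      · exact replaceOn_not_mem hj

end Nonvanishing

/-- A nonzero polynomial is nonzero at one of the points given by the codes. -/
theorem exists_point_ne_zero {F : Type*} [Field F] {W d n M L : ℕ} {c : ℕ → List Bool}
    {R : MvPolynomial ℕ F} (hR : R ≠ 0)
    (hv : (R.vars : Set ℕ) ⊆ Set.Iio d) (hn : ∀ i, R.degreeOf i ≤ n)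
    (hM : ∑ i ∈ Finset.range d, n * (W + 1) ^ (c i).length ≤ M)
    (hinj : Set.InjOn (Nat.cast : ℕ → F) (Set.Iic M))
    (hL : ∀ i < d, (c i).length ≤ L)
    (hpf : ∀ i < d, ∀ j < d, i ≠ j → ¬ c i <+: c j)
    (hcut : ∀ u, CutRank W (cluster d c u) R) :
    ∃ t ≤ M, MvPolynomial.aeval (fun i => codeVal W (t : F) (c i)) R ≠ 0 := by
  classical
  -- The merging argument needs an infinite field, and `F` may be finite. Only the final test points
  -- have to lie in `F`.
  set K := AlgebraicClosure F
  have hinjK : Set.InjOn (Nat.cast : ℕ → K) (Set.Iic M) := by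
    intro a ha b hb hab
    refine hinj ha hb ((algebraMap F K).injective ?_)
    simpa using hab
  obtain ⟨y, hy⟩ : ∃ y : ℕ → K, MvPolynomial.aeval y R ≠ 0 := by
    by_contra! h
    refine hR (MvPolynomial.map_injective _ (algebraMap F K).injective ?_)
    rw [map_zero]
    refine MvPolynomial.funext fun y => ?_
    rw [MvPolynomial.eval_map, map_zero, ← h y]
    rfl
  obtain ⟨z, hz⟩ := exists_replaceOn_ne_zero hv hn hM hinjK hL hpf hcut (L + 1) [] (by simp) hy
  -- All places now depend on one variable. The value `z` over `K` shows that `P` is nonzero, and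
  -- its degree excludes the `M + 1` distinct roots `0, ..., M`.
  set P : F[X] := MvPolynomial.aeval (fun i => codeVal W X (c i)) R with hP
  have heval : ∀ {A : Type _} [CommRing A] [Algebra F A] (x : A),
      aeval x P = MvPolynomial.aeval (fun i => codeVal W x (c i)) R := by
    intro A _ _ x
    rw [hP, ← AlgHom.comp_apply, MvPolynomial.comp_aeval]
    congr 2
    funext i
    rw [map_codeVal, aeval_X]
  have hP0 : P ≠ 0 := by
    intro h0
    refine hz ?_
    have := heval z
    rw [h0, map_zero] at this
    rw [this]
    refine MvPolynomial.eval₂Hom_congr' rfl (fun i hi _ => ?_) rfl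
    have : i ∈ cluster d c [] := ⟨hv hi, List.nil_prefix⟩
    rw [replaceOn_mem this]
    simp
  have hdeg : P.natDegree ≤ M := by
    refine (natDegree_aeval_le hv hn _).trans (le_trans ?_ hM)
    refine Finset.sum_le_sum fun i _ => Nat.mul_le_mul_left _ ?_
    refine (natDegree_codeVal_le W _ _).trans ?_
    rw [natDegree_X, one_mul]
  by_contra! h
  refine hP0 (Polynomial.eq_zero_of_natDegree_lt_card_of_eval_eq_zero' P
    ((Finset.range (M + 1)).image (Nat.cast : ℕ → F)) ?_ ?_)
  · intro x hx
    obtain ⟨t, ht, rfl⟩ := Finset.mem_image.1 hx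
    rw [← coe_aeval_eq_eval, heval]
    exact h t (by simpa [Nat.lt_succ_iff] using ht)
  · rw [Finset.card_image_of_injOn, Finset.card_range]
    · omega
    · intro a ha b hb hab
      exact hinj (by simpa [Nat.lt_succ_iff] using ha) (by simpa [Nat.lt_succ_iff] using hb) hab

end UPT

-- Decompositions along a tree and the rank of cuts.

namespace UPT

section Decomposition
variable {F : Type*} [Field F]

/-- The polynomials in the variables from `S`, as a subspace. -/
noncomputable abbrev polyOn (F : Type*) [Field F] (S : Set ℕ) :
    Submodule F (MvPolynomial ℕ F) :=
  Subalgebra.toSubmodule (MvPolynomial.supported F S)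

theorem polyOn_mono {S S' : Set ℕ} (h : S ⊆ S') : polyOn F S ≤ polyOn F S' :=
  MvPolynomial.supported_mono h

theorem polyOn_mul_le (S S' : Set ℕ) : polyOn F S * polyOn F S' ≤ polyOn F (S ∪ S') :=
  Submodule.mul_le.2 fun _ ha _ hb => Subalgebra.mul_mem _
    (polyOn_mono Set.subset_union_left ha) (polyOn_mono Set.subset_union_right hb)

/-- A hierarchical decomposition with subspaces of dimension at most `w` along a binary tree. -/
def HasDecomposition (w : ℕ) : BT → ℕ → Submodule F (MvPolynomial ℕ F) → Prop
  | .nil, _, V => (∃ A : Finset (MvPolynomial ℕ F), A.card ≤ w ∧ V = Submodule.span F A) ∧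
      V ≤ polyOn F ∅
  | .leaf, p, V => (∃ A : Finset (MvPolynomial ℕ F), A.card ≤ w ∧ V = Submodule.span F A) ∧
      V ≤ polyOn F {p}
  | .br a b, p, V => (∃ A : Finset (MvPolynomial ℕ F), A.card ≤ w ∧ V = Submodule.span F A) ∧
      ∃ V₁ V₂, HasDecomposition w a p V₁ ∧ HasDecomposition w b (p + a.cnt) V₂ ∧ V ≤ V₁ * V₂

theorem HasDecomposition.exists_span {w : ℕ} {t : BT} {p : ℕ}
    {V : Submodule F (MvPolynomial ℕ F)} (h : HasDecomposition w t p V) :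
    ∃ A : Finset (MvPolynomial ℕ F), A.card ≤ w ∧ V = Submodule.span F A := by
  cases t <;> exact h.1

theorem BT.places_br (a b : BT) (p : ℕ) :
    (BT.br a b).places p = a.places p ∪ b.places (p + a.cnt) := by
  ext i; simp only [BT.places, BT.cnt, Set.mem_Ico, Set.mem_union]; omega

theorem BT.places_disjoint (a b : BT) (p : ℕ) {i : ℕ} (h : i ∈ a.places p) :
    i ∉ b.places (p + a.cnt) := by
  simp only [BT.places, Set.mem_Ico] at *; omega

theorem HasDecomposition.le_polyOn {w : ℕ} {t : BT} {p : ℕ}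
    {V : Submodule F (MvPolynomial ℕ F)} (h : HasDecomposition w t p V) :
    V ≤ polyOn F (t.places p) := by
  induction t generalizing p V with
  | nil => exact h.2.trans (polyOn_mono (Set.empty_subset _))
  | leaf => exact h.2.trans (polyOn_mono (by simp [BT.places, BT.cnt]))
  | br a b iha ihb =>
    obtain ⟨-, V₁, V₂, h₁, h₂, hV⟩ := h
    rw [BT.places_br]
    exact hV.trans ((mul_le_mul' (iha h₁) (ihb h₂)).trans (polyOn_mul_le _ _))

theorem Seg.subset {t : BT} {p : ℕ} {S : Set ℕ} (h : Seg t p S) : S ⊆ t.places p := by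
  induction h with
  | empty => exact Set.empty_subset _
  | full => exact subset_rfl
  | left _ ih => rw [BT.places_br]; exact Set.union_subset_union_left _ ih
  | right _ ih => rw [BT.places_br, Set.union_comm]; exact Set.union_subset_union_right _ ih

theorem Dif.subset {t : BT} {p : ℕ} {S : Set ℕ} (h : Dif t p S) : S ⊆ t.places p := by
  induction h with
  | seg h => exact h.subset
  | left _ ih => rw [BT.places_br]; exact ih.trans Set.subset_union_left
  | right _ ih => rw [BT.places_br]; exact ih.trans Set.subset_union_right

/-- On the way from the root to the removed subtree, every sibling space uses variables from `S`
only and is absorbed into `polyOn F S`. What stays is a spanning set for the removed subtree; if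
nothing is removed, the constant `1` serves. -/
theorem HasDecomposition.exists_of_seg {w : ℕ} (hw : 1 ≤ w) {t : BT} {p : ℕ} {S : Set ℕ}
    (hS : Seg t p S) {V : Submodule F (MvPolynomial ℕ F)} (h : HasDecomposition w t p V) :
    ∃ U : Finset (MvPolynomial ℕ F), U.card ≤ w ∧ (∀ x ∈ U, x ∈ polyOn F (t.places p \ S)) ∧
      V ≤ Submodule.span F U * polyOn F S := by
  induction hS generalizing V with
  | empty t p =>
    obtain ⟨A, hA, rfl⟩ := h.exists_span
    refine ⟨A, hA, fun x hx => ?_, fun x hx => ?_⟩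
    · rw [Set.sdiff_empty]; exact h.le_polyOn (Submodule.subset_span hx)
    · rw [← mul_one x]; exact Submodule.mul_mem_mul hx (Subalgebra.one_mem _)
  | full t p =>
    refine ⟨{1}, by simpa using hw, fun x hx => ?_, fun x hx => ?_⟩
    · rw [Finset.mem_singleton.1 hx]; exact Subalgebra.one_mem _
    · rw [← one_mul x]
      exact Submodule.mul_mem_mul (Submodule.subset_span (by simp)) (h.le_polyOn hx)
  | @left a b p S hS ih =>
    obtain ⟨-, V₁, V₂, h₁, h₂, hV⟩ := h
    obtain ⟨U, hU, hUS, hV₁⟩ := ih h₁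
    refine ⟨U, hU, fun x hx => polyOn_mono ?_ (hUS x hx), ?_⟩
    · rintro i ⟨hi, hi'⟩
      rw [BT.places_br]
      exact ⟨.inl hi, by rintro (h | h); exacts [hi' h, BT.places_disjoint a b p hi h]⟩
    · refine hV.trans ((mul_le_mul' hV₁ h₂.le_polyOn).trans ?_)
      rw [mul_assoc]
      exact mul_le_mul' le_rfl (polyOn_mul_le _ _)
  | @right a b p S hS ih =>
    obtain ⟨-, V₁, V₂, h₁, h₂, hV⟩ := h
    obtain ⟨U, hU, hUS, hV₂⟩ := ih h₂
    refine ⟨U, hU, fun x hx => polyOn_mono ?_ (hUS x hx), ?_⟩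
    · rintro i ⟨hi, hi'⟩
      rw [BT.places_br]
      exact ⟨.inr hi, by rintro (h | h); exacts [hi' h, BT.places_disjoint a b p h hi]⟩
    · rw [mul_comm] at hV
      refine hV.trans ((mul_le_mul' hV₂ h₁.le_polyOn).trans ?_)
      rw [mul_assoc]
      exact mul_le_mul' le_rfl (polyOn_mul_le _ _)

/-- At the outer of the two nested subtrees, each of at most `w` generators is expanded along at
most `w` polynomials of the inner subtree, and the coefficients are the `w * w` polynomials in the
variables from `S`. On the way up to the root, the siblings are absorbed into the complement of `S`.
-/
theorem HasDecomposition.exists_of_dif {w : ℕ} (hw : 1 ≤ w) {t : BT} {p : ℕ} {S : Set ℕ}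
    (hS : Dif t p S) {V : Submodule F (MvPolynomial ℕ F)} (h : HasDecomposition w t p V) :
    ∃ A : Finset (MvPolynomial ℕ F), A.card ≤ w * w ∧ (∀ x ∈ A, x ∈ polyOn F S) ∧
      V ≤ Submodule.span F A * polyOn F Sᶜ := by
  classical
  induction hS generalizing V with
  | @seg t p S hS =>
    obtain ⟨U, hU, hUS, hV⟩ := h.exists_of_seg hw hS
    obtain ⟨A, hA, rfl⟩ := h.exists_span
    have : ∀ v : A, ∃ B : U → MvPolynomial ℕ F, (∀ s, B s ∈ polyOn F S) ∧
        (v : MvPolynomial ℕ F) = ∑ s : U, (s : MvPolynomial ℕ F) * B s := fun v =>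
      mem_span_finset_mul (hV (Submodule.subset_span v.2))
    choose B hB hv using this
    refine ⟨Finset.univ.image fun vs : A × U => B vs.1 vs.2, ?_, ?_, ?_⟩
    · refine Finset.card_image_le.trans ?_
      rw [Finset.card_univ, Fintype.card_prod, Fintype.card_coe, Fintype.card_coe]
      exact Nat.mul_le_mul hA hU
    · intro x hx
      obtain ⟨vs, -, rfl⟩ := Finset.mem_image.1 hx
      exact hB _ _
    · rw [Submodule.span_le]
      intro v hvA
      have hv' : v = _ := hv ⟨v, hvA⟩
      rw [SetLike.mem_coe, hv']
      refine Submodule.sum_mem _ fun s _ => ?_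
      rw [mul_comm (s : MvPolynomial ℕ F)]
      refine Submodule.mul_mem_mul (Submodule.subset_span ?_) (polyOn_mono ?_ (hUS s s.2))
      · exact Finset.mem_coe.2 (Finset.mem_image.2 ⟨(⟨v, hvA⟩, s), Finset.mem_univ _, rfl⟩)
      · exact fun i hi => hi.2
  | @left a b p S hS ih =>
    obtain ⟨-, V₁, V₂, h₁, h₂, hV⟩ := h
    obtain ⟨A, hA, hAS, hV₁⟩ := ih h₁
    refine ⟨A, hA, hAS, hV.trans ((mul_le_mul' hV₁ h₂.le_polyOn).trans ?_)⟩
    rw [mul_assoc]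
    refine mul_le_mul' le_rfl ((polyOn_mul_le _ _).trans (polyOn_mono ?_))
    exact Set.union_subset subset_rfl fun i hi hi' => BT.places_disjoint a b p (hS.subset hi') hi
  | @right a b p S hS ih =>
    obtain ⟨-, V₁, V₂, h₁, h₂, hV⟩ := h
    obtain ⟨A, hA, hAS, hV₂⟩ := ih h₂
    rw [mul_comm] at hV
    refine ⟨A, hA, hAS, hV.trans ((mul_le_mul' hV₂ h₁.le_polyOn).trans ?_)⟩
    rw [mul_assoc]
    refine mul_le_mul' le_rfl ((polyOn_mul_le _ _).trans (polyOn_mono ?_))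
    exact Set.union_subset subset_rfl fun i hi hi' => BT.places_disjoint a b p hi (hS.subset hi')

/-- The code of the leaf with number `i`. -/
def leafCode (t : BT) (i : ℕ) : List Bool :=
  flat (Nat.log 2 t.cnt) ((recs t).getD i (0, []))

theorem leafCode_eq {t : BT} {i : ℕ} (hi : i < (recs t).length) :
    leafCode t i = flat (Nat.log 2 t.cnt) (recs t)[i] := by
  rw [leafCode, List.getD_eq_getElem _ _ hi]

/-- No block has a level above `log` of the count, so `dif_flat` at that level concerns all leaves.
-/
theorem cluster_leafCode (t : BT) (u : List Bool) : Dif t 0 (cluster t.cnt (leafCode t) u) := by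
  convert (balanced t).dif_flat 0 (Nat.log 2 t.cnt) u using 1
  ext i
  constructor
  · rintro ⟨hi, hu⟩
    rw [← length_recs] at hi
    rw [leafCode_eq hi] at hu
    exact ⟨i, _, List.getElem?_eq_getElem hi,
      ⟨(balanced t).le_log (List.getElem_mem _), hu⟩, (zero_add i).symm⟩
  · rintro ⟨k, r, hk, ⟨-, hu⟩, rfl⟩
    obtain ⟨hi, rfl⟩ := List.getElem?_eq_some_iff.1 hk
    rw [zero_add]
    exact ⟨by rwa [← length_recs], by rwa [leafCode_eq hi]⟩

theorem leafCode_not_prefix (t : BT) {i j : ℕ} (hi : i < t.cnt) (hj : j < t.cnt) (hij : i ≠ j) :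
    ¬ leafCode t i <+: leafCode t j := by
  rw [← length_recs] at hi hj
  rw [leafCode_eq hi, leafCode_eq hj]
  have hle := fun k (hk : k < (recs t).length) => (balanced t).le_log (List.getElem_mem hk)
  have hpf := List.pairwise_iff_getElem.1 (balanced t).pf
  rcases lt_or_gt_of_ne hij with h | h
  · exact (flat_pf (hpf i j hi hj h) (hle i hi) (hle j hj)).1
  · exact (flat_pf (hpf j i hj hi h) (hle j hj) (hle i hi)).2

theorem length_leafCode_le (t : BT) {i : ℕ} (hi : i < t.cnt) :
    (leafCode t i).length ≤ 5 * Nat.log 2 t.cnt := by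
  rw [← length_recs] at hi
  rw [leafCode_eq hi]
  exact (balanced t).length_flat_le (List.getElem_mem _)

/-- Nonzero polynomials with a decomposition along `t` are nonzero at some point that is given by
the codes of the leaves of `t`. -/
theorem HasDecomposition.exists_point {w n M : ℕ} (hw : 1 ≤ w) {t : BT}
    {V : Submodule F (MvPolynomial ℕ F)} (h : HasDecomposition w t 0 V) {R : MvPolynomial ℕ F}
    (hRV : R ∈ V) (hR : R ≠ 0) (hn : ∀ i, R.degreeOf i ≤ n)
    (hM : n * t.cnt * (w * w + 1) ^ (5 * Nat.log 2 t.cnt) ≤ M)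
    (hinj : Set.InjOn (Nat.cast : ℕ → F) (Set.Iic M)) :
    ∃ x ≤ M, MvPolynomial.aeval (fun i => codeVal (w * w) (x : F) (leafCode t i)) R ≠ 0 := by
  refine exists_point_ne_zero (d := t.cnt) hR ?_ hn (le_trans ?_ hM) hinj
    (fun i hi => length_leafCode_le t hi) (fun i hi j hj => leafCode_not_prefix t hi hj)
    fun u => ?_
  · have := MvPolynomial.mem_supported.1 (h.le_polyOn hRV)
    intro i hi
    simpa [BT.places] using this hi
  · refine (Finset.sum_le_sum (g := fun _ => n * (w * w + 1) ^ (5 * Nat.log 2 t.cnt))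
      fun i hi => Nat.mul_le_mul_left _ ?_).trans ?_
    · exact Nat.pow_le_pow_right (by omega) (length_leafCode_le t (Finset.mem_range.1 hi))
    · rw [Finset.sum_const, Finset.card_range, smul_eq_mul]
      exact le_of_eq (by ring)
  · obtain ⟨A, hA, hAS, hV⟩ := h.exists_of_dif hw (cluster_leafCode t u)
    exact ⟨A, hA, hAS, hV hRV⟩

end Decomposition

-- From words to monomials in place variables, and matrices that evaluate them.

section Words
variable {F : Type*} [Field F] {n : ℕ}

/-- The product of variables that is given by a word. -/
def wordProd (F : Type*) [Field F] {n : ℕ} (u : List (Fin n)) : FreeAlgebra F (Fin n) :=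
  (u.map (FreeAlgebra.ι F)).prod

theorem wordProd_cons (k : Fin n) (u : List (Fin n)) :
    wordProd F (k :: u) = FreeAlgebra.ι F k * wordProd F u := by simp [wordProd]

theorem wordProd_mem (u : List (Fin n)) : wordProd F u ∈ homogeneous F n u.length :=
  Submodule.subset_span ⟨u, rfl, rfl⟩

theorem homogeneous_induction {d : ℕ} {p : FreeAlgebra F (Fin n) → Prop}
    (word : ∀ u : List (Fin n), u.length = d → p (wordProd F u)) (zero : p 0)
    (add : ∀ f g, p f → p g → p (f + g)) (smul : ∀ (c : F) f, p f → p (c • f))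
    {f : FreeAlgebra F (Fin n)} (hf : f ∈ homogeneous F n d) : p f := by
  refine Submodule.span_induction (p := fun f _ => p f) ?_ zero (fun f g _ _ => add f g)
    (fun c f _ => smul c f) hf
  rintro _ ⟨u, hu, rfl⟩
  exact word u hu

theorem one_mem_homogeneous : (1 : FreeAlgebra F (Fin n)) ∈ homogeneous F n 0 := by
  simpa [wordProd] using wordProd_mem (F := F) (n := n) []

theorem ι_mem_homogeneous (k : Fin n) : FreeAlgebra.ι F k ∈ homogeneous F n 1 := by
  simpa [wordProd] using wordProd_mem (F := F) [k]

theorem mul_mem_homogeneous {d e : ℕ} {f g : FreeAlgebra F (Fin n)}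
    (hf : f ∈ homogeneous F n d) (hg : g ∈ homogeneous F n e) :
    f * g ∈ homogeneous F n (d + e) := by
  refine homogeneous_induction (p := fun f => f * g ∈ homogeneous F n (d + e))
    (fun u hu => ?_) ?_ (fun f f' h h' => ?_) (fun c f h => ?_) hf
  · refine homogeneous_induction (p := fun g => wordProd F u * g ∈ homogeneous F n (d + e))
      (fun v hv => ?_) ?_ (fun f f' h h' => ?_) (fun c f h => ?_) hg
    · have := wordProd_mem (F := F) (u ++ v)
      rw [List.length_append, hu, hv] at this
      simpa [wordProd] using this
    · simp
    · rw [mul_add]; exact Submodule.add_mem _ h h'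
    · rw [mul_smul_comm]; exact Submodule.smul_mem _ _ h
  · simp
  · rw [add_mul]; exact Submodule.add_mem _ h h'
  · rw [smul_mul_assoc]; exact Submodule.smul_mem _ _ h

/-- The degree of a nonzero homogeneous polynomial is unique. -/
theorem homogeneous_degree_unique {d e : ℕ} {f : FreeAlgebra F (Fin n)}
    (hd : f ∈ homogeneous F n d) (he : f ∈ homogeneous F n e) (hf : f ≠ 0) : d = e := by
  -- A central variable `X` is attached to each letter, so its exponent records the degree.
  let φ : FreeAlgebra F (Fin n) →ₐ[F] Polynomial (FreeAlgebra F (Fin n)) :=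
    FreeAlgebra.lift F fun k => Polynomial.X * Polynomial.C (FreeAlgebra.ι F k)
  have key : ∀ d, f ∈ homogeneous F n d → φ f = Polynomial.monomial d f := by
    intro d hd
    refine homogeneous_induction (p := fun f => φ f = Polynomial.monomial d f)
      (fun u hu => ?_) ?_ (fun f f' h h' => ?_) (fun c f h => ?_) hd
    · subst hu
      clear hd
      induction u with
      | nil => simp [wordProd]
      | cons k u ih =>
        have hk : φ (FreeAlgebra.ι F k) = Polynomial.monomial 1 (FreeAlgebra.ι F k) := by
          simp [φ, Polynomial.X_mul_C, Polynomial.C_mul_X_eq_monomial]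
        rw [wordProd_cons, map_mul, ih, hk, Polynomial.monomial_mul_monomial, List.length_cons,
          add_comm]
    · simp
    · rw [map_add, h, h', map_add]
    · rw [map_smul, h, Polynomial.smul_monomial]
  have h := key d hd
  rw [key e he] at h
  have := congrArg (fun q => Polynomial.coeff q e) h
  simp only [Polynomial.coeff_monomial] at this
  by_contra hne
  simp [hne] at this
  exact hf this

/-- A variable acts on sequences of polynomials by a shift and a multiplication with powers of the
place variables. -/
noncomputable def shiftOp (F : Type*) [Field F] (k : ℕ) :
    Module.End F (ℕ → MvPolynomial ℕ F) where
  toFun φ p := MvPolynomial.X p ^ k * φ (p + 1)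
  map_add' φ ψ := by funext p; simp [mul_add]
  map_smul' c φ := by funext p; simp

/-- The action of non-commutative polynomials on sequences of polynomials. -/
noncomputable def wordOp (F : Type*) [Field F] (n : ℕ) :
    FreeAlgebra F (Fin n) →ₐ[F] Module.End F (ℕ → MvPolynomial ℕ F) :=
  FreeAlgebra.lift F fun k => shiftOp F k

/-- The commutative polynomial in which a word becomes the product of the powers of place variables,
starting at place `p`, with the letters as exponents. -/
noncomputable def placePoly (F : Type*) [Field F] (n p : ℕ) :
    FreeAlgebra F (Fin n) →ₗ[F] MvPolynomial ℕ F :=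
  LinearMap.proj p ∘ₗ LinearMap.applyₗ (1 : ℕ → MvPolynomial ℕ F) ∘ₗ (wordOp F n).toLinearMap

theorem placePoly_apply (p : ℕ) (f : FreeAlgebra F (Fin n)) :
    placePoly F n p f = wordOp F n f 1 p := rfl

theorem wordOp_ι_mul (k : Fin n) (f : FreeAlgebra F (Fin n)) (φ : ℕ → MvPolynomial ℕ F) (p : ℕ) :
    wordOp F n (FreeAlgebra.ι F k * f) φ p =
      MvPolynomial.X p ^ (k : ℕ) * wordOp F n f φ (p + 1) := by
  rw [map_mul, Module.End.mul_apply, wordOp, FreeAlgebra.lift_ι_apply]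
  rfl

theorem placePoly_one (p : ℕ) : placePoly F n p 1 = 1 := by
  rw [placePoly_apply, map_one (wordOp F n)]; rfl

theorem placePoly_ι (p : ℕ) (k : Fin n) :
    placePoly F n p (FreeAlgebra.ι F k) = MvPolynomial.X p ^ (k : ℕ) := by
  rw [placePoly_apply, ← mul_one (FreeAlgebra.ι F k), wordOp_ι_mul, map_one (wordOp F n)]
  simp

theorem wordOp_apply_of_mem {m : ℕ} {f : FreeAlgebra F (Fin n)} (hf : f ∈ homogeneous F n m)
    (φ : ℕ → MvPolynomial ℕ F) (p : ℕ) :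
    wordOp F n f φ p = placePoly F n p f * φ (p + m) := by
  refine homogeneous_induction (p := fun f => wordOp F n f φ p = placePoly F n p f * φ (p + m))
    (fun u hu => ?_) ?_ (fun f f' h h' => ?_) (fun c f h => ?_) hf
  · subst hu
    clear hf
    induction u generalizing p with
    | nil => simp [wordProd, placePoly_one]
    | cons k u ih =>
      rw [wordProd_cons, wordOp_ι_mul, placePoly_apply, wordOp_ι_mul, ih, placePoly_apply,
        List.length_cons, mul_assoc, Nat.add_assoc, Nat.add_comm 1]
  · simp
  · simp only [map_add, LinearMap.add_apply, Pi.add_apply, h, h']; ring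
  · simp only [map_smul, LinearMap.smul_apply, Pi.smul_apply, h, smul_mul_assoc]

/-- All words of `f` have length `m`, so the words of `g` start at the same place `p + m` behind
each of them. For inhomogeneous `f` this would fail. -/
theorem placePoly_mul {m : ℕ} {f : FreeAlgebra F (Fin n)} (hf : f ∈ homogeneous F n m)
    (g : FreeAlgebra F (Fin n)) (p : ℕ) :
    placePoly F n p (f * g) = placePoly F n p f * placePoly F n (p + m) g := by
  rw [placePoly_apply, map_mul, Module.End.mul_apply, wordOp_apply_of_mem hf]
  rfl

/-- The exponents of the monomial that belongs to a word. -/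
noncomputable def expo : ℕ → List (Fin n) → ℕ →₀ ℕ
  | _, [] => 0
  | p, k :: u => Finsupp.single p (k : ℕ) + expo (p + 1) u

theorem placePoly_wordProd (p : ℕ) (u : List (Fin n)) :
    placePoly F n p (wordProd F u) = MvPolynomial.monomial (expo p u) 1 := by
  induction u generalizing p with
  | nil => exact placePoly_one p
  | cons k u ih =>
    rw [wordProd_cons, placePoly_mul (ι_mem_homogeneous k), placePoly_ι, ih, expo,
      MvPolynomial.X_pow_eq_monomial, MvPolynomial.monomial_mul, one_mul]

theorem expo_of_lt {p i : ℕ} (u : List (Fin n)) (h : i < p) : expo p u i = 0 := by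
  induction u generalizing p with
  | nil => rfl
  | cons k u ih =>
    rw [expo, Finsupp.add_apply, ih (by omega), Finsupp.single_apply, if_neg (by omega)]

theorem expo_le (p i : ℕ) (u : List (Fin n)) : expo p u i ≤ n := by
  induction u generalizing p with
  | nil => exact Nat.zero_le _
  | cons k u ih =>
    rw [expo, Finsupp.add_apply, Finsupp.single_apply]
    split
    · subst i
      rw [expo_of_lt u (by omega)]; omega
    · rw [zero_add]; exact ih _

/-- The exponent at each place is the letter there. The equality of lengths matters because the
letter `0` leaves no trace in the monomial. -/
theorem expo_injective {p : ℕ} {u v : List (Fin n)} (hl : u.length = v.length)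
    (h : expo p u = expo p v) : u = v := by
  induction u generalizing p v with
  | nil => exact (List.length_eq_zero_iff.1 hl.symm).symm
  | cons k u ih =>
    obtain _ | ⟨k', v⟩ := v
    · simp at hl
    · simp only [expo] at h
      have h1 := DFunLike.congr_fun h p
      simp only [Finsupp.add_apply, expo_of_lt _ (Nat.lt_succ_self p), Finsupp.single_eq_same,
        add_zero] at h1
      rw [h1] at h
      rw [Fin.ext h1, ih (by simpa using hl) (add_left_cancel h)]

/-- Words of length `d` go to pairwise different monomials, so the coefficients of `f` reappear
without cancellation. -/
theorem placePoly_ne_zero {d : ℕ} {f : FreeAlgebra F (Fin n)} (hf : f ∈ homogeneous F n d)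
    (h0 : f ≠ 0) (p : ℕ) : placePoly F n p f ≠ 0 := by
  classical
  have hspan : f ∈ Submodule.span F
      (Set.range fun u : {u : List (Fin n) // u.length = d} => wordProd F u.1) := by
    rw [homogeneous] at hf
    convert hf using 2
    apply Set.ext
    intro x
    constructor
    · rintro ⟨u, rfl⟩; exact ⟨u.1, u.2, rfl⟩
    · rintro ⟨u, hu, rfl⟩; exact ⟨⟨u, hu⟩, rfl⟩
  obtain ⟨c, rfl⟩ := Finsupp.mem_span_range_iff_exists_finsupp.1 hspan
  intro hz
  refine h0 ?_
  have hc : c = 0 := by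
    ext u
    rw [Finsupp.sum, map_sum] at hz
    have := congrArg (MvPolynomial.coeff (expo p u.1)) hz
    simp only [map_smul, placePoly_wordProd, MvPolynomial.coeff_sum, MvPolynomial.coeff_smul,
      MvPolynomial.coeff_monomial, MvPolynomial.coeff_zero, smul_eq_mul] at this
    rw [Finset.sum_eq_single u] at this
    · simpa using this
    · intro v _ hvu
      rw [if_neg, mul_zero]
      intro he
      exact hvu (Subtype.ext (expo_injective (v.2.trans u.2.symm) he))
    · intro hu
      rw [Finsupp.notMem_support_iff.1 hu, zero_mul]
  rw [hc, Finsupp.sum_zero_index]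

theorem degreeOf_placePoly_le {d : ℕ} {f : FreeAlgebra F (Fin n)} (hf : f ∈ homogeneous F n d)
    (p i : ℕ) : (placePoly F n p f).degreeOf i ≤ n := by
  refine homogeneous_induction (p := fun f => (placePoly F n p f).degreeOf i ≤ n)
    (fun u hu => ?_) ?_ (fun f f' h h' => ?_) (fun c f h => ?_) hf
  · rw [placePoly_wordProd, MvPolynomial.degreeOf_monomial_eq _ _ one_ne_zero]
    exact expo_le p i u
  · simp
  · rw [map_add]
    exact (MvPolynomial.degreeOf_add_le _ _ _).trans (max_le h h')
  · rw [map_smul, MvPolynomial.smul_eq_C_mul]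
    exact (MvPolynomial.degreeOf_C_mul_le _ _ _).trans h

/-- The matrix for the variable with number `k`: the powers `y i ^ k` on the upper diagonal. -/
def stepMatrix {A : Type*} [CommSemiring A] (d : ℕ) (y : ℕ → A) (k : ℕ) :
    Matrix (Fin (d + 1)) (Fin (d + 1)) A :=
  fun i j => if (j : ℕ) = i + 1 then y i ^ k else 0

/-- Each matrix only allows the step from `i` to `i + 1`, so one path contributes to the entry, and
the letter used at step `i` becomes the exponent of `y i`. -/
theorem lift_stepMatrix_wordProd {d : ℕ} (y : ℕ → F) (u : List (Fin n)) (i j : Fin (d + 1))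
    (hij : (j : ℕ) = i + u.length) :
    FreeAlgebra.lift F (fun k : Fin n => stepMatrix d y k) (wordProd F u) i j =
      MvPolynomial.aeval y (placePoly F n i (wordProd F u)) := by
  induction u generalizing i with
  | nil =>
    have : i = j := Fin.ext (by simpa using hij.symm)
    subst this
    simp [wordProd, placePoly_one]
  | cons k u ih =>
    rw [List.length_cons] at hij
    have hi : (i : ℕ) + 1 < d + 1 := by omega
    rw [wordProd_cons, map_mul, FreeAlgebra.lift_ι_apply, Matrix.mul_apply,
      Finset.sum_eq_single ⟨i + 1, hi⟩, ih ⟨i + 1, hi⟩ (by simp; omega),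
      placePoly_mul (ι_mem_homogeneous k), placePoly_ι, map_mul]
    · simp [stepMatrix]
    · intro l _ hl
      rw [stepMatrix, if_neg, zero_mul]
      intro h
      exact hl (Fin.ext h)
    · intro h
      exact absurd (Finset.mem_univ _) h

theorem lift_stepMatrix {d : ℕ} (y : ℕ → F) {f : FreeAlgebra F (Fin n)}
    (hf : f ∈ homogeneous F n d) :
    FreeAlgebra.lift F (fun k : Fin n => stepMatrix d y k) f 0 (Fin.last d) =
      MvPolynomial.aeval y (placePoly F n 0 f) := by
  refine homogeneous_induction (p := fun f =>
    FreeAlgebra.lift F (fun k : Fin n => stepMatrix d y k) f 0 (Fin.last d) =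
      MvPolynomial.aeval y (placePoly F n 0 f))
    (fun u hu => ?_) ?_ (fun f f' h h' => ?_) (fun c f h => ?_) hf
  · exact lift_stepMatrix_wordProd y u 0 (Fin.last d) (by simp [hu])
  · simp
  · rw [map_add, map_add, map_add, Matrix.add_apply, h, h']
  · rw [map_smul, map_smul, map_smul, Matrix.smul_apply, h]

end Words

-- Parse trees of UPT circuits and the decomposition that they yield.

mutual
/-- The binary tree of a shape; its marked leaves are the variable leaves. -/
def shapeBT : RTree Kind → BT
  | .node .var _ => .leaf
  | .node _ ts => .br .nil (shapesBT ts)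
/-- The binary tree of a list of shapes. -/
def shapesBT : List (RTree Kind) → BT
  | [] => .nil
  | t :: ts => .br (shapeBT t) (shapesBT ts)
end

namespace Circuit
variable {F : Type*} {n : ℕ} (C : Circuit F n)

theorem shape_node (g : Fin C.numGates) (ts : List (RTree (Fin C.numGates))) :
    C.shape (.node g ts) = .node (C.gate g).kind (ts.map C.shape) := by
  have : ∀ ts : List (RTree (Fin C.numGates)),
      RTree.mapList (fun g => (C.gate g).kind) ts = ts.map C.shape := by
    intro ts
    induction ts with
    | nil => rfl
    | cons t ts ih => rw [RTree.mapList, ih]; rfl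
  rw [shape, RTree.map, this]

variable {C}

/-- The inversion of the rules for partial parse trees. -/
theorem IsPartialParseTree.children {g : Fin C.numGates} {ts : List (RTree (Fin C.numGates))}
    (h : C.IsPartialParseTree (.node g ts)) :
    (∀ i, C.gate g = .var i → ts = []) ∧ (∀ c, C.gate g = .const c → ts = []) ∧
      (∀ l, C.gate g = .plus l → ∃ t, ts = [t] ∧ t.root ∈ l.map Prod.snd ∧
        C.IsPartialParseTree t) ∧
      (∀ l, C.gate g = .times l → ts.map RTree.root = l ∧ ∀ t ∈ ts, C.IsPartialParseTree t) := by
  cases h with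
  | var hg => simp [hg]
  | const hg => simp [hg]
  | plus hg hl ht =>
    simp only [hg]
    refine ⟨by simp, by simp, ?_, by simp⟩
    intro l hl'
    cases hl'
    exact ⟨_, rfl, hl, ht⟩
  | times hg hl hts =>
    simp only [hg]
    refine ⟨by simp, by simp, by simp, ?_⟩
    intro l hl'
    cases hl'
    exact ⟨hl, hts⟩

/-- A gate with a nonzero value has a partial parse tree. -/
theorem exists_isPartialParseTree [Field F] {g : Fin C.numGates} (hv : C.value g ≠ 0) :
    ∃ t, C.IsPartialParseTree t ∧ t.root = g := by
  induction g using WellFoundedLT.induction with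
  | _ g ih =>
    rcases hg : C.gate g with i | c | l | l
    · exact ⟨_, .var hg, rfl⟩
    · exact ⟨_, .const hg, rfl⟩
    · rw [C.value_plus hg] at hv
      obtain ⟨e, he, hne⟩ : ∃ e ∈ l, C.value e.2 ≠ 0 := by
        by_contra! h
        refine hv (List.sum_eq_zero fun x hx => ?_)
        obtain ⟨e, he, rfl⟩ := List.mem_map.1 hx
        rw [h e he, smul_zero]
      have hmem : e.2 ∈ l.map Prod.snd := List.mem_map.2 ⟨e, he, rfl⟩
      obtain ⟨t, ht, hr⟩ := ih e.2 (C.acyclic g e.2 (by rw [hg]; exact hmem)) hne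
      exact ⟨_, .plus hg (hr ▸ hmem) ht, rfl⟩
    · rw [C.value_times hg] at hv
      have hne : ∀ h ∈ l, C.value h ≠ 0 := by
        intro h hh h0
        exact hv (List.prod_eq_zero (List.mem_map.2 ⟨h, hh, h0⟩))
      have hex : ∀ h ∈ l, ∃ t, C.IsPartialParseTree t ∧ t.root = h := fun h hh =>
        ih h (C.acyclic g h (by rw [hg]; exact hh)) (hne h hh)
      have : Inhabited (RTree (Fin C.numGates)) := ⟨.node g []⟩
      choose! t ht hr using hex
      refine ⟨.node g (l.map t), .times hg ?_ ?_, rfl⟩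
      · rw [List.map_map]
        exact (List.map_congr_left fun h hh => hr h hh).trans (List.map_id _)
      · intro s hs
        obtain ⟨h, hh, rfl⟩ := List.mem_map.1 hs
        exact ht h hh

/-- There are partial parse trees from `g`, and all of them have shape `T`. -/
def HasShape (C : Circuit F n) (g : Fin C.numGates) (T : RTree Kind) : Prop :=
  (∃ t, C.IsPartialParseTree t ∧ t.root = g) ∧
    ∀ t, C.IsPartialParseTree t → t.root = g → C.shape t = T

theorem HasShape.exists_children {g : Fin C.numGates} {T : RTree Kind} (h : C.HasShape g T) :
    ∃ ts, C.IsPartialParseTree (.node g ts) ∧ T = .node (C.gate g).kind (ts.map C.shape) := by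
  obtain ⟨⟨t, ht, hr⟩, hs⟩ := h
  obtain ⟨g', ts⟩ := t
  obtain rfl : g' = g := hr
  exact ⟨ts, ht, by rw [← hs _ ht rfl, shape_node]⟩

theorem HasShape.leaf {g : Fin C.numGates} {T : RTree Kind} (h : C.HasShape g T)
    (hg : (∃ i, C.gate g = .var i) ∨ ∃ c, C.gate g = .const c) :
    T = .node (C.gate g).kind [] := by
  obtain ⟨ts, hts, rfl⟩ := h.exists_children
  obtain ⟨h1, h2, -, -⟩ := hts.children
  rcases hg with ⟨i, hi⟩ | ⟨c, hc⟩
  · rw [h1 i hi]; rfl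
  · rw [h2 c hc]; rfl

/-- A partial parse tree of any child extends to one of `g`, which forces its shape. A child without
partial parse trees has value `0` and may be ignored, hence the condition in the last part. -/
theorem HasShape.plus [Field F] {g : Fin C.numGates} {T : RTree Kind} (h : C.HasShape g T)
    {l : List (F × Fin C.numGates)} (hg : C.gate g = .plus l) :
    ∃ T', T = .node .plus [T'] ∧
      (∃ h ∈ l.map Prod.snd, C.HasShape h T') ∧
      ∀ h ∈ l.map Prod.snd, C.value h ≠ 0 → C.HasShape h T' := by
  obtain ⟨ts, hts, hT⟩ := h.exists_children
  obtain ⟨t, rfl, hr, ht⟩ := hts.children.2.2.1 l hg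
  rw [hg] at hT
  have key : ∀ h' ∈ l.map Prod.snd, (∃ t, C.IsPartialParseTree t ∧ t.root = h') →
      C.HasShape h' (C.shape t) := by
    rintro _ hmem ⟨t', ht', rfl⟩
    refine ⟨⟨t', ht', rfl⟩, fun s hs hsr => ?_⟩
    have := h.2 _ (.plus hg (hsr ▸ hmem) hs) rfl
    rw [shape_node, hT, hg] at this
    injection this with _ this
    simpa using this
  exact ⟨C.shape t, hT, ⟨_, hr, key _ hr ⟨t, ht, rfl⟩⟩, fun h' hmem hv =>
    key h' hmem (exists_isPartialParseTree hv)⟩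

/-- The subtrees below a multiplication gate can be exchanged independently. So each child inherits
a unique shape and the property `Extends` from its parent. -/
theorem set_children {g : Fin C.numGates} {l : List (Fin C.numGates)} (hg : C.gate g = .times l)
    {ts : List (RTree (Fin C.numGates))} (hts : C.IsPartialParseTree (.node g ts)) {j : ℕ}
    {t : RTree (Fin C.numGates)} (ht : C.IsPartialParseTree t) (hj : l[j]? = some t.root) :
    C.IsPartialParseTree (.node g (ts.set j t)) := by
  obtain ⟨hl, hts⟩ := hts.children.2.2.2 l hg
  refine .times hg ?_ ?_
  · rw [List.map_set, hl]
    obtain ⟨hj', he⟩ := List.getElem?_eq_some_iff.1 hj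
    rw [← he, List.set_getElem_self]
  · intro s hs
    rcases List.mem_or_eq_of_mem_set hs with hs | rfl
    · exact hts s hs
    · exact ht

theorem HasShape.times {g : Fin C.numGates} {T : RTree Kind} (h : C.HasShape g T)
    {l : List (Fin C.numGates)} (hg : C.gate g = .times l) :
    ∃ Ts, T = .node .times Ts ∧ List.Forall₂ C.HasShape l Ts := by
  obtain ⟨ts, hts, hT⟩ := h.exists_children
  obtain ⟨hl, hts'⟩ := hts.children.2.2.2 l hg
  rw [hg] at hT
  refine ⟨_, hT, List.forall₂_iff_get.2 ⟨by simp [← hl], fun j hj hj' => ?_⟩⟩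
  have hjt : j < ts.length := by simpa using hj'
  have hlj : l.get ⟨j, hj⟩ = ts[j].root := by simp [← hl]
  refine ⟨⟨ts[j], hts' _ (List.getElem_mem _), hlj.symm⟩, fun s hs hsr => ?_⟩
  have := h.2 _ (set_children hg hts hs (j := j) (by
    rw [hsr]; exact List.getElem?_eq_getElem hj)) rfl
  rw [shape_node, hT, hg] at this
  injection this with _ this
  have := congrArg (fun x => x[j]?) this
  simpa [hjt] using this

theorem prod_mem_homogeneous [Field F] {l : List (Fin C.numGates)} {Ts : List (RTree Kind)}
    (h : List.Forall₂ (fun h T => C.value h ∈ homogeneous F n (shapeBT T).cnt) l Ts) :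
    (l.map C.value).prod ∈ homogeneous F n (shapesBT Ts).cnt := by
  induction h with
  | nil => exact one_mem_homogeneous
  | cons h _ ih =>
    rw [List.map_cons, List.prod_cons]
    exact mul_mem_homogeneous h ih

theorem HasShape.value_mem [Field F] {g : Fin C.numGates} {T : RTree Kind} (h : C.HasShape g T) :
    C.value g ∈ homogeneous F n (shapeBT T).cnt := by
  induction g using WellFoundedLT.induction generalizing T with
  | _ g ih =>
    rcases hg : C.gate g with i | c | l | l
    · rw [h.leaf (.inl ⟨i, hg⟩), C.value_var hg, hg]
      exact ι_mem_homogeneous i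
    · rw [h.leaf (.inr ⟨c, hg⟩), C.value_const hg, hg, Algebra.algebraMap_eq_smul_one]
      exact Submodule.smul_mem _ _ one_mem_homogeneous
    · obtain ⟨T', rfl, -, hT'⟩ := h.plus hg
      rw [C.value_plus hg]
      refine list_sum_mem fun x hx => ?_
      obtain ⟨e, he, rfl⟩ := List.mem_map.1 hx
      refine Submodule.smul_mem _ _ ?_
      by_cases h0 : C.value e.2 = 0
      · rw [h0]; exact Submodule.zero_mem _
      · have hmem : e.2 ∈ l.map Prod.snd := List.mem_map.2 ⟨e, he, rfl⟩
        have := ih e.2 (C.acyclic g e.2 (by rw [hg]; exact hmem)) (hT' _ hmem h0)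
        simpa [shapeBT, shapesBT, BT.cnt] using this
    · obtain ⟨Ts, rfl, hTs⟩ := h.times hg
      rw [C.value_times hg]
      have : (shapeBT (.node .times Ts)).cnt = (shapesBT Ts).cnt := by
        simp [shapeBT, BT.cnt]
      rw [this]
      have hacy : ∀ h ∈ l, h < g := fun h hh => C.acyclic g h (by rw [hg]; exact hh)
      refine prod_mem_homogeneous ?_
      clear this hg h
      induction hTs with
      | nil => exact .nil
      | cons h _ ih' =>
        exact .cons (ih _ (hacy _ (by simp)) h) (ih' fun h hh => hacy h (by simp [hh]))

/-- All partial parse trees from `g` occur at position `τ` in parse trees. -/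
def Extends (C : Circuit F n) (τ : List ℕ) (g : Fin C.numGates) : Prop :=
  ∀ t, C.IsPartialParseTree t → t.root = g →
    ∃ s, C.IsParseTree s ∧ ∀ ρ, s.labelAt (τ ++ ρ) = t.labelAt ρ

theorem HasShape.mem_preimages {τ : List ℕ} {g : Fin C.numGates} {T : RTree Kind}
    (h : C.HasShape g T) (hτ : C.Extends τ g) : g ∈ C.preimages τ := by
  obtain ⟨⟨t, ht, hr⟩, -⟩ := h
  obtain ⟨s, hs, hl⟩ := hτ t ht hr
  refine ⟨s, hs, ?_⟩
  have := hl []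
  rw [List.append_nil] at this
  rw [this]
  cases t
  rw [RTree.labelAt]
  exact congrArg some hr

theorem labelAt_cons {α : Type*} {i : ℕ} {ρ : List ℕ} {a : α} {ts : List (RTree α)} {t : RTree α}
    (h : ts[i]? = some t) : RTree.labelAt (i :: ρ) (.node a ts) = t.labelAt ρ := by
  rw [RTree.labelAt, h]

theorem Extends.plus {τ : List ℕ} {g h : Fin C.numGates} (hτ : C.Extends τ g)
    {l : List (F × Fin C.numGates)} (hg : C.gate g = .plus l) (hl : h ∈ l.map Prod.snd) :
    C.Extends (τ ++ [0]) h := by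
  rintro t ht rfl
  obtain ⟨s, hs, hs'⟩ := hτ _ (.plus hg hl ht) rfl
  refine ⟨s, hs, fun ρ => ?_⟩
  rw [List.append_assoc, hs']
  exact labelAt_cons rfl

theorem Extends.times {τ : List ℕ} {g h : Fin C.numGates} {T : RTree Kind} (hτ : C.Extends τ g)
    (hT : C.HasShape g T) {l : List (Fin C.numGates)} (hg : C.gate g = .times l) {j : ℕ}
    (hj : l[j]? = some h) : C.Extends (τ ++ [j]) h := by
  rintro t ht rfl
  obtain ⟨ts, hts, -⟩ := hT.exists_children
  obtain ⟨s, hs, hs'⟩ := hτ _ (set_children hg hts ht hj) rfl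
  refine ⟨s, hs, fun ρ => ?_⟩
  rw [List.append_assoc, hs']
  refine labelAt_cons ?_
  rw [List.getElem?_set_self]
  have := (List.getElem?_eq_some_iff.1 hj).1
  rwa [← (hts.children.2.2.2 l hg).1, List.length_map] at this

/-- Here the width enters: `HasShape` supplies a partial parse tree and `Extends` puts it at
position `τ` of a full one, so the gate is a genuine preimage. -/
theorem card_le_of_extends {w : ℕ} (hw : C.PreimageWidthLE w) {τ : List ℕ}
    {G : Finset (Fin C.numGates)} {T : RTree Kind}
    (hG : ∀ g ∈ G, C.HasShape g T ∧ C.Extends τ g) : G.card ≤ w := by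
  rw [← Set.ncard_coe_finset]
  exact (Set.ncard_le_ncard (fun g hg => (hG g hg).1.mem_preimages (hG g hg).2)
    (Set.toFinite _)).trans (hw τ)

theorem one_hasDecomposition [Field F] {w : ℕ} (hw : 1 ≤ w) (p : ℕ) :
    HasDecomposition w .nil p (1 : Submodule F (MvPolynomial ℕ F)) := by
  refine ⟨⟨{1}, by simpa using hw, ?_⟩, ?_⟩
  · rw [Submodule.one_eq_span]; simp
  · rw [Submodule.one_le]; exact Subalgebra.one_mem _

theorem span_image_exists [Field F] {w : ℕ} {G : Finset (Fin C.numGates)} (hG : G.card ≤ w)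
    (f : Fin C.numGates → MvPolynomial ℕ F) :
    ∃ A : Finset (MvPolynomial ℕ F), A.card ≤ w ∧
      Submodule.span F (f '' G) = Submodule.span F A := by
  classical
  exact ⟨G.image f, Finset.card_image_le.trans hG, by rw [Finset.coe_image]⟩

/-- The decomposition of a list of shapes, given the decompositions of its members. -/
theorem hasDecomposition_list [Field F] {w : ℕ} (hC : C.PreimageWidthLE w)
    {τ : List ℕ} {G : Finset (Fin C.numGates)} {T : RTree Kind} (hGne : G.Nonempty)
    (hG : ∀ g ∈ G, C.HasShape g T ∧ C.Extends τ g)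
    {c : Fin C.numGates → List (Fin C.numGates)} (hc : ∀ g ∈ G, C.gate g = .times (c g))
    (Us : List (RTree Kind))
    (ih : ∀ U ∈ Us, ∀ (τ : List ℕ) (G : Finset (Fin C.numGates)) (p : ℕ), G.Nonempty →
      (∀ g ∈ G, C.HasShape g U ∧ C.Extends τ g) →
        HasDecomposition w (shapeBT U) p
          (Submodule.span F ((fun g => placePoly F n p (C.value g)) '' G)))
    (j p : ℕ) (hU : ∀ g ∈ G, List.Forall₂ C.HasShape ((c g).drop j) Us) :
    HasDecomposition w (shapesBT Us) p (Submodule.span F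
      ((fun g => placePoly F n p (((c g).drop j).map C.value).prod) '' G)) := by
  classical
  have hcard := card_le_of_extends hC hG
  induction Us generalizing j p with
  | nil =>
    refine ⟨span_image_exists hcard _, ?_⟩
    rw [Submodule.span_le]
    rintro _ ⟨g, hg, rfl⟩
    have := List.forall₂_nil_right_iff.1 (hU g hg)
    simp only [this, List.map_nil, List.prod_nil, placePoly_one]
    exact Subalgebra.one_mem _
  | cons U Us ih' =>
    refine ⟨span_image_exists hcard _, ?_⟩
    -- The default is irrelevant for gates in `G`, where `hU` forces a nonempty list.
    let hd : Fin C.numGates → Fin C.numGates := fun g => ((c g).drop j).headD g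
    have hcons : ∀ g ∈ G, (c g).drop j = hd g :: (c g).drop (j + 1) ∧ C.HasShape (hd g) U ∧
        List.Forall₂ C.HasShape ((c g).drop (j + 1)) Us := by
      intro g hg
      have h := hU g hg
      cases hl : (c g).drop j with
      | nil => rw [hl] at h; cases h
      | cons a l =>
        rw [hl, List.forall₂_cons] at h
        have hl' : (c g).drop (j + 1) = l := by
          rw [← List.drop_drop, hl]; rfl
        have hh : hd g = a := by simp only [hd, hl]; rfl
        rw [hl', hh]
        exact ⟨rfl, h⟩
    -- The heads are gates at the child position. The second space is spanned by one suffix product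
    -- for each gate of `G`, so its dimension is again at most `w`.
    refine ⟨_, _, ih U (by simp) (τ ++ [j]) (G.image hd) p (hGne.image _) ?_,
      ih' (fun U hU => ih U (by simp [hU])) (j + 1) (p + (shapeBT U).cnt)
        (fun g hg => (hcons g hg).2.2), ?_⟩
    · intro h hh
      obtain ⟨g, hg, rfl⟩ := Finset.mem_image.1 hh
      refine ⟨(hcons g hg).2.1, (hG g hg).2.times (hG g hg).1 (hc g hg) ?_⟩
      have := congrArg (fun l => l[0]?) (hcons g hg).1
      simpa using this
    · rw [Submodule.span_le]
      rintro _ ⟨g, hg, rfl⟩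
      obtain ⟨h1, h2, -⟩ := hcons g hg
      dsimp only
      rw [h1, List.map_cons, List.prod_cons, placePoly_mul h2.value_mem]
      refine Submodule.mul_mem_mul (Submodule.subset_span ?_)
        (Submodule.subset_span ⟨g, hg, rfl⟩)
      exact ⟨hd g, Finset.mem_coe.2 (Finset.mem_image_of_mem _ hg), rfl⟩

/-- The induction runs over sets of gates with a common position and shape: the children of such
gates at one child position form such a set again, and the width bounds its size. Node labels other
than variables contribute a `.nil` subtree, matched by the space of constants. -/
theorem hasDecomposition_shape [Field F] {w : ℕ} (hw : 1 ≤ w) (hC : C.PreimageWidthLE w)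
    (T : RTree Kind)
    (τ : List ℕ) (G : Finset (Fin C.numGates)) (p : ℕ) (hGne : G.Nonempty)
    (hG : ∀ g ∈ G, C.HasShape g T ∧ C.Extends τ g) :
    HasDecomposition w (shapeBT T) p
      (Submodule.span F ((fun g => placePoly F n p (C.value g)) '' G)) := by
  classical
  induction hm : sizeOf T using Nat.strong_induction_on generalizing T τ G p with
  | _ m IH =>
  subst hm
  obtain ⟨k, Ts⟩ := T
  have hcard := card_le_of_extends hC hG
  have hkind : ∀ g ∈ G, (C.gate g).kind = k := by
    intro g hg
    obtain ⟨ts, -, hT⟩ := (hG g hg).1.exists_children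
    injection hT with h _
    exact h.symm
  obtain ⟨g₀, hg₀⟩ := hGne
  cases k with
  | var =>
    refine ⟨span_image_exists hcard _, ?_⟩
    rw [Submodule.span_le]
    rintro _ ⟨g, hg, rfl⟩
    have hk := hkind g hg
    rcases hgg : C.gate g with i | c | l | l <;> rw [hgg] at hk <;> cases hk
    have hX : (MvPolynomial.X p : MvPolynomial ℕ F) ∈ MvPolynomial.supported F {p} :=
      MvPolynomial.X_mem_supported.2 (Set.mem_singleton p)
    have hp := Subalgebra.pow_mem _ hX i
    simp only [C.value_var hgg, placePoly_ι]
    exact hp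
  | const =>
    refine ⟨span_image_exists hcard _, 1, 1, one_hasDecomposition hw _, ?_, ?_⟩
    · have hk := hkind g₀ hg₀
      rcases hgg : C.gate g₀ with i | c | l | l <;> rw [hgg] at hk <;> cases hk
      have := (hG g₀ hg₀).1.leaf (.inr ⟨c, hgg⟩)
      injection this with _ this
      rw [this]
      exact one_hasDecomposition hw _
    · rw [mul_one, Submodule.span_le]
      rintro _ ⟨g, hg, rfl⟩
      have hk := hkind g hg
      rcases hgg : C.gate g with i | c | l | l <;> rw [hgg] at hk <;> cases hk
      simp only [C.value_const hgg, Algebra.algebraMap_eq_smul_one, map_smul, placePoly_one]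
      exact Submodule.smul_mem _ _ (Submodule.one_le.1 le_rfl)
  | plus =>
    have hplus : ∀ g ∈ G, ∃ l, C.gate g = .plus l := by
      intro g hg
      have hk := hkind g hg
      rcases hgg : C.gate g with i | c | l | l <;> rw [hgg] at hk <;> cases hk
      exact ⟨l, rfl⟩
    obtain ⟨l₀, hl₀⟩ := hplus g₀ hg₀
    obtain ⟨T', hT', ⟨h₀, hh₀, hs₀⟩, -⟩ := (hG g₀ hg₀).1.plus hl₀
    injection hT' with _ hT'
    subst hT'
    -- The children that occur in parse trees; those left out have value `0` and do not affect the
    -- sums.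
    let G' : Finset (Fin C.numGates) := Finset.univ.filter fun h =>
      C.HasShape h T' ∧ ∃ g ∈ G, h ∈ (C.gate g).children
    have hG' : ∀ h ∈ G', C.HasShape h T' ∧ C.Extends (τ ++ [0]) h := by
      intro h hh
      obtain ⟨-, hs, g, hg, hc⟩ := Finset.mem_filter.1 hh
      obtain ⟨l, hl⟩ := hplus g hg
      rw [hl] at hc
      exact ⟨hs, (hG g hg).2.plus hl hc⟩
    have hne : G'.Nonempty := ⟨h₀, Finset.mem_filter.2
      ⟨Finset.mem_univ _, hs₀, g₀, hg₀, by rw [hl₀]; exact hh₀⟩⟩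
    have ih := IH (sizeOf T') (by simp; omega) T' (τ ++ [0]) G' p hne hG' rfl
    refine ⟨span_image_exists hcard _, 1,
      Submodule.span F ((fun g => placePoly F n p (C.value g)) '' G'),
      one_hasDecomposition hw _, ⟨span_image_exists (card_le_of_extends hC hG') _, _, 1, ih,
        one_hasDecomposition hw _, by rw [mul_one]⟩, ?_⟩
    rw [one_mul, Submodule.span_le]
    rintro _ ⟨g, hg, rfl⟩
    obtain ⟨l, hl⟩ := hplus g hg
    obtain ⟨T'', hT'', -, hs⟩ := (hG g hg).1.plus hl
    injection hT'' with _ hT''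
    injection hT'' with hT''
    subst hT''
    dsimp only
    rw [SetLike.mem_coe, C.value_plus hl, map_list_sum, List.map_map]
    refine list_sum_mem fun x hx => ?_
    obtain ⟨e, he, rfl⟩ := List.mem_map.1 hx
    rw [Function.comp_apply, map_smul]
    refine Submodule.smul_mem _ _ ?_
    by_cases h0 : C.value e.2 = 0
    · rw [h0, map_zero]; exact Submodule.zero_mem _
    · have hmem : e.2 ∈ l.map Prod.snd := List.mem_map.2 ⟨e, he, rfl⟩
      refine Submodule.subset_span ⟨e.2, Finset.mem_coe.2 (Finset.mem_filter.2
        ⟨Finset.mem_univ _, hs _ hmem h0, g, hg, by rw [hl]; exact hmem⟩), rfl⟩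
  | times =>
    have htimes : ∀ g ∈ G, C.gate g = .times (C.gate g).children := by
      intro g hg
      have hk := hkind g hg
      rcases hgg : C.gate g with i | c | l | l <;> rw [hgg] at hk <;> cases hk
      rfl
    have hlist := hasDecomposition_list hC ⟨g₀, hg₀⟩ hG htimes Ts
      (fun U hU τ G p hne hG => IH (sizeOf U) (by
        have := List.sizeOf_lt_of_mem hU
        simp only [RTree.node.sizeOf_spec]
        omega) U τ G p hne hG rfl) 0 p (by
        intro g hg
        obtain ⟨Ts', hT, hf⟩ := (hG g hg).1.times (htimes g hg)
        injection hT with _ hT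
        rwa [hT])
    refine ⟨span_image_exists hcard _, 1, _, one_hasDecomposition hw _, hlist, ?_⟩
    rw [one_mul, Submodule.span_le]
    rintro _ ⟨g, hg, rfl⟩
    refine Submodule.subset_span ⟨g, hg, ?_⟩
    dsimp only
    rw [C.value_times (htimes g hg), List.drop_zero]

end Circuit

/-- The points given by the codes of the leaves hit all nonzero polynomials of the class. -/
theorem uptClass_hit {F : Type*} [Field F] {n d w M : ℕ} {T : RTree Kind} (hw : 1 ≤ w)
    {f : FreeAlgebra F (Fin n)} (hf : f ∈ uptClass F n d T w) (h0 : f ≠ 0)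
    (hM : n * d * (w * w + 1) ^ (5 * Nat.log 2 d) ≤ M)
    (hinj : Set.InjOn (Nat.cast : ℕ → F) (Set.Iic M)) :
    (shapeBT T).cnt = d ∧ ∃ x ≤ M, FreeAlgebra.lift F (fun k : Fin n =>
      stepMatrix d (fun i => codeVal (w * w) (x : F) (leafCode (shapeBT T) i)) k) f ≠ 0 := by
  obtain ⟨hd, C, hU, hC, rfl⟩ := hf
  -- A nonzero output guarantees a parse tree; without one, being UPT says nothing.
  obtain ⟨t, ht, hr⟩ := Circuit.exists_isPartialParseTree h0
  have hs : C.HasShape C.output T := ⟨⟨t, ht, hr⟩, fun s hs hsr => hU s ⟨hs, hsr⟩⟩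
  have hcnt := homogeneous_degree_unique hs.value_mem hd h0
  have hE : C.Extends [] C.output := fun s hs hsr => ⟨s, ⟨hs, hsr⟩, fun ρ => rfl⟩
  have hdec := Circuit.hasDecomposition_shape hw hC T [] {C.output} 0 (by simp)
    (fun g hg => by rw [Finset.mem_singleton.1 hg]; exact ⟨hs, hE⟩)
  refine ⟨hcnt, ?_⟩
  obtain ⟨x, hx, hne⟩ := hdec.exists_point (M := M) hw
    (Submodule.subset_span ⟨C.output, by simp, rfl⟩) (placePoly_ne_zero hd h0 0)
    (degreeOf_placePoly_le hd 0) (by rwa [hcnt]) hinj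
  refine ⟨x, hx, fun hz => hne ?_⟩
  rw [← lift_stepMatrix _ hd, hz]
  rfl

-- The program and its correctness.

namespace Prog

section Eval
variable (a b x : Data) (p q c : Prog) (k m : ℕ)

@[simp] theorem toNat_num : (Data.num k).toNat = k := (rfl)
@[simp] theorem eval_id : id.eval x = x := (rfl)
@[simp] theorem eval_const : (const k).eval x = .num k := (rfl)
@[simp] theorem eval_fst : fst.eval (.pair a b) = a := (rfl)
@[simp] theorem eval_snd : snd.eval (.pair a b) = b := (rfl)
@[simp] theorem eval_isPair_num : isPair.eval (.num k) = .num 0 := (rfl)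
@[simp] theorem eval_isPair_pair : isPair.eval (.pair a b) = .num 1 := (rfl)
@[simp] theorem eval_add : add.eval (.pair a b) = .num (a.toNat + b.toNat) := (rfl)
@[simp] theorem eval_sub : sub.eval (.pair a b) = .num (a.toNat - b.toNat) := (rfl)
@[simp] theorem eval_mul : mul.eval (.pair a b) = .num (a.toNat * b.toNat) := (rfl)
@[simp] theorem eval_comp : (comp p q).eval x = q.eval (p.eval x) := (rfl)
@[simp] theorem eval_pair : (pair p q).eval x = .pair (p.eval x) (q.eval x) := (rfl)
@[simp] theorem eval_cond :
    (cond c p q).eval x = if (c.eval x).toNat = 0 then q.eval x else p.eval x := by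
  rw [eval, ite_not]
@[simp] theorem eval_loop : (loop p).eval (.pair (.num k) x) = p.eval^[k] x := (rfl)
theorem eval_fold : (fold p q).eval (.pair x a) = Data.fold p.eval q.eval a x := (rfl)

end Eval

/-- The operation `o` on the results of two programs. -/
def op (o p q : Prog) : Prog := (pair p q).comp o

@[simp] theorem eval_op (o p q : Prog) (x : Data) :
    (op o p q).eval x = o.eval (.pair (p.eval x) (q.eval x)) := (rfl)

/-- A number that is nonzero if and only if the results of two programs are different numbers. -/
def neP (p q : Prog) : Prog := op add (op sub p q) (op sub q p)

theorem eval_neP {p q : Prog} {x : Data} {k m : ℕ} (hp : p.eval x = .num k)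
    (hq : q.eval x = .num m) : (neP p q).eval x = .num (k - m + (m - k)) := by
  simp [neP, hp, hq]

/-- Entry number `i` of a list, from the input `(i, l)`. -/
def nthP : Prog := (loop snd).comp fst

theorem eval_nthP {l : List Data} {i : ℕ} (hi : i < l.length) :
    nthP.eval (.pair (.num i) (.ofList l)) = l[i] := by
  have h : ∀ (i : ℕ) (l : List Data), i ≤ l.length →
      (snd.eval)^[i] (.ofList l) = .ofList (l.drop i) := by
    intro i
    induction i with
    | zero => simp
    | succ i ih =>
      intro l hl
      obtain _ | ⟨a, l⟩ := l
      · simp at hl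
      · rw [Function.iterate_succ_apply]
        exact ih l (by simpa using hl)
  rw [nthP, eval_comp, eval_loop, h i l hi.le, List.drop_eq_getElem_cons hi, Data.ofList, eval_fst]

/-- One step of `tabP`. -/
def tabStep (p : Prog) : Prog :=
  (pair (pair (op sub (fst.comp fst) (const 1)) (fst.comp snd)) snd).comp
    (pair fst (pair (fst.comp p) snd))

/-- The list of the values of `p` at `(0, e), …, (N - 1, e)`, from the input `(N, e)`. -/
def tabP (p : Prog) : Prog :=
  (pair fst (pair id (const 0))).comp ((loop (tabStep p)).comp snd)

/-- The counter runs downwards, so that putting each new value in front yields the list in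
increasing order. -/
theorem iterate_tabStep (p : Prog) (N j : ℕ) (hj : j ≤ N) (e : Data) :
    ((tabStep p).eval)^[j] (.pair (.pair (.num N) e) (.num 0)) =
      .pair (.pair (.num (N - j)) e)
        (.ofList ((List.range' (N - j) j).map fun i => p.eval (.pair (.num i) e))) := by
  induction j with
  | zero => rfl
  | succ j ih =>
    rw [Function.iterate_succ_apply', ih (by omega)]
    have : N - j = N - (j + 1) + 1 := by omega
    simp only [tabStep, eval_op, eval_comp, eval_pair, eval_fst, eval_snd, eval_const, eval_sub,
      toNat_num, Nat.sub_sub]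
    rw [List.range'_succ, List.map_cons, ← this]
    rfl

theorem eval_tabP (p : Prog) (N : ℕ) (e : Data) :
    (tabP p).eval (.pair (.num N) e) =
      .ofList ((List.range N).map fun i => p.eval (.pair (.num i) e)) := by
  rw [tabP, eval_comp, eval_comp, eval_pair, eval_pair, eval_fst, eval_id, eval_const, eval_loop,
    iterate_tabStep p N N le_rfl, Nat.sub_self, eval_snd, List.range_eq_range']

theorem eval_tabP_eq {p : Prog} {N : ℕ} {e : Data} {l : List Data} (hl : l.length = N)
    (h : ∀ (i : ℕ) (hi : i < l.length), p.eval (.pair (.num i) e) = l[i]) :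
    (tabP p).eval (.pair (.num N) e) = .ofList l := by
  rw [eval_tabP]
  congr 1
  refine List.ext_getElem (by simp [hl]) fun i h₁ h₂ => ?_
  rw [List.getElem_map, List.getElem_range, h i h₂]

/-- One step of `halfP`. -/
def halfStep : Prog := pair add (op sub (const 1) snd)

/-- Half of a number, rounded down. -/
def halfP : Prog := (pair id (pair (const 0) (const 0))).comp ((loop halfStep).comp fst)

/-- The state is the quotient and the remainder of the number of rounds modulo `2`: the old
remainder is added to the quotient, then it is flipped. -/
theorem iterate_halfStep (j : ℕ) :
    (halfStep.eval)^[j] (.pair (.num 0) (.num 0)) = .pair (.num (j / 2)) (.num (j % 2)) := by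
  induction j with
  | zero => rfl
  | succ j ih =>
    rw [Function.iterate_succ_apply', ih]
    simp only [halfStep, eval_op, eval_pair, eval_snd, eval_const, eval_add, eval_sub, toNat_num]
    congr 2 <;> omega

theorem eval_halfP (x : ℕ) : halfP.eval (.num x) = .num (x / 2) := by
  simp [halfP, iterate_halfStep]

/-- One step of `hbP`. -/
def hbStep : Prog :=
  cond (neP (snd.comp fst) (snd.comp snd))
    (pair (op add fst (const 1))
      (pair ((snd.comp fst).comp halfP) ((snd.comp snd).comp halfP))) id

/-- The function `hb`. -/
def hbP : Prog := (pair add (pair (const 0) id)).comp ((loop hbStep).comp fst)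

theorem eval_hbStep (c x y : ℕ) :
    hbStep.eval (.pair (.num c) (.pair (.num x) (.num y))) =
      if x = y then .pair (.num c) (.pair (.num x) (.num y))
      else .pair (.num (c + 1)) (.pair (.num (x / 2)) (.num (y / 2))) := by
  rw [hbStep, eval_cond, eval_neP (k := x) (m := y) (by simp) (by simp)]
  by_cases h : x = y
  · simp [h]
  · rw [if_neg (by simp; omega), if_neg h]
    simp [eval_halfP]

/-- After the two numbers agree, the remaining rounds are idle. The bounds for the intermediate
state are needed for the cost. -/
theorem iterate_hbStep (k c x y : ℕ) : ∃ c' x' y', c' ≤ c + k ∧ x' ≤ x ∧ y' ≤ y ∧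
    (hb x y ≤ k → c' = c + hb x y) ∧
    (hbStep.eval)^[k] (.pair (.num c) (.pair (.num x) (.num y))) =
      .pair (.num c') (.pair (.num x') (.num y')) := by
  induction k generalizing c x y with
  | zero => exact ⟨c, x, y, le_rfl, le_rfl, le_rfl, by omega, rfl⟩
  | succ k ih =>
    rw [Function.iterate_succ_apply, eval_hbStep]
    by_cases h : x = y
    · rw [if_pos h]
      obtain ⟨c', x', y', h1, h2, h3, h4, h5⟩ := ih c x y
      refine ⟨c', x', y', by omega, h2, h3, fun _ => h4 ?_, h5⟩
      rw [h, hb_self]; omega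
    · rw [if_neg h]
      obtain ⟨c', x', y', h1, h2, h3, h4, h5⟩ := ih (c + 1) (x / 2) (y / 2)
      refine ⟨c', x', y', by omega, by omega, by omega, fun hk => ?_, h5⟩
      rw [hb_of_ne h] at hk ⊢
      rw [h4 (by omega)]; omega

theorem eval_hbP (x y : ℕ) : hbP.eval (.pair (.num x) (.num y)) = .num (hb x y) := by
  obtain ⟨c', x', y', -, -, -, h4, h5⟩ := iterate_hbStep (x + y) 0 x y
  simp [hbP, h5, h4 hb_le]

/-- Codes as data. -/
def encBits (u : List Bool) : Data := .ofList (u.map fun b => .num b.toNat)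

/-- Records as data. -/
def encRec (r : Rec) : Data := .pair (.num r.1) (encBits r.2)

/-- The function `flat`. -/
def flatP : Prog :=
  (pair (op sub fst (snd.comp fst))
    (cond (snd.comp fst) (pair (const 0) (snd.comp snd)) (snd.comp snd))).comp
  (loop (pair (const 1) id))

theorem eval_flatP {e : ℕ} {r : Rec} (h : r.1 ≤ e) :
    flatP.eval (.pair (.num e) (encRec r)) = encBits (flat e r) := by
  have key : ∀ k, ((pair (const 1) id).eval)^[k] (encBits (flat r.1 r)) =
      encBits (flat (r.1 + k) r) := by
    intro k
    induction k with
    | zero => rfl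
    | succ k ih =>
      rw [Function.iterate_succ_apply', ih, ← add_assoc, flat, if_pos (by omega)]
      rfl
  obtain ⟨k, rfl⟩ := Nat.exists_eq_add_of_le h
  rw [← key]
  have h0 : flat r.1 r = if r.1 = 0 then r.2 else false :: r.2 := by
    obtain ⟨_ | t, u⟩ := r <;> simp [flat]
  rw [h0]
  simp only [flatP, eval_op, eval_comp, eval_pair, eval_fst, eval_snd, eval_sub, eval_cond,
    toNat_num, encRec, Nat.add_sub_cancel_left, eval_loop, eval_const]
  split <;> rfl

/-- The function `heavyRec`. -/
def heavyP : Prog :=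
  cond (op sub fst (snd.comp fst))
    (pair fst (pair (const 0) ((pair (op sub fst (const 1)) snd).comp flatP))) snd

theorem eval_heavyP (e : ℕ) (r : Rec) :
    heavyP.eval (.pair (.num e) (encRec r)) = encRec (heavyRec e r) := by
  have hf : r.1 < e → _ := fun h => eval_flatP (r := r) (e := e - 1) (by omega)
  rw [heavyRec]
  simp only [heavyP, eval_cond, eval_op, eval_comp, eval_pair, eval_fst, eval_snd, eval_sub,
    toNat_num, encRec, eval_const] at hf ⊢
  by_cases h : r.1 < e
  · rw [if_neg (by omega), if_pos h, hf h]
    rfl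
  · rw [if_pos (by omega), if_neg h]

/-- The function `lightRec`. -/
def lightP : Prog := pair fst (pair (const 1) flatP)

theorem eval_lightP {e : ℕ} {r : Rec} (h : r.1 ≤ e) :
    lightP.eval (.pair (.num e) (encRec r)) = encRec (lightRec e r) := by
  rw [lightP, eval_pair, eval_pair, eval_fst, eval_const, eval_flatP h]
  rfl

/-- The number of marked leaves and the records of a tree, as data. -/
def encNode (t : BT) : Data := .pair (.num t.cnt) (.ofList ((recs t).map encRec))

/-- The record with number `i` in a joined tree, from the input `(i, e, x, y)` with the level `e` of
the new block and the data `x`, `y` of the two subtrees. -/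
def joinEntry : Prog :=
  cond (op sub (snd.comp (snd.comp (fst.comp fst))) fst)
    (cond (op sub (snd.comp (snd.comp (snd.comp fst))) (snd.comp (snd.comp (fst.comp fst))))
      (op lightP (snd.comp fst) (op nthP fst (snd.comp (snd.comp (fst.comp snd)))))
      (op heavyP (snd.comp fst) (op nthP fst (snd.comp (snd.comp (fst.comp snd))))))
    (cond (op sub (snd.comp (snd.comp (snd.comp fst))) (snd.comp (snd.comp (fst.comp fst))))
      (op heavyP (snd.comp fst) (op nthP (op sub fst (snd.comp (snd.comp (fst.comp fst))))
        (snd.comp (snd.comp (snd.comp snd)))))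
      (op lightP (snd.comp fst) (op nthP (op sub fst (snd.comp (snd.comp (fst.comp fst))))
        (snd.comp (snd.comp (snd.comp snd))))))

/-- The function `joinLevel`, on the data of two subtrees. -/
def levelP : Prog :=
  op sub (op hbP (cond (op sub (fst.comp fst) (snd.comp fst)) (fst.comp fst) (snd.comp fst))
    (op add (fst.comp fst) (snd.comp fst))) (const 1)

theorem eval_levelP (m k : ℕ) (x y : Data) :
    levelP.eval (.pair (.pair (.num m) x) (.pair (.num k) y)) = .num (joinLevel m k) := by
  have : (if m - k = 0 then Data.num k else Data.num m) = .num (max m k) := by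
    split <;> congr 1 <;> omega
  simp only [levelP, eval_op, eval_comp, eval_cond, eval_fst, eval_snd, eval_sub, eval_add,
    toNat_num, this, eval_hbP, eval_const, joinLevel]

/-- The data of a joined tree, from those of the two subtrees. -/
def joinP : Prog :=
  pair (op add (fst.comp fst) (snd.comp fst))
    ((pair (op add (fst.comp fst) (snd.comp fst)) (pair levelP id)).comp (tabP joinEntry))

/-- `lightP` is correct only for records up to the new level, since it computes with truncated
differences; `balanced` and `joinLevel_spec` guarantee this for the lighter subtree. -/
theorem eval_joinP (a b : BT) :
    joinP.eval (.pair (encNode a) (encNode b)) = encNode (.br a b) := by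
  have hlb : a.cnt < b.cnt → ∀ r ∈ recs a, r.1 ≤ joinLevel a.cnt b.cnt := by
    intro h r hr
    have hr' := (balanced a).le_log hr
    have h0 : 0 < a.cnt := by
      rw [← length_recs]; exact List.length_pos_of_mem hr
    rw [joinLevel_comm]
    exact hr'.trans (joinLevel_spec h0 h.le).2.2.2
  have hla : b.cnt ≤ a.cnt → ∀ r ∈ recs b, r.1 ≤ joinLevel a.cnt b.cnt := by
    intro h r hr
    have hr' := (balanced b).le_log hr
    have h0 : 0 < b.cnt := by
      rw [← length_recs]; exact List.length_pos_of_mem hr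
    exact hr'.trans (joinLevel_spec h0 h).2.2.2
  have hl := eval_levelP a.cnt b.cnt (.ofList ((recs a).map encRec)) (.ofList ((recs b).map encRec))
  have htab : (tabP joinEntry).eval (.pair (.num (a.cnt + b.cnt))
      (.pair (.num (joinLevel a.cnt b.cnt)) (.pair (encNode a) (encNode b)))) =
      .ofList ((recs (.br a b)).map encRec) := by
    refine eval_tabP_eq (by rw [List.length_map, length_recs]; rfl) fun i hi => ?_
    rw [List.length_map, length_recs, BT.cnt] at hi
    have hleft : ∀ h : i < a.cnt, nthP.eval (.pair (.num i) (.ofList ((recs a).map encRec))) =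
        encRec ((recs a)[i]'(by rwa [length_recs])) := by
      intro h
      rw [eval_nthP (by rw [List.length_map, length_recs]; exact h), List.getElem_map]
    have hright : ∀ h : ¬ i < a.cnt,
        nthP.eval (.pair (.num (i - a.cnt)) (.ofList ((recs b).map encRec))) =
        encRec ((recs b)[i - a.cnt]'(by rw [length_recs]; omega)) := by
      intro h
      rw [eval_nthP (by rw [List.length_map, length_recs]; omega), List.getElem_map]
    simp only [joinEntry, encNode, eval_cond, eval_op, eval_comp, eval_fst, eval_snd, eval_sub,
      toNat_num]
    rw [List.getElem_map]
    by_cases h : b.cnt ≤ a.cnt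
    · have hba : b.cnt - a.cnt = 0 := by omega
      rw [if_pos hba, if_pos hba]
      simp only [recs, if_pos h]
      by_cases hia : i < a.cnt
      · rw [if_neg (by omega), hleft hia, eval_heavyP,
          List.getElem_append_left (by rwa [List.length_map, length_recs]), List.getElem_map]
      · rw [if_pos (by omega), hright hia, eval_lightP (hla h _ (List.getElem_mem _)),
          List.getElem_append_right (by rw [List.length_map, length_recs]; omega)]
        simp only [List.length_map, length_recs, List.getElem_map]
    · have hba : ¬ b.cnt - a.cnt = 0 := by omega
      rw [if_neg hba, if_neg hba]
      simp only [recs, if_neg h]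
      by_cases hia : i < a.cnt
      · rw [if_neg (by omega), hleft hia, eval_lightP (hlb (by omega) _ (List.getElem_mem _)),
          List.getElem_append_left (by rwa [List.length_map, length_recs]), List.getElem_map]
      · rw [if_pos (by omega), hright hia, eval_heavyP,
          List.getElem_append_right (by rw [List.length_map, length_recs]; omega)]
        simp only [List.length_map, length_recs, List.getElem_map]
  simp only [encNode] at hl htab ⊢
  simp only [joinP, eval_op, eval_comp, eval_pair, eval_fst, eval_snd, eval_add, eval_id,
    toNat_num, hl, htab, BT.cnt]

/-- The number `0`, which marks the shapes that are variable leaves. -/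
def isZero : Data → Bool
  | .num 0 => true
  | _ => false

/-- The binary tree in a datum; its marked leaves are the pairs that start with `0`. -/
def toBT : Data → BT
  | .num _ => .nil
  | .pair a b => if isZero a then .leaf else .br (toBT a) (toBT b)

/-- The recursion need not know whether a pair is a shape or a list cell: a list cell starts with an
encoded shape, which is a pair, so only variable leaves start with the number `0`. -/
theorem toBT_encodeShape (T : RTree Kind) : toBT (encodeShape T) = shapeBT T := by
  induction hm : sizeOf T using Nat.strong_induction_on generalizing T with
  | _ m IH =>
    subst hm
    obtain ⟨k, Ts⟩ := T
    have hl : toBT (encodeShapes Ts) = shapesBT Ts := by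
      have : ∀ U ∈ Ts, toBT (encodeShape U) = shapeBT U := fun U hU =>
        IH (sizeOf U) (by
          have := List.sizeOf_lt_of_mem hU
          simp only [RTree.node.sizeOf_spec]
          omega) U rfl
      clear IH
      induction Ts with
      | nil => rfl
      | cons U Us ih =>
        rw [encodeShapes, toBT, shapesBT, if_neg, this U (by simp),
          ih fun V hV => this V (by simp [hV])]
        cases U
        simp [encodeShape, isZero]
    cases k
    · simp [encodeShape, Kind.encode, toBT, isZero, shapeBT]
    all_goals
      rw [encodeShape, Kind.encode, toBT, if_neg (by simp [isZero]), hl]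
      rfl

/-- The recursion step of `recsP`. -/
def recsStep : Prog :=
  cond (snd.comp (fst.comp (fst.comp isPair))) (snd.comp (snd.comp joinP))
    (cond (snd.comp (fst.comp fst)) (snd.comp (snd.comp joinP))
      (pair (const 1) (pair (pair (const 0) (const 0)) (const 0))))

/-- The number of marked leaves and the records of the binary tree in a datum. -/
def recsP : Prog := (pair id (const 0)).comp (fold (pair (const 0) (const 0)) recsStep)

theorem eval_recsStep (e a b : Data) :
    recsStep.eval (.pair e (.pair (.pair a b) (.pair (encNode (toBT a)) (encNode (toBT b))))) =
      encNode (toBT (.pair a b)) := by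
  rw [toBT]
  simp only [recsStep, eval_cond, eval_comp, eval_fst, eval_snd, eval_joinP]
  rcases a with (_ | k) | ⟨a, a'⟩
  · rfl
  · simp [isZero]
  · simp [isZero]

theorem fold_recs (e x : Data) :
    Data.fold (pair (const 0) (const 0)).eval recsStep.eval e x = encNode (toBT x) := by
  induction x with
  | num k => rfl
  | pair a b iha ihb => rw [Data.fold, iha, ihb, eval_recsStep]

theorem eval_recsP (x : Data) : recsP.eval x = encNode (toBT x) := by
  rw [recsP, eval_comp, eval_pair, eval_fold]
  exact fold_recs _ x

/-- One step of `powP`. -/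
def powStep : Prog := pair fst mul

/-- The power `v ^ m`, from the input `(v, m)`. -/
def powP : Prog := (pair snd (pair fst (const 1))).comp ((loop powStep).comp snd)

theorem iterate_powStep (v j : ℕ) :
    (powStep.eval)^[j] (.pair (.num v) (.num 1)) = .pair (.num v) (.num (v ^ j)) := by
  induction j with
  | zero => rfl
  | succ j ih =>
    rw [Function.iterate_succ_apply', ih, pow_succ']
    rfl

theorem eval_powP (v m : ℕ) : powP.eval (.pair (.num v) (.num m)) = .num (v ^ m) := by
  simp [powP, iterate_powStep]

/-- One step of `valP`. -/
def valStep : Prog :=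
  cond (snd.comp (fst.comp isPair))
    (pair fst (pair (snd.comp (fst.comp snd))
      (op mul (op powP (snd.comp snd) fst)
        (op add (const 1) (op mul (snd.comp (fst.comp fst)) (snd.comp snd)))))) id

/-- The function `codeVal`, from the input `(L, W, u, v)` with a bound `L` for the length of the
code `u`. -/
def valP : Prog := (loop valStep).comp (snd.comp snd)

theorem iterate_valStep (W v j : ℕ) (u : List Bool) :
    (valStep.eval)^[j] (.pair (.num W) (.pair (encBits u) (.num v))) =
      .pair (.num W) (.pair (encBits (u.drop j)) (.num (codeVal W v (u.take j)))) := by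
  induction j generalizing u v with
  | zero => simp [codeVal]
  | succ j ih =>
    rw [Function.iterate_succ_apply]
    obtain _ | ⟨b, u⟩ := u
    · have h : valStep.eval (.pair (.num W) (.pair (encBits []) (.num v))) =
        .pair (.num W) (.pair (encBits []) (.num v)) := rfl
      rw [h, ih]
      simp
    · have h : valStep.eval (.pair (.num W) (.pair (encBits (b :: u)) (.num v))) =
        .pair (.num W) (.pair (encBits u) (.num (v ^ W * (if b then 1 + v else 1)))) := by
        cases b <;> simp [valStep, encBits, Data.ofList, eval_powP]
      rw [h, ih]
      rfl

theorem eval_valP {W v L : ℕ} {u : List Bool} (h : u.length ≤ L) :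
    valP.eval (.pair (.num L) (.pair (.num W) (.pair (encBits u) (.num v)))) =
      .num (codeVal W v u) := by
  simp [valP, iterate_valStep, List.take_of_length_le h]

/-- From the input and the records: the parameters `W`, `K`, `L` are put in front. -/
def paramP : Prog :=
  pair (pair (op mul (fst.comp (snd.comp (snd.comp snd))) (fst.comp (snd.comp (snd.comp snd))))
    (pair (op sub (op hbP (const 0) (fst.comp (snd.comp fst))) (const 1))
      (op mul (const 5) (op sub (op hbP (const 0) (fst.comp (snd.comp fst))) (const 1))))) id

/-- The number of points. -/
def countP : Prog :=
  op add (op mul (op mul (snd.comp (fst.comp fst)) (snd.comp (fst.comp (snd.comp fst))))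
    (op powP (op add (fst.comp fst) (const 1)) (fst.comp (snd.comp snd)))) (const 1)

/-- The nonzero entries of the matrices, from the input `(j, i, k, t, g)`. -/
def powEntryP : Prog :=
  op powP
    ((pair (snd.comp (snd.comp (snd.comp (snd.comp (fst.comp (snd.comp snd))))))
      (pair (snd.comp (snd.comp (snd.comp (snd.comp (fst.comp fst)))))
        (pair (op flatP (snd.comp (snd.comp (snd.comp (snd.comp (fst.comp (snd.comp fst))))))
          (op nthP (snd.comp fst)
            (snd.comp (snd.comp (snd.comp (snd.comp (snd.comp (snd.comp snd))))))))
          (snd.comp (snd.comp (snd.comp fst)))))).comp valP)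
    (snd.comp (snd.comp fst))

/-- The entries of the matrices, from the input `(j, i, k, t, g)`. -/
def entryP : Prog :=
  cond (neP fst (op add (snd.comp fst) (const 1))) (const 0) powEntryP

/-- The rows of the matrices, from the input `(i, k, t, g)`. -/
def rowP : Prog :=
  (pair (op add (snd.comp (snd.comp (snd.comp (snd.comp (fst.comp (snd.comp fst)))))) (const 1))
    id).comp (tabP entryP)

/-- The matrices, from the input `(k, t, g)`. -/
def matrixP : Prog :=
  (pair (op add (snd.comp (snd.comp (snd.comp (fst.comp (snd.comp fst))))) (const 1)) id).comp
    (tabP rowP)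

/-- The points, from the input `(t, g)`. -/
def pointP : Prog := (pair (snd.comp (snd.comp (fst.comp fst))) id).comp (tabP matrixP)

/-- The program that lists the hitting set. -/
def mainP : Prog :=
  (pair id ((snd.comp (snd.comp fst)).comp recsP)).comp
    (cond (neP (snd.comp fst) (fst.comp (snd.comp fst))) (const 0)
      (paramP.comp ((pair countP id).comp (tabP pointP))))

/-- The parameters, the input and the records, as data. -/
def encEnv (n d w : ℕ) (x : Data) (t : BT) : Data :=
  .pair (.pair (.num (w * w)) (.pair (.num (Nat.log 2 d)) (.num (5 * Nat.log 2 d))))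
    (.pair (.pair (.num n) (.pair (.num d) (.pair x (.num w)))) (encNode t))

theorem eval_paramP (n d w : ℕ) (hd : d ≠ 0) (x : Data) (t : BT) :
    paramP.eval (.pair (.pair (.num n) (.pair (.num d) (.pair x (.num w)))) (encNode t)) =
      encEnv n d w x t := by
  simp [paramP, encEnv, eval_hbP, hb_zero_left hd]

/-- The number of points. -/
def numPoints (n d w : ℕ) : ℕ := n * d * (w * w + 1) ^ (5 * Nat.log 2 d) + 1

theorem eval_countP (n d w : ℕ) (x : Data) (t : BT) :
    countP.eval (encEnv n d w x t) = .num (numPoints n d w) := by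
  simp [countP, encEnv, eval_powP, numPoints]

theorem eval_nthP_leafCode {t : BT} {i : ℕ} (hi : i < t.cnt) :
    flatP.eval (.pair (.num (Nat.log 2 t.cnt))
      (nthP.eval (.pair (.num i) (.ofList ((recs t).map encRec))))) = encBits (leafCode t i) := by
  rw [← length_recs] at hi
  rw [eval_nthP (by simpa using hi), List.getElem_map,
    eval_flatP ((balanced t).le_log (List.getElem_mem hi)), leafCode_eq hi]

theorem eval_entryP {n w : ℕ} {x : Data} {t : BT} (v k i j : ℕ) (hj : j < t.cnt + 1) :
    entryP.eval (.pair (.num j) (.pair (.num i) (.pair (.num k)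
      (.pair (.num v) (encEnv n t.cnt w x t))))) =
      .num (if j = i + 1 then codeVal (w * w) v (leafCode t i) ^ k else 0) := by
  rw [entryP, eval_cond, eval_neP (k := j) (m := i + 1) (by simp) (by simp), toNat_num]
  by_cases h : j = i + 1
  · rw [if_pos (by omega), if_pos h]
    simp only [powEntryP, encEnv, encNode, eval_op, eval_comp, eval_pair, eval_fst, eval_snd]
    rw [eval_nthP_leafCode (by omega), eval_valP (length_leafCode_le t (by omega)), eval_powP]
  · rw [if_neg (by omega), if_neg h, eval_const]

theorem eval_rowP {n w : ℕ} {x : Data} {t : BT} (v k i : ℕ) :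
    rowP.eval (.pair (.num i) (.pair (.num k) (.pair (.num v) (encEnv n t.cnt w x t)))) =
      .ofList (List.ofFn fun j : Fin (t.cnt + 1) =>
        .num (if (j : ℕ) = i + 1 then codeVal (w * w) v (leafCode t i) ^ k else 0)) := by
  have : rowP.eval (.pair (.num i) (.pair (.num k) (.pair (.num v) (encEnv n t.cnt w x t)))) =
      (tabP entryP).eval (.pair (.num (t.cnt + 1))
        (.pair (.num i) (.pair (.num k) (.pair (.num v) (encEnv n t.cnt w x t))))) := by
    simp [rowP, encEnv]
  rw [this]
  refine eval_tabP_eq (by simp) fun j hj => ?_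
  rw [eval_entryP _ _ _ _ (by simpa only [List.length_ofFn] using hj), List.getElem_ofFn]

theorem eval_matrixP {n w : ℕ} {x : Data} {t : BT} (v k : ℕ) :
    matrixP.eval (.pair (.num k) (.pair (.num v) (encEnv n t.cnt w x t))) =
      encodeMatrix (stepMatrix t.cnt (fun i => codeVal (w * w) v (leafCode t i)) k) := by
  have : matrixP.eval (.pair (.num k) (.pair (.num v) (encEnv n t.cnt w x t))) =
      (tabP rowP).eval (.pair (.num (t.cnt + 1))
        (.pair (.num k) (.pair (.num v) (encEnv n t.cnt w x t)))) := by
    simp [matrixP, encEnv]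
  rw [this]
  refine eval_tabP_eq (by simp) fun i hi => ?_
  rw [eval_rowP, List.getElem_ofFn]
  rfl

theorem eval_pointP {n w : ℕ} {x : Data} {t : BT} (v : ℕ) :
    pointP.eval (.pair (.num v) (encEnv n t.cnt w x t)) =
      .ofList (List.ofFn fun k : Fin n =>
        encodeMatrix (stepMatrix t.cnt (fun i => codeVal (w * w) v (leafCode t i)) k)) := by
  have : pointP.eval (.pair (.num v) (encEnv n t.cnt w x t)) =
      (tabP matrixP).eval (.pair (.num n) (.pair (.num v) (encEnv n t.cnt w x t))) := by
    simp [pointP, encEnv]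
  rw [this]
  refine eval_tabP_eq (by simp) fun i hi => ?_
  rw [eval_matrixP]
  simp

/-- The hitting set. -/
def hittingPoints (n d w : ℕ) (t : BT) : List (Fin n → Matrix (Fin (d + 1)) (Fin (d + 1)) ℕ) :=
  if t.cnt = d then
    (List.range (numPoints n d w)).map fun v k =>
      stepMatrix d (fun i => codeVal (w * w) v (leafCode t i)) k
  else []

theorem eval_mainP {n d w : ℕ} {T : RTree Kind} (hd : d ≠ 0) :
    mainP.eval (encodeInput n d T w) = encodePoints (hittingPoints n d w (shapeBT T)) := by
  have h0 : mainP.eval (encodeInput n d T w) =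
      if (shapeBT T).cnt = d then (tabP pointP).eval (.pair (.num (numPoints n d w))
        (encEnv n d w (encodeShape T) (shapeBT T))) else .num 0 := by
    rw [mainP, encodeInput, eval_comp, eval_pair, eval_id, eval_comp, eval_comp, eval_comp,
      eval_snd, eval_snd, eval_fst, eval_recsP, toBT_encodeShape, eval_cond,
      eval_neP (k := (shapeBT T).cnt) (m := d) (by simp [encNode]) (by simp), toNat_num,
      eval_comp, eval_paramP n d w hd, eval_comp, eval_pair, eval_countP, eval_id, eval_const]
    by_cases h : (shapeBT T).cnt = d
    · rw [if_pos (by omega), if_pos h]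
    · rw [if_neg (by omega), if_neg h]
  rw [h0, hittingPoints]
  by_cases h : (shapeBT T).cnt = d
  · subst h
    rw [if_pos rfl, if_pos rfl, eval_tabP, encodePoints, List.map_map]
    congr 1
    refine List.map_congr_left fun v _ => ?_
    rw [eval_pointP]
    rfl
  · rw [if_neg h, if_neg h]
    rfl

/-- The characteristic is used only to keep the parameters `0, ..., M` distinct. If the number of
variable leaves is not `d`, the class has no nonzero member and the empty list suffices. -/
theorem isHittingSet_hittingPoints {F : Type*} [Field F] {n d w : ℕ} {T : RTree Kind} (hw : 1 ≤ w)
    (hF : ringChar F = 0 ∨ numPoints n d w ≤ ringChar F) :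
    IsHittingSet (pointsOver F (hittingPoints n d w (shapeBT T))) (uptClass F n d T w) := by
  intro f hf h0
  have hinj : Set.InjOn (Nat.cast : ℕ → F)
      (Set.Iic (n * d * (w * w + 1) ^ (5 * Nat.log 2 d))) := by
    intro a ha b hb hab
    have ha : a < numPoints n d w := Nat.lt_succ_of_le ha
    have hb : b < numPoints n d w := Nat.lt_succ_of_le hb
    have := (CharP.cast_eq_iff_mod_eq F (ringChar F)).1 hab
    rcases hF with h | h
    · rwa [h, Nat.mod_zero, Nat.mod_zero] at this
    · rwa [Nat.mod_eq_of_lt (by omega), Nat.mod_eq_of_lt (by omega)] at this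
  obtain ⟨hcnt, v, hv, hne⟩ := uptClass_hit hw hf h0 le_rfl hinj
  refine ⟨_, ⟨fun k : Fin n => stepMatrix d (fun i => codeVal (w * w) v
    (leafCode (shapeBT T) i)) (k : ℕ), ?_, rfl⟩, ?_⟩
  · rw [hittingPoints, if_pos hcnt]
    exact List.mem_map.2 ⟨v, List.mem_range.2 (Nat.lt_succ_of_le hv), rfl⟩
  · convert hne using 5 with k
    ext i j
    simp only [Matrix.map_apply, stepMatrix]
    split
    · rw [Nat.cast_pow]
      congr 1
      exact map_codeVal (Nat.castRingHom F) _ _ _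
    · exact Nat.cast_zero

end Prog

-- Cost estimates, for families of inputs measured by a common size.

/-- The function `f` is bounded by a power of `N + 2`. -/
def PolyBounded {ι : Type} (N f : ι → ℕ) : Prop := ∃ k, ∀ i, f i ≤ (N i + 2) ^ k

namespace PolyBounded

variable {ι κ : Type} {N f g : ι → ℕ}

theorem mono (hg : PolyBounded N g) (h : ∀ i, f i ≤ g i) : PolyBounded N f := by
  obtain ⟨k, hk⟩ := hg
  exact ⟨k, fun i => (h i).trans (hk i)⟩

theorem const (c : ℕ) : PolyBounded N fun _ => c :=
  ⟨c, fun i => c.lt_two_pow_self.le.trans (Nat.pow_le_pow_left (by omega) c)⟩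

theorem self : PolyBounded N N := ⟨1, fun i => by rw [pow_one]; omega⟩

theorem mul (hf : PolyBounded N f) (hg : PolyBounded N g) : PolyBounded N fun i => f i * g i := by
  obtain ⟨k, hk⟩ := hf
  obtain ⟨m, hm⟩ := hg
  exact ⟨k + m, fun i => (Nat.mul_le_mul (hk i) (hm i)).trans (pow_add _ _ _).ge⟩

theorem add (hf : PolyBounded N f) (hg : PolyBounded N g) : PolyBounded N fun i => f i + g i := by
  obtain ⟨k, hk⟩ := hf
  obtain ⟨m, hm⟩ := hg
  refine ⟨max k m + 1, fun i => ?_⟩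
  have h₁ := (hk i).trans (Nat.pow_le_pow_right (by omega) (le_max_left k m))
  have h₂ := (hm i).trans (Nat.pow_le_pow_right (by omega) (le_max_right k m))
  rw [pow_succ]
  nlinarith [Nat.zero_le (N i * (N i + 2) ^ max k m)]

theorem add_iff : (PolyBounded N fun i => f i + g i) ↔ PolyBounded N f ∧ PolyBounded N g :=
  ⟨fun h => ⟨h.mono fun _ => Nat.le_add_right _ _, h.mono fun _ => Nat.le_add_left _ _⟩,
    fun h => h.1.add h.2⟩

theorem pow (hf : PolyBounded N f) (m : ℕ) : PolyBounded N fun i => f i ^ m := by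
  obtain ⟨k, hk⟩ := hf
  exact ⟨k * m, fun i => (Nat.pow_le_pow_left (hk i) m).trans (pow_mul _ _ _).ge⟩

theorem sub (hf : PolyBounded N f) : PolyBounded N fun i => f i - g i :=
  hf.mono fun _ => Nat.sub_le _ _

theorem size (hf : PolyBounded N f) : PolyBounded N fun i => (f i).size :=
  hf.mono fun i => Nat.size_le.2 (f i).lt_two_pow_self

theorem comp (hf : PolyBounded N f) (h : κ → ι) :
    PolyBounded (fun a => N (h a)) fun a => f (h a) := by
  obtain ⟨k, hk⟩ := hf
  exact ⟨k, fun a => hk (h a)⟩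

theorem fin {m : ι → ℕ} (hm : PolyBounded N m) :
    PolyBounded (fun q : Σ i, Fin (m i) => N q.1) fun q => (q.2 : ℕ) :=
  (hm.comp Sigma.fst).mono fun q => q.2.2.le

/-- Each branch has to be estimated only for the inputs that reach it, where list indices are in
range or parameters agree. -/
theorem ite_subtype {c : ι → Prop} [DecidablePred c]
    (hf : PolyBounded (fun i : {i // c i} => N i) fun i => f i)
    (hg : PolyBounded (fun i : {i // ¬ c i} => N i) fun i => g i) :
    PolyBounded N fun i => if c i then f i else g i := by
  obtain ⟨k, hk⟩ := hf
  obtain ⟨m, hm⟩ := hg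
  refine ⟨max k m, fun i => ?_⟩
  dsimp only
  split
  · next h => exact (hk ⟨i, h⟩).trans (Nat.pow_le_pow_right (by omega) (le_max_left k m))
  · next h => exact (hm ⟨i, h⟩).trans (Nat.pow_le_pow_right (by omega) (le_max_right k m))

theorem ite {c : ι → Prop} [DecidablePred c] (hf : PolyBounded N f) (hg : PolyBounded N g) :
    PolyBounded N fun i => if c i then f i else g i :=
  ite_subtype (hf.comp _) (hg.comp _)

/-- The rounds of a loop are added to the index type, which makes one exponent valid for all rounds.
-/
theorem sum {m : ι → ℕ} {h : ι → ℕ → ℕ} (hm : PolyBounded N m)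
    (hh : PolyBounded (fun q : Σ i, Fin (m i) => N q.1) fun q => h q.1 q.2) :
    PolyBounded N fun i => ∑ j ∈ Finset.range (m i), h i j := by
  obtain ⟨k, hk⟩ := hh
  obtain ⟨l, hl⟩ := hm
  refine ⟨l + k, fun i => ?_⟩
  calc ∑ j ∈ Finset.range (m i), h i j ≤ (Finset.range (m i)).card • (N i + 2) ^ k :=
        Finset.sum_le_card_nsmul _ _ _ fun j hj => hk ⟨i, j, Finset.mem_range.1 hj⟩
    _ ≤ (N i + 2) ^ l * (N i + 2) ^ k := by
        rw [Finset.card_range, smul_eq_mul]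
        exact Nat.mul_le_mul_right _ (hl i)
    _ = _ := (pow_add _ _ _).symm

end PolyBounded

namespace Prog

section Cost
variable (a b x : Data) (p q c : Prog) (k : ℕ)

@[simp] theorem cost_id : id.cost x = 1 := (rfl)
@[simp] theorem cost_const : (const k).cost x = 1 := (rfl)
@[simp] theorem cost_fst : fst.cost x = 1 := (rfl)
@[simp] theorem cost_snd : snd.cost x = 1 := (rfl)
@[simp] theorem cost_isPair : isPair.cost x = 1 := (rfl)
@[simp] theorem cost_add : add.cost (.pair a b) = 1 + a.toNat.size + b.toNat.size := (rfl)
@[simp] theorem cost_sub : sub.cost (.pair a b) = 1 + a.toNat.size + b.toNat.size := (rfl)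
@[simp] theorem cost_mul : mul.cost (.pair a b) = (1 + a.toNat.size) * (1 + b.toNat.size) := (rfl)
@[simp] theorem cost_comp : (comp p q).cost x = 1 + p.cost x + q.cost (p.eval x) := (rfl)
@[simp] theorem cost_pair : (pair p q).cost x = 1 + p.cost x + q.cost x := (rfl)
@[simp] theorem cost_cond : (cond c p q).cost x =
    1 + c.cost x + if (c.eval x).toNat = 0 then q.cost x else p.cost x := by
  rw [cost, ite_not]
@[simp] theorem cost_loop : (loop p).cost (.pair (.num k) x) =
    1 + ∑ i ∈ Finset.range k, (1 + p.cost (p.eval^[i] x)) := (rfl)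
@[simp] theorem cost_op (o : Prog) : (op o p q).cost x =
    1 + (1 + p.cost x + q.cost x) + o.cost (.pair (p.eval x) (q.eval x)) := (rfl)

end Cost

variable {ι : Type} {N : ι → ℕ}

theorem polyBounded_neP {p q : Prog} {x : ι → Data} {f g : ι → ℕ}
    (hp : ∀ i, p.eval (x i) = .num (f i))
    (hq : ∀ i, q.eval (x i) = .num (g i)) (hf : PolyBounded N f) (hg : PolyBounded N g)
    (hcp : PolyBounded N fun i => p.cost (x i)) (hcq : PolyBounded N fun i => q.cost (x i)) :
    PolyBounded N fun i => (neP p q).cost (x i) := by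
  simp only [neP, cost_op, eval_op, hp, hq, cost_sub, cost_add, eval_sub, toNat_num]
  apply_rules [PolyBounded.add, PolyBounded.mul, PolyBounded.const, PolyBounded.size,
    PolyBounded.sub]

theorem polyBounded_nthP {f : ι → ℕ} {y : ι → Data} (hf : PolyBounded N f) :
    PolyBounded N fun i => nthP.cost (.pair (.num (f i)) (y i)) := by
  simp only [nthP, cost_comp, cost_loop, cost_fst, cost_snd, Finset.sum_const, Finset.card_range,
    smul_eq_mul]
  apply_rules [PolyBounded.add, PolyBounded.mul, PolyBounded.const, PolyBounded.size,
    PolyBounded.sub]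

theorem polyBounded_tabP {p : Prog} {m : ι → ℕ} {e : ι → Data} (hm : PolyBounded N m)
    (h : PolyBounded (fun q : Σ i, Fin (m i) => N q.1)
      fun q => p.cost (.pair (.num q.2) (e q.1))) :
    PolyBounded N fun i => (tabP p).cost (.pair (.num (m i)) (e i)) := by
  obtain ⟨k, hk⟩ := h
  -- Round `q.2` computes the entry `m - (q.2 + 1)`, because the counter runs downwards.
  have h' : PolyBounded (fun q : Σ i, Fin (m i) => N q.1)
      fun q => p.cost (.pair (.num (m q.1 - (q.2 + 1))) (e q.1)) :=
    ⟨k, fun q => hk ⟨q.1, ⟨m q.1 - (q.2 + 1), by have := q.2.2; omega⟩⟩⟩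
  have hm' := hm.comp (Sigma.fst : (Σ i, Fin (m i)) → ι)
  have hs : PolyBounded (fun q : Σ i, Fin (m i) => N q.1) fun q => 1 + (tabStep p).cost
      ((tabStep p).eval^[q.2] (.pair (.pair (.num (m q.1)) (e q.1)) (.num 0))) := by
    refine .mono (g := fun q => 25 + (m q.1).size +
      p.cost (.pair (.num (m q.1 - (q.2 + 1))) (e q.1))) ?_ fun q => ?_
    · apply_rules [PolyBounded.add, PolyBounded.mul, PolyBounded.const, PolyBounded.size]
    · rw [iterate_tabStep p _ _ q.2.2.le]
      simp only [tabStep, cost_comp, cost_pair, cost_op, eval_op, eval_comp, eval_pair, eval_fst,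
        eval_snd, eval_const, eval_sub, toNat_num, Nat.sub_sub, cost_sub, cost_fst, cost_snd,
        cost_const, Nat.size_one]
      have : (m q.1 - q.2).size ≤ (m q.1).size := Nat.size_le_size (Nat.sub_le _ _)
      omega
  simp only [tabP, cost_comp, cost_pair, eval_pair, eval_fst, eval_id, eval_const,
    cost_loop, cost_fst, cost_id, cost_const, cost_snd]
  apply_rules [PolyBounded.add, PolyBounded.const, PolyBounded.sum]

theorem polyBounded_halfP {f : ι → ℕ} (hf : PolyBounded N f) :
    PolyBounded N fun i => halfP.cost (.num (f i)) := by
  have hs : PolyBounded (fun q : Σ i, Fin (f i) => N q.1) fun q => 1 + halfStep.cost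
      ((halfStep.eval)^[q.2] (.pair (.num 0) (.num 0))) := by
    have h₁ : PolyBounded (fun q : Σ i, Fin (f i) => N q.1) fun q => (q.2 : ℕ) / 2 :=
      hf.fin.mono fun q => Nat.div_le_self _ _
    have h₂ : PolyBounded (fun q : Σ i, Fin (f i) => N q.1) fun q => (q.2 : ℕ) % 2 :=
      hf.fin.mono fun q => Nat.mod_le _ _
    simp only [iterate_halfStep]
    simp only [halfStep, cost_pair, cost_op, cost_add, cost_sub, cost_const,
      cost_snd, eval_const, eval_snd, toNat_num]
    simp (maxDischargeDepth := 99) only [PolyBounded.add_iff, PolyBounded.const, PolyBounded.mul,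
    PolyBounded.size, PolyBounded.sub, PolyBounded.ite, and_self, *]
  simp only [halfP, cost_comp, cost_pair, cost_id, cost_const, cost_fst, cost_loop, eval_pair,
    eval_id, eval_const]
  apply_rules [PolyBounded.add, PolyBounded.const, PolyBounded.sum]

theorem polyBounded_hbStep {c x y : ι → ℕ} (hc : PolyBounded N c) (hx : PolyBounded N x)
    (hy : PolyBounded N y) :
    PolyBounded N fun i => hbStep.cost (.pair (.num (c i)) (.pair (.num (x i)) (.num (y i)))) := by
  have h := polyBounded_neP (N := N) (p := snd.comp fst) (q := snd.comp snd)
    (x := fun i => .pair (.num (c i)) (.pair (.num (x i)) (.num (y i)))) (f := x) (g := y)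
    (by simp) (by simp) hx hy (by simpa using .const _) (by simpa using .const _)
  have := polyBounded_halfP hx
  have := polyBounded_halfP hy
  simp only [hbStep, cost_cond, cost_pair, cost_op, cost_comp, cost_id, cost_const, cost_fst,
    cost_snd, cost_add, eval_comp, eval_fst, eval_snd, eval_const, toNat_num]
  simp (maxDischargeDepth := 99) only [PolyBounded.add_iff, PolyBounded.const, PolyBounded.mul,
    PolyBounded.size, PolyBounded.sub, PolyBounded.ite, and_self, *]

theorem polyBounded_hbP {x y : ι → ℕ} (hx : PolyBounded N x) (hy : PolyBounded N y) :
    PolyBounded N fun i => hbP.cost (.pair (.num (x i)) (.num (y i))) := by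
  have hs : PolyBounded (fun q : Σ i, Fin (x i + y i) => N q.1) fun q => 1 + hbStep.cost
      ((hbStep.eval)^[q.2] (.pair (.num 0) (.pair (.num (x q.1)) (.num (y q.1))))) := by
    choose c' x' y' hc' hx' hy' _ h using fun q : Σ i, Fin (x i + y i) =>
      iterate_hbStep q.2 0 (x q.1) (y q.1)
    simp only [h]
    refine .add (.const _) (polyBounded_hbStep ?_ ?_ ?_)
    · exact (hx.add hy).fin.mono fun q => (hc' q).trans (Nat.zero_add _).le
    · exact (hx.comp _).mono hx'
    · exact (hy.comp _).mono hy'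
  simp only [hbP, cost_comp, cost_pair, cost_id, cost_const, cost_fst, cost_loop, cost_add,
    eval_add, eval_pair, eval_id, eval_const, toNat_num]
  have := hx.add hy
  apply_rules [PolyBounded.add, PolyBounded.const, PolyBounded.size, PolyBounded.sum]

theorem polyBounded_flatP {e : ι → ℕ} {r : ι → Rec} (he : PolyBounded N e)
    (hr : PolyBounded N fun i => (r i).1) :
    PolyBounded N fun i => flatP.cost (.pair (.num (e i)) (encRec (r i))) := by
  simp only [flatP, encRec, cost_comp, cost_pair, cost_op, cost_cond, cost_id, cost_const, cost_fst,
    cost_snd, cost_loop, cost_sub, eval_comp, eval_pair, eval_op, eval_fst, eval_snd, eval_sub,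
    toNat_num, Finset.sum_const, Finset.card_range, smul_eq_mul]
  simp (maxDischargeDepth := 99) only [PolyBounded.add_iff, PolyBounded.const, PolyBounded.mul,
    PolyBounded.size, PolyBounded.sub, PolyBounded.ite, and_self, *]

theorem polyBounded_heavyP {e : ι → ℕ} {r : ι → Rec} (he : PolyBounded N e)
    (hr : PolyBounded N fun i => (r i).1) :
    PolyBounded N fun i => heavyP.cost (.pair (.num (e i)) (encRec (r i))) := by
  have := polyBounded_flatP (he.sub (g := fun _ => 1)) hr
  simp only [encRec] at this
  simp only [heavyP, encRec, cost_comp, cost_pair, cost_op, cost_cond, cost_const,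
    cost_fst, cost_snd, cost_sub, eval_comp, eval_pair, eval_op, eval_fst, eval_snd, eval_sub,
    eval_const, toNat_num]
  simp (maxDischargeDepth := 99) only [PolyBounded.add_iff, PolyBounded.const, PolyBounded.mul,
    PolyBounded.size, PolyBounded.sub, PolyBounded.ite, and_self, *]

theorem polyBounded_lightP {e : ι → ℕ} {r : ι → Rec} (he : PolyBounded N e)
    (hr : PolyBounded N fun i => (r i).1) :
    PolyBounded N fun i => lightP.cost (.pair (.num (e i)) (encRec (r i))) := by
  have := polyBounded_flatP he hr
  simp only [lightP, cost_pair, cost_const, cost_fst]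
  simp (maxDischargeDepth := 99) only [PolyBounded.add_iff, PolyBounded.const, PolyBounded.mul,
    PolyBounded.size, PolyBounded.sub, PolyBounded.ite, and_self, *]

theorem polyBounded_levelP {m k : ι → ℕ} {x y : ι → Data} (hm : PolyBounded N m)
    (hk : PolyBounded N k) : PolyBounded N fun i =>
      levelP.cost (.pair (.pair (.num (m i)) (x i)) (.pair (.num (k i)) (y i))) := by
  have h : ∀ m k : ℕ, (if m - k = 0 then Data.num k else Data.num m) = .num (max m k) := by
    intro m k
    split <;> congr 1 <;> omega
  have hmax : PolyBounded N fun i => max (m i) (k i) :=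
    (hm.add hk).mono fun i => by omega
  have := polyBounded_hbP hmax (hm.add hk)
  have : PolyBounded N fun i => hb (max (m i) (k i)) (m i + k i) :=
    (hmax.add (hm.add hk)).mono fun i => hb_le
  simp only [levelP, cost_comp, cost_op, cost_cond, cost_const, cost_fst, cost_snd, cost_sub,
    cost_add, eval_comp, eval_op, eval_cond, eval_fst, eval_snd, eval_sub, eval_add, eval_const,
    toNat_num, h, eval_hbP]
  simp (maxDischargeDepth := 99) only [PolyBounded.add_iff, PolyBounded.const, PolyBounded.mul,
    PolyBounded.size, PolyBounded.sub, PolyBounded.ite, and_self, *]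

theorem eval_nthP_recs {t : BT} {j : ℕ} (hj : j < t.cnt) :
    nthP.eval (.pair (.num j) (.ofList ((recs t).map encRec))) =
      encRec ((recs t).getD j (0, [])) := by
  rw [← length_recs] at hj
  rw [eval_nthP (by simpa using hj), List.getElem_map, List.getD_eq_getElem _ _ hj]

theorem polyBounded_tag {t : ι → BT} (ht : PolyBounded N fun q => (t q).cnt) (j : ι → ℕ) :
    PolyBounded N fun q => ((recs (t q)).getD (j q) (0, [])).1 := by
  refine ht.mono fun q => ?_
  by_cases hj : j q < (recs (t q)).length
  · rw [List.getD_eq_getElem _ _ hj]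
    exact ((balanced (t q)).le_log (List.getElem_mem hj)).trans (Nat.log_le_self _ _)
  · rw [List.getD_eq_default _ _ (by omega)]
    exact Nat.zero_le _

theorem polyBounded_heavyP_nthP {t : ι → BT} {j e : ι → ℕ} (hj : ∀ q, j q < (t q).cnt)
    (ht : PolyBounded N fun q => (t q).cnt) (he : PolyBounded N e) :
    PolyBounded N fun q => heavyP.cost (.pair (.num (e q))
      (nthP.eval (.pair (.num (j q)) (.ofList ((recs (t q)).map encRec))))) := by
  simp only [eval_nthP_recs (hj _)]
  exact polyBounded_heavyP he (polyBounded_tag ht j)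

theorem polyBounded_lightP_nthP {t : ι → BT} {j e : ι → ℕ} (hj : ∀ q, j q < (t q).cnt)
    (ht : PolyBounded N fun q => (t q).cnt) (he : PolyBounded N e) :
    PolyBounded N fun q => lightP.cost (.pair (.num (e q))
      (nthP.eval (.pair (.num (j q)) (.ofList ((recs (t q)).map encRec))))) := by
  simp only [eval_nthP_recs (hj _)]
  exact polyBounded_lightP he (polyBounded_tag ht j)

theorem polyBounded_joinEntry {a b : ι → BT} {i e : ι → ℕ}
    (hi : ∀ q, i q < (a q).cnt + (b q).cnt) (ha : PolyBounded N fun q => (a q).cnt)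
    (hb : PolyBounded N fun q => (b q).cnt) (he : PolyBounded N e) :
    PolyBounded N fun q => joinEntry.cost
      (.pair (.num (i q)) (.pair (.num (e q)) (.pair (encNode (a q)) (encNode (b q))))) := by
  have hi' : PolyBounded N i := (ha.add hb).mono fun q => (hi q).le
  simp only [joinEntry, encNode, cost_cond, cost_op, cost_comp, cost_fst, cost_snd, cost_sub,
    eval_op, eval_comp, eval_fst, eval_snd, eval_sub, toNat_num]
  refine .add ?_ (.ite_subtype ?_ ?_)
  · simp (maxDischargeDepth := 99) only [PolyBounded.add_iff, PolyBounded.const, PolyBounded.mul,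
      PolyBounded.size, PolyBounded.sub, PolyBounded.ite, and_self, *]
  · have hj : ∀ q : {q // (a q).cnt - i q = 0}, i q - (a q).cnt < (b q).cnt := fun q => by
      have := q.2
      have := hi q
      omega
    have h₁ := polyBounded_heavyP_nthP hj (hb.comp _) (he.comp _)
    have h₂ := polyBounded_lightP_nthP hj (hb.comp _) (he.comp _)
    have hi'' := hi'.comp (Subtype.val : {q // (a q).cnt - i q = 0} → ι)
    have ha' := ha.comp (Subtype.val : {q // (a q).cnt - i q = 0} → ι)
    have hb' := hb.comp (Subtype.val : {q // (a q).cnt - i q = 0} → ι)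
    have hs := (hi'.sub (g := fun q => (a q).cnt)).comp
      (Subtype.val : {q // (a q).cnt - i q = 0} → ι)
    have hn := fun y => polyBounded_nthP (y := y) hs
    simp (maxDischargeDepth := 99) only [PolyBounded.add_iff, PolyBounded.const, PolyBounded.mul,
      PolyBounded.size, PolyBounded.sub, PolyBounded.ite, and_self, *]
  · have hj : ∀ q : {q // ¬ (a q).cnt - i q = 0}, i q < (a q).cnt := fun q => by
      have := q.2
      omega
    have h₁ := polyBounded_heavyP_nthP hj (ha.comp _) (he.comp _)
    have h₂ := polyBounded_lightP_nthP hj (ha.comp _) (he.comp _)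
    have hi'' := hi'.comp (Subtype.val : {q // ¬ (a q).cnt - i q = 0} → ι)
    have ha' := ha.comp (Subtype.val : {q // ¬ (a q).cnt - i q = 0} → ι)
    have hb' := hb.comp (Subtype.val : {q // ¬ (a q).cnt - i q = 0} → ι)
    have hn := fun y => polyBounded_nthP (y := y) hi''
    simp (maxDischargeDepth := 99) only [PolyBounded.add_iff, PolyBounded.const, PolyBounded.mul,
      PolyBounded.size, PolyBounded.sub, PolyBounded.ite, and_self, *]

theorem polyBounded_joinP {a b : ι → BT} (ha : PolyBounded N fun q => (a q).cnt)
    (hb' : PolyBounded N fun q => (b q).cnt) :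
    PolyBounded N fun q => joinP.cost (.pair (encNode (a q)) (encNode (b q))) := by
  have hab := ha.add hb'
  have he : PolyBounded N fun q => joinLevel (a q).cnt (b q).cnt :=
    (hab.add hab).mono fun q => by
      have : hb (max (a q).cnt (b q).cnt) ((a q).cnt + (b q).cnt) ≤ _ := hb_le
      rw [joinLevel]
      omega
  have h₁ := polyBounded_levelP (x := fun q => .ofList ((recs (a q)).map encRec))
    (y := fun q => .ofList ((recs (b q)).map encRec)) ha hb'
  have h₃ : PolyBounded (fun q : Σ q, Fin ((a q).cnt + (b q).cnt) => N q.1) fun q =>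
      joinEntry.cost (.pair (.num q.2) (.pair (.num (joinLevel (a q.1).cnt (b q.1).cnt))
        (.pair (encNode (a q.1)) (encNode (b q.1))))) :=
    polyBounded_joinEntry (fun q => q.2.2) (ha.comp _) (hb'.comp _) (he.comp _)
  have h₂ := polyBounded_tabP (p := joinEntry) (e := fun q =>
      .pair (.num (joinLevel (a q).cnt (b q).cnt)) (.pair (encNode (a q)) (encNode (b q)))) hab h₃
  simp only [encNode] at h₂
  simp only [joinP, encNode, cost_pair, cost_op, cost_comp, cost_id, cost_fst, cost_snd, cost_add,
    eval_op, eval_comp, eval_pair, eval_fst, eval_snd, eval_add, eval_id, eval_levelP, toNat_num]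
  simp (maxDischargeDepth := 99) only [PolyBounded.add_iff, PolyBounded.const, PolyBounded.mul,
    PolyBounded.size, PolyBounded.sub, PolyBounded.ite, and_self, *]

/-- The number of nodes of a datum. -/
def nodes : Data → ℕ
  | .num _ => 1
  | .pair a b => 1 + nodes a + nodes b

theorem cnt_toBT_le (x : Data) : (toBT x).cnt ≤ nodes x := by
  induction x with
  | num k => simp [toBT, BT.cnt]
  | pair a b iha ihb =>
    rw [toBT, nodes]
    split
    · rw [BT.cnt]; omega
    · rw [BT.cnt]; omega

mutual
-- A node accounts for its pair, its kind, the end of its list of children and the list cell that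
-- holds it; the root has no such cell.
theorem nodes_encodeShape : ∀ T : RTree Kind, nodes (encodeShape T) + 1 = 4 * T.size
  | .node k Ts => by
    have := nodes_encodeShapes Ts
    have hk : nodes k.encode = 1 := by cases k <;> rfl
    rw [encodeShape, nodes, RTree.size, hk]
    omega
theorem nodes_encodeShapes : ∀ Ts : List (RTree Kind),
    nodes (encodeShapes Ts) = 1 + 4 * RTree.sizeList Ts
  | [] => rfl
  | T :: Ts => by
    have := nodes_encodeShape T
    have := nodes_encodeShapes Ts
    rw [encodeShapes, nodes, RTree.sizeList]
    omega
end

theorem polyBounded_recsStep :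
    PolyBounded (fun q : Data × Data × Data => nodes q.2.1 + nodes q.2.2) fun q =>
      recsStep.cost (.pair q.1 (.pair (.pair q.2.1 q.2.2)
        (.pair (encNode (toBT q.2.1)) (encNode (toBT q.2.2))))) := by
  have h := polyBounded_joinP (N := fun q : Data × Data × Data => nodes q.2.1 + nodes q.2.2)
    (a := fun q => toBT q.2.1) (b := fun q => toBT q.2.2)
    (.mono .self fun q => (cnt_toBT_le _).trans (Nat.le_add_right _ _))
    (.mono .self fun q => (cnt_toBT_le _).trans (Nat.le_add_left _ _))
  simp only [recsStep, cost_cond, cost_comp, cost_pair, cost_const, cost_fst, cost_snd,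
    cost_isPair, eval_comp, eval_fst, eval_snd]
  simp (maxDischargeDepth := 99) only [PolyBounded.add_iff, PolyBounded.const, PolyBounded.mul,
    PolyBounded.size, PolyBounded.sub, PolyBounded.ite, and_self, *]

/-- Every node of the datum is charged for one recursion step, and the size of the whole datum
bounds the cost of each step. -/
theorem polyBounded_recsP : PolyBounded nodes recsP.cost := by
  obtain ⟨k, hk⟩ := polyBounded_recsStep
  have h : ∀ (e x : Data) (M : ℕ), nodes x ≤ M →
      Data.foldCost (pair (const 0) (const 0)).eval recsStep.eval (pair (const 0) (const 0)).cost
        recsStep.cost e x ≤ nodes x * (4 + (M + 2) ^ k) := by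
    intro e x M
    induction x with
    | num m =>
      intro _
      simp only [Data.foldCost, cost_pair, cost_const, nodes]
      omega
    | pair a b iha ihb =>
      intro hM
      rw [nodes] at hM
      rw [Data.foldCost, fold_recs, fold_recs, nodes]
      have h₁ := hk (e, a, b)
      have h₂ : (nodes a + nodes b + 2) ^ k ≤ (M + 2) ^ k := Nat.pow_le_pow_left (by omega) k
      have h₃ := iha (by omega)
      have h₄ := ihb (by omega)
      dsimp only at h₁
      simp only [add_mul, one_mul]
      omega
  have h' : PolyBounded nodes fun x => nodes x * (4 + (nodes x + 2) ^ k) :=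
    PolyBounded.self.mul (.add (.const 4) (.pow (.add .self (.const 2)) k))
  refine ((PolyBounded.const 6).add h').mono fun x => ?_
  have := h (.num 0) x _ le_rfl
  rw [recsP, cost_comp, eval_pair, eval_id, eval_const, cost_pair, cost_id, cost_const, cost]
  change 1 + (1 + 1 + 1) + (1 + Data.foldCost _ _ _ _ (.num 0) x) ≤ _
  omega

end Prog

-- Costs of arithmetic with large numbers, and the cost of the main program.

namespace PolyBounded

variable {ι : Type} {N f g : ι → ℕ}

/-- From here on only the binary lengths of values are bounded, not the values themselves. -/
theorem size_pow (hf : PolyBounded N fun i => (f i).size) (hg : PolyBounded N g) :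
    PolyBounded N fun i => (f i ^ g i).size :=
  ((hf.mul hg).add (.const 1)).mono fun i => Nat.size_le.2 <| by
    rw [pow_succ, pow_mul]
    have := Nat.pow_le_pow_left (Nat.lt_size_self (f i)).le (g i)
    have : 0 < (2 ^ (f i).size) ^ g i := by positivity
    omega

end PolyBounded

/-- One letter takes `1 + v` to at most `(1 + v) ^ (W + 1)`, so the exponents multiply along the
code. -/
theorem codeVal_lt {W : ℕ} (hW : 1 ≤ W) (v : ℕ) (u : List Bool) :
    codeVal W v u < (1 + v) ^ (W + 1) ^ u.length := by
  induction u generalizing v with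
  | nil => simp [codeVal]
  | cons b u ih =>
    have h : 1 + v ^ W * (if b then 1 + v else 1) ≤ (1 + v) ^ (W + 1) := by
      have h₁ : v ^ W + 1 ≤ (1 + v) ^ W := by
        have := pow_add_pow_le (Nat.zero_le v) (Nat.zero_le 1) (by omega : W ≠ 0)
        simpa [add_comm] using this
      have h₂ : v ^ W * (if b then 1 + v else 1) ≤ v ^ W * (1 + v) :=
        Nat.mul_le_mul_left _ (by split <;> omega)
      rw [pow_succ]
      nlinarith
    refine (ih _).trans_le ?_
    rw [List.length_cons, pow_succ', pow_mul]
    exact Nat.pow_le_pow_left h _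

namespace Prog

variable {ι : Type} {N : ι → ℕ}

theorem polyBounded_powP {v m : ι → ℕ} (hv : PolyBounded N fun i => (v i).size)
    (hm : PolyBounded N m) :
    PolyBounded N fun i => powP.cost (.pair (.num (v i)) (.num (m i))) := by
  have hs : PolyBounded (fun q : Σ i, Fin (m i) => N q.1) fun q => 1 + powStep.cost
      ((powStep.eval)^[q.2] (.pair (.num (v q.1)) (.num 1))) := by
    have h := (hv.comp (Sigma.fst : (Σ i, Fin (m i)) → ι))
    have h₁ := PolyBounded.size_pow h hm.fin
    simp only [iterate_powStep]
    simp only [powStep, cost_pair, cost_fst, cost_mul, toNat_num]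
    simp (maxDischargeDepth := 99) only [PolyBounded.add_iff, PolyBounded.const, PolyBounded.mul,
      PolyBounded.size, and_self, *]
  have := PolyBounded.sum (h := fun i j => 1 + powStep.cost
      ((powStep.eval)^[j] (.pair (.num (v i)) (.num 1)))) hm hs
  simp only [powP, cost_comp, cost_pair, cost_const, cost_fst, cost_snd, cost_loop, eval_pair,
    eval_fst, eval_snd, eval_const]
  simp (maxDischargeDepth := 99) only [PolyBounded.add_iff, PolyBounded.const, and_self, *]

theorem polyBounded_valStep {W v : ι → ℕ} {u : ι → List Bool}
    (hv : PolyBounded N fun i => (v i).size) (hW : PolyBounded N W) : PolyBounded N fun i =>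
      valStep.cost (.pair (.num (W i)) (.pair (encBits (u i)) (.num (v i)))) := by
  have h₁ := polyBounded_powP hv hW
  have h₂ := PolyBounded.size_pow hv hW
  have h₃ : PolyBounded N fun i => (1 + v i).size :=
    (hv.add (.const 1)).mono fun i => Nat.size_le.2 <| by
      have := Nat.lt_size_self (v i)
      rw [pow_succ]
      omega
  refine .mono (g := fun i => 100 + powP.cost (.pair (.num (v i)) (.num (W i))) +
    2 * (1 + (v i).size) + (v i).size + (1 + (v i ^ W i).size) * (1 + (1 + v i).size))
    ?_ fun i => ?_
  · simp (maxDischargeDepth := 99) only [PolyBounded.add_iff, PolyBounded.const, PolyBounded.mul,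
      PolyBounded.size, and_self, *]
  · have h : Nat.size 1 ≤ (1 + v i).size := Nat.size_le_size (Nat.le_add_right _ _)
    have h' := Nat.mul_le_mul_left (1 + (v i ^ W i).size) (Nat.add_le_add_left h 1)
    obtain _ | ⟨_ | _, l⟩ := u i
    all_goals
      simp only [valStep, encBits, List.map_nil, List.map_cons, Data.ofList, cost_cond, cost_comp,
        cost_op, cost_pair, cost_id, cost_const, cost_fst, cost_snd, cost_isPair, cost_add,
        cost_mul, eval_comp, eval_op, eval_pair, eval_fst, eval_snd, eval_isPair_num, eval_isPair_pair,
        eval_const, eval_powP, eval_mul, eval_add, toNat_num, if_true, one_ne_zero, if_false,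
        Bool.toNat_false, Bool.toNat_true, Nat.size_zero, Nat.size_one, zero_mul, one_mul,
        add_zero] at h h' ⊢
      omega

theorem polyBounded_size_codeVal {L W v : ι → ℕ} {u : ι → List Bool} (hW : ∀ i, 1 ≤ W i)
    (hL : PolyBounded N fun i => (W i + 1) ^ L i) (hv : PolyBounded N v)
    (hu : ∀ i, (u i).length ≤ L i) : PolyBounded N fun i => (codeVal (W i) (v i) (u i)).size :=
  (PolyBounded.size_pow ((PolyBounded.const 1).add hv).size hL).mono fun i =>
    Nat.size_le_size ((codeVal_lt (hW i) _ _).le.trans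
      (Nat.pow_le_pow_right (by omega) (Nat.pow_le_pow_right (by omega) (hu i))))

theorem polyBounded_valP {L W v : ι → ℕ} {u : ι → List Bool} (hW : ∀ i, 1 ≤ W i)
    (hL : PolyBounded N fun i => (W i + 1) ^ L i) (hv : PolyBounded N v) (hW' : PolyBounded N W) :
    PolyBounded N fun i => valP.cost
      (.pair (.num (L i)) (.pair (.num (W i)) (.pair (encBits (u i)) (.num (v i))))) := by
  have hL' : PolyBounded N L := hL.mono fun i => (Nat.lt_pow_self (by have := hW i; omega)).le
  have hs : PolyBounded (fun q : Σ i, Fin (L i) => N q.1) fun q => 1 + valStep.cost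
      ((valStep.eval)^[q.2] (.pair (.num (W q.1)) (.pair (encBits (u q.1)) (.num (v q.1))))) := by
    -- The intermediate values belong to prefixes of the code, so the bound for full codes applies
    -- to them.
    simp only [iterate_valStep]
    refine .add (.const 1) (polyBounded_valStep ?_ (hW'.comp _))
    exact polyBounded_size_codeVal (fun q => hW q.1) (hL.comp _) (hv.comp _) fun q =>
      (List.length_take_le _ _).trans q.2.2.le
  have := PolyBounded.sum (h := fun i j => 1 + valStep.cost
      ((valStep.eval)^[j] (.pair (.num (W i)) (.pair (encBits (u i)) (.num (v i)))))) hL' hs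
  simp only [valP, cost_comp, cost_snd, cost_loop]
  simp (maxDischargeDepth := 99) only [PolyBounded.add_iff, PolyBounded.const, and_self, *]

/-- Polynomial bounds for the numbers on which the entries of the matrices depend. -/
structure EnvBounded (N w : ι → ℕ) (t : ι → BT) : Prop where
  cnt : PolyBounded N fun i => (t i).cnt
  pos : ∀ i, 1 ≤ w i
  width : PolyBounded N w
  pow : PolyBounded N fun i => (w i * w i + 1) ^ (5 * Nat.log 2 (t i).cnt)

theorem EnvBounded.comp {κ : Type} {w : ι → ℕ} {t : ι → BT} (h : EnvBounded N w t) (f : κ → ι) :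
    EnvBounded (fun a => N (f a)) (fun a => w (f a)) fun a => t (f a) :=
  ⟨h.cnt.comp f, fun _ => h.pos _, h.width.comp f, h.pow.comp f⟩

theorem polyBounded_powEntryP {w v k i : ι → ℕ} {t : ι → BT} (h : EnvBounded N w t)
    (hv : PolyBounded N v) (hk : PolyBounded N k) (hi : ∀ q, i q < (t q).cnt) (n j : ι → ℕ)
    (x : ι → Data) : PolyBounded N fun q => powEntryP.cost (.pair (.num (j q)) (.pair (.num (i q))
      (.pair (.num (k q)) (.pair (.num (v q))
        (encEnv (n q) (t q).cnt (w q) (x q) (t q)))))) := by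
  have hi' : PolyBounded N i := h.cnt.mono fun q => (hi q).le
  have hW : ∀ q, 1 ≤ w q * w q := fun q => Nat.mul_le_mul (h.pos q) (h.pos q)
  have hlog : PolyBounded N fun q => Nat.log 2 (t q).cnt := h.cnt.mono fun q => Nat.log_le_self _ _
  have h₁ := polyBounded_flatP hlog (polyBounded_tag h.cnt i)
  have h₂ := polyBounded_nthP (y := fun q => .ofList ((recs (t q)).map encRec)) hi'
  have h₃ := polyBounded_valP (u := fun q => leafCode (t q) (i q)) hW h.pow hv
    (h.width.mul h.width)
  have h₄ := polyBounded_powP (polyBounded_size_codeVal hW h.pow hv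
    fun q => length_leafCode_le (t q) (hi q)) hk
  simp only [powEntryP, encEnv, encNode, cost_op, cost_comp, cost_pair, cost_fst, cost_snd,
    eval_op, eval_comp, eval_pair, eval_fst, eval_snd, eval_nthP_leafCode (hi _),
    eval_valP (length_leafCode_le _ (hi _))]
  simp only [eval_nthP_recs (hi _)]
  simp (maxDischargeDepth := 99) only [PolyBounded.add_iff, PolyBounded.const, and_self, *]

theorem polyBounded_entryP {w v k i j : ι → ℕ} {t : ι → BT} (h : EnvBounded N w t)
    (hv : PolyBounded N v) (hk : PolyBounded N k) (hi : PolyBounded N i)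
    (hj : ∀ q, j q < (t q).cnt + 1) (n : ι → ℕ) (x : ι → Data) :
    PolyBounded N fun q => entryP.cost (.pair (.num (j q)) (.pair (.num (i q))
      (.pair (.num (k q)) (.pair (.num (v q))
        (encEnv (n q) (t q).cnt (w q) (x q) (t q)))))) := by
  have hj' : PolyBounded N j := h.cnt.mono fun q => Nat.le_of_lt_succ (hj q)
  have h₁ := polyBounded_neP (N := N) (p := fst) (q := op add (snd.comp fst) (const 1))
    (x := fun q => .pair (.num (j q)) (.pair (.num (i q)) (.pair (.num (k q)) (.pair (.num (v q))
        (encEnv (n q) (t q).cnt (w q) (x q) (t q))))))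
    (f := j) (g := fun q => i q + 1) (by simp) (by simp) hj' (hi.add (.const 1))
    (by simpa using .const _) (by
      simp only [cost_op, cost_comp, cost_fst, cost_snd, cost_const, cost_add, eval_comp, eval_fst,
        eval_snd, eval_const, toNat_num]
      simp (maxDischargeDepth := 99) only [PolyBounded.add_iff, PolyBounded.const,
        PolyBounded.size, and_self, *])
  have he : ∀ q, (neP fst (op add (snd.comp fst) (const 1))).eval
      (.pair (.num (j q)) (.pair (.num (i q)) (.pair (.num (k q)) (.pair (.num (v q))
        (encEnv (n q) (t q).cnt (w q) (x q) (t q)))))) =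
      .num (j q - (i q + 1) + (i q + 1 - j q)) := fun q => eval_neP (by simp) (by simp)
  simp only [entryP, cost_cond, cost_const, he, toNat_num]
  refine .add (.add (.const _) h₁) (.ite_subtype ?_ (.const 1))
  exact polyBounded_powEntryP (h.comp _) (hv.comp _) (hk.comp _)
    (fun q => by have := q.2; have := hj q; omega) _ _ _

theorem polyBounded_rowP {w v k i : ι → ℕ} {t : ι → BT} (h : EnvBounded N w t)
    (hv : PolyBounded N v) (hk : PolyBounded N k) (hi : PolyBounded N i) (n : ι → ℕ)
    (x : ι → Data) : PolyBounded N fun q => rowP.cost (.pair (.num (i q)) (.pair (.num (k q))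
      (.pair (.num (v q)) (encEnv (n q) (t q).cnt (w q) (x q) (t q))))) := by
  have hm := h.cnt.add (.const 1)
  have hs : PolyBounded (fun q : Σ q, Fin ((t q).cnt + 1) => N q.1) fun q =>
      entryP.cost (.pair (.num q.2) (.pair (.num (i q.1)) (.pair (.num (k q.1))
        (.pair (.num (v q.1)) (encEnv (n q.1) (t q.1).cnt (w q.1) (x q.1) (t q.1)))))) :=
    polyBounded_entryP (h.comp _) (hv.comp _) (hk.comp _) (hi.comp _) (fun q => q.2.2) _ _
  have h₁ := polyBounded_tabP (p := entryP) (e := fun q => .pair (.num (i q)) (.pair (.num (k q))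
      (.pair (.num (v q)) (encEnv (n q) (t q).cnt (w q) (x q) (t q))))) hm hs
  have hc := h.cnt
  simp only [encEnv] at h₁
  simp only [rowP, encEnv, cost_op, cost_comp, cost_pair, cost_id, cost_const, cost_fst, cost_snd,
    cost_add, eval_op, eval_comp, eval_pair, eval_fst, eval_snd, eval_id, eval_const, eval_add,
    toNat_num]
  simp (maxDischargeDepth := 99) only [PolyBounded.add_iff, PolyBounded.const, PolyBounded.size,
    and_self, *]

theorem polyBounded_matrixP {w v k : ι → ℕ} {t : ι → BT} (h : EnvBounded N w t)
    (hv : PolyBounded N v) (hk : PolyBounded N k) (n : ι → ℕ) (x : ι → Data) :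
    PolyBounded N fun q => matrixP.cost (.pair (.num (k q)) (.pair (.num (v q))
      (encEnv (n q) (t q).cnt (w q) (x q) (t q)))) := by
  have hm := h.cnt.add (.const 1)
  have hs : PolyBounded (fun q : Σ q, Fin ((t q).cnt + 1) => N q.1) fun q =>
      rowP.cost (.pair (.num q.2) (.pair (.num (k q.1)) (.pair (.num (v q.1))
        (encEnv (n q.1) (t q.1).cnt (w q.1) (x q.1) (t q.1))))) :=
    polyBounded_rowP (h.comp _) (hv.comp _) (hk.comp _) hm.fin _ _
  have h₁ := polyBounded_tabP (p := rowP) (e := fun q => .pair (.num (k q)) (.pair (.num (v q))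
      (encEnv (n q) (t q).cnt (w q) (x q) (t q)))) hm hs
  have hc := h.cnt
  simp only [encEnv] at h₁
  simp only [matrixP, encEnv, cost_op, cost_comp, cost_pair, cost_id, cost_const, cost_fst,
    cost_snd, cost_add, eval_op, eval_comp, eval_pair, eval_fst, eval_snd, eval_id, eval_const,
    eval_add, toNat_num]
  simp (maxDischargeDepth := 99) only [PolyBounded.add_iff, PolyBounded.const, PolyBounded.size,
    and_self, *]

theorem polyBounded_pointP {w v n : ι → ℕ} {t : ι → BT} (h : EnvBounded N w t)
    (hv : PolyBounded N v) (hn : PolyBounded N n) (x : ι → Data) :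
    PolyBounded N fun q => pointP.cost (.pair (.num (v q))
      (encEnv (n q) (t q).cnt (w q) (x q) (t q))) := by
  have hs : PolyBounded (fun q : Σ q, Fin (n q) => N q.1) fun q =>
      matrixP.cost (.pair (.num q.2) (.pair (.num (v q.1))
        (encEnv (n q.1) (t q.1).cnt (w q.1) (x q.1) (t q.1)))) :=
    polyBounded_matrixP (h.comp _) (hv.comp _) hn.fin _ _
  have h₁ := polyBounded_tabP (p := matrixP) (e := fun q => .pair (.num (v q))
      (encEnv (n q) (t q).cnt (w q) (x q) (t q))) hn hs
  simp only [encEnv] at h₁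
  simp only [pointP, encEnv, cost_op, cost_comp, cost_pair, cost_id, cost_fst, cost_snd, eval_comp,
    eval_pair, eval_fst, eval_snd, eval_id]
  simp (maxDischargeDepth := 99) only [PolyBounded.add_iff, PolyBounded.const, and_self, *]

theorem polyBounded_tab_pointP {w n : ι → ℕ} {t : ι → BT} (h : EnvBounded N w t)
    (hn : PolyBounded N n) (x : ι → Data) :
    PolyBounded N fun q => (tabP pointP).cost (.pair (.num (numPoints (n q) (t q).cnt (w q)))
      (encEnv (n q) (t q).cnt (w q) (x q) (t q))) := by
  have hm : PolyBounded N fun q => numPoints (n q) (t q).cnt (w q) :=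
    ((hn.mul h.cnt).mul h.pow).add (.const 1)
  exact polyBounded_tabP hm (polyBounded_pointP (h.comp _) hm.fin (hn.comp _) _)

theorem polyBounded_paramP {n d w : ι → ℕ} (hd : PolyBounded N d) (hw : PolyBounded N w)
    (x y : ι → Data) : PolyBounded N fun q => paramP.cost
      (.pair (.pair (.num (n q)) (.pair (.num (d q)) (.pair (x q) (.num (w q))))) (y q)) := by
  have h₁ := polyBounded_hbP (.const 0) hd
  have h₂ : PolyBounded N fun q => hb 0 (d q) := hd.mono fun q => hb_le.trans (Nat.zero_add _).le
  simp only [paramP, cost_op, cost_comp, cost_pair, cost_id, cost_const, cost_fst, cost_snd,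
    cost_sub, cost_mul, eval_op, eval_comp, eval_pair, eval_fst, eval_snd, eval_const, eval_sub,
    eval_hbP, toNat_num]
  simp (maxDischargeDepth := 99) only [PolyBounded.add_iff, PolyBounded.const, PolyBounded.mul,
    PolyBounded.size, PolyBounded.sub, and_self, *]

theorem polyBounded_countP {n d w : ι → ℕ} (hn : PolyBounded N n) (hd : PolyBounded N d)
    (hw : PolyBounded N w) (hp : PolyBounded N fun q => (w q * w q + 1) ^ (5 * Nat.log 2 (d q)))
    (x : ι → Data) (t : ι → BT) :
    PolyBounded N fun q => countP.cost (encEnv (n q) (d q) (w q) (x q) (t q)) := by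
  have hl : PolyBounded N fun q => Nat.log 2 (d q) := hd.mono fun q => Nat.log_le_self _ _
  have h₁ := polyBounded_powP ((hw.mul hw).add (.const 1)).size ((PolyBounded.const 5).mul hl)
  simp only [countP, encEnv, cost_op, cost_comp, cost_const, cost_fst, cost_snd, cost_add,
    cost_mul, eval_op, eval_comp, eval_fst, eval_snd, eval_const, eval_add, eval_mul, eval_powP,
    toNat_num]
  simp (maxDischargeDepth := 99) only [PolyBounded.add_iff, PolyBounded.const, PolyBounded.mul,
    PolyBounded.size, and_self, *]

theorem polyBounded_mainP {n d w : ι → ℕ} {T : ι → RTree Kind} (hn : PolyBounded N n)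
    (hd : PolyBounded N d) (hw : PolyBounded N w) (hT : PolyBounded N fun q => (T q).size)
    (hp : PolyBounded N fun q => (w q * w q + 1) ^ (5 * Nat.log 2 (d q)))
    (hd' : ∀ q, d q ≠ 0) (hw' : ∀ q, 1 ≤ w q) :
    PolyBounded N fun q => mainP.cost (encodeInput (n q) (d q) (T q) (w q)) := by
  have hc : PolyBounded N fun q => (shapeBT (T q)).cnt :=
    ((PolyBounded.const 4).mul hT).mono fun q => by
      have := nodes_encodeShape (T q)
      have := cnt_toBT_le (encodeShape (T q))
      rw [toBT_encodeShape] at this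
      omega
  have h₁ : PolyBounded N fun q => recsP.cost (encodeShape (T q)) := by
    obtain ⟨k, hk⟩ := polyBounded_recsP
    refine ((((PolyBounded.const 4).mul hT).add (.const 2)).pow k).mono fun q => (hk _).trans ?_
    exact Nat.pow_le_pow_left (by have := nodes_encodeShape (T q); omega) k
  have h₂ := polyBounded_neP (N := N) (p := snd.comp fst) (q := fst.comp (snd.comp fst))
    (x := fun q => .pair (.pair (.num (n q)) (.pair (.num (d q))
      (.pair (encodeShape (T q)) (.num (w q))))) (encNode (shapeBT (T q))))
    (f := fun q => (shapeBT (T q)).cnt) (g := d) (by simp [encNode]) (by simp) hc hd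
    (by simpa using .const _) (by simpa using .const _)
  have h₃ := polyBounded_paramP (n := n) hd hw (fun q => encodeShape (T q))
    fun q => encNode (shapeBT (T q))
  have h₄ := polyBounded_countP hn hd hw hp (fun q => encodeShape (T q)) fun q => shapeBT (T q)
  -- The tabulation runs only if the number of variable leaves is `d`, and its estimate relies on
  -- that equality.
  have h₅ : PolyBounded (fun q : {q // (shapeBT (T q)).cnt - d q + (d q - (shapeBT (T q)).cnt) = 0}
      => N q) fun q => (tabP pointP).cost (.pair (.num (numPoints (n q) (d q) (w q)))
        (encEnv (n q) (d q) (w q) (encodeShape (T q)) (shapeBT (T q)))) := by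
    have h : ∀ q : {q // (shapeBT (T q)).cnt - d q + (d q - (shapeBT (T q)).cnt) = 0},
        (shapeBT (T q)).cnt = d q := fun q => by have := q.2; omega
    have := polyBounded_tab_pointP
      (ι := {q // (shapeBT (T q)).cnt - d q + (d q - (shapeBT (T q)).cnt) = 0})
      (t := fun q => shapeBT (T q)) (w := fun q => w q)
      ⟨hc.comp _, fun q => hw' q, hw.comp _, by simpa only [h] using hp.comp _⟩ (hn.comp _)
      fun q => encodeShape (T q)
    simpa only [h] using this
  have he : ∀ q, (neP (snd.comp fst) (fst.comp (snd.comp fst))).eval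
      (.pair (.pair (.num (n q)) (.pair (.num (d q)) (.pair (encodeShape (T q)) (.num (w q)))))
        (encNode (shapeBT (T q)))) =
      .num ((shapeBT (T q)).cnt - d q + (d q - (shapeBT (T q)).cnt)) := fun q =>
    eval_neP (by simp [encNode]) (by simp)
  simp only [mainP, encodeInput, cost_comp, cost_pair, cost_cond, cost_id, cost_const, cost_fst,
    cost_snd, eval_comp, eval_pair, eval_fst, eval_snd, eval_id, eval_recsP, toBT_encodeShape, he,
    eval_paramP _ _ _ (hd' _), eval_countP, toNat_num]
  refine .add (.add ?_ ?_) (.add (.add ?_ ?_) (.ite_subtype ?_ ?_))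
  rotate_left 4
  · exact .add (.add (.const _) (h₃.comp _))
      (.add (.add (.const _) (.add (.add (.const _) (h₄.comp _)) (.const _))) h₅)
  all_goals
    simp (maxDischargeDepth := 99) only [PolyBounded.add_iff, PolyBounded.const, and_self, *]

/-- From `w * w + 1 ≤ 2 * w ^ 2` comes an extra power of `2 ^ log d`, which is at most `d` and so
goes into the polynomial factor. -/
theorem pow_log_le {d w : ℕ} (hd : 1 ≤ d) (hw : 1 ≤ w) :
    (w * w + 1) ^ (5 * Nat.log 2 d) ≤ d ^ 5 * w ^ (10 * Nat.log 2 d) := by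
  have h₁ : w * w + 1 ≤ 2 * w ^ 2 := by nlinarith
  calc (w * w + 1) ^ (5 * Nat.log 2 d) ≤ (2 * w ^ 2) ^ (5 * Nat.log 2 d) :=
        Nat.pow_le_pow_left h₁ _
    _ = (2 ^ Nat.log 2 d) ^ 5 * w ^ (10 * Nat.log 2 d) := by
        rw [mul_pow, ← pow_mul, ← pow_mul]
        congr 2 <;> omega
    _ ≤ _ := Nat.mul_le_mul_right _ (Nat.pow_le_pow_left (Nat.pow_log_le_self 2 (by omega)) 5)

theorem exists_cost_mainP_le : ∃ k, ∀ (n d w : ℕ) (T : RTree Kind), 1 ≤ n → 1 ≤ d → 1 ≤ w →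
    mainP.cost (encodeInput n d T w) ≤
      3 ^ k * (n * d * w * T.size) ^ k * w ^ (k * Nat.log 2 d) := by
  let ι := {q : ℕ × ℕ × ℕ × RTree Kind // 1 ≤ q.1 ∧ 1 ≤ q.2.1 ∧ 1 ≤ q.2.2.1}
  let n : ι → ℕ := fun q => q.1.1
  let d : ι → ℕ := fun q => q.1.2.1
  let w : ι → ℕ := fun q => q.1.2.2.1
  let T : ι → RTree Kind := fun q => q.1.2.2.2
  -- One size that each parameter and `w ^ log d` divide; since all factors are positive, it bounds
  -- every one of them.
  let N : ι → ℕ := fun q => n q * d q * w q * (T q).size * w q ^ Nat.log 2 (d q)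
  have hn (q) : 1 ≤ n q := q.2.1
  have hd (q) : 1 ≤ d q := q.2.2.1
  have hw (q) : 1 ≤ w q := q.2.2.2
  have hT (t : RTree Kind) : 1 ≤ t.size := by
    cases t
    rw [RTree.size]
    omega
  have hp (q) : 1 ≤ w q ^ Nat.log 2 (d q) := Nat.one_le_pow _ _ (hw q)
  have hdvd (q) (x : ℕ) (h : x ∣ N q) : x ≤ N q := by
    refine Nat.le_of_dvd ?_ h
    have := hn q; have := hd q; have := hw q; have := hT (T q); have := hp q
    positivity
  have hN : PolyBounded N N := .self
  have hdN : PolyBounded N d := hN.mono fun q =>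
    hdvd q _ ⟨n q * w q * (T q).size * w q ^ Nat.log 2 (d q), by ring⟩
  have hpN : PolyBounded N fun q => w q ^ Nat.log 2 (d q) := hN.mono fun q =>
    hdvd q _ (Dvd.intro_left _ rfl)
  obtain ⟨k, hk⟩ := polyBounded_mainP (N := N) (n := n) (d := d) (w := w) (T := T)
    (hN.mono fun q => hdvd q _ ⟨d q * w q * (T q).size * w q ^ Nat.log 2 (d q), by ring⟩)
    hdN
    (hN.mono fun q => hdvd q _ ⟨n q * d q * (T q).size * w q ^ Nat.log 2 (d q), by ring⟩)
    (hN.mono fun q => hdvd q _ ⟨n q * d q * w q * w q ^ Nat.log 2 (d q), by ring⟩)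
    (((hdN.pow 5).mul (hpN.pow 10)).mono fun q => (pow_log_le (hd q) (hw q)).trans
      (by rw [mul_comm 10, pow_mul]))
    (fun q => (Nat.pos_iff_ne_zero.1 (hd q))) hw
  refine ⟨k, fun n' d' w' T' hn' hd' hw' => (hk ⟨(n', d', w', T'), hn', hd', hw'⟩).trans ?_⟩
  have h1 : 1 ≤ n' * d' * w' * T'.size * w' ^ Nat.log 2 d' := by
    have := hT T'
    have : 0 < n' * d' * w' * T'.size * w' ^ Nat.log 2 d' := by positivity
    exact this
  rw [mul_comm k, pow_mul, ← mul_pow, ← mul_pow]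
  refine Nat.pow_le_pow_left ?_ k
  change n' * d' * w' * T'.size * w' ^ Nat.log 2 d' + 2 ≤ _
  rw [mul_assoc 3]
  omega

theorem numPoints_le {n d w : ℕ} (hn : 1 ≤ n) (hd : 1 ≤ d) (hw : 1 ≤ w) :
    numPoints n d w ≤ 2 * (n * d) ^ 6 * w ^ (10 * Nat.log 2 d) := by
  have h₁ := Nat.mul_le_mul_left (n * d) (pow_log_le hd hw)
  have h₂ : n * d * (d ^ 5 * w ^ (10 * Nat.log 2 d)) ≤ (n * d) ^ 6 * w ^ (10 * Nat.log 2 d) := by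
    rw [← mul_assoc, pow_succ' _ 5]
    refine Nat.mul_le_mul_right _ (Nat.mul_le_mul_left _ (Nat.pow_le_pow_left ?_ 5))
    exact Nat.le_mul_of_pos_left _ hn
  have h₃ : 0 < (n * d) ^ 6 * w ^ (10 * Nat.log 2 d) := by positivity
  rw [numPoints, mul_assoc 2]
  omega

end Prog
end UPT

/-- One program `P` and constants `a, b, c` serve all parameters and all fields. The number of points
is `w ^ O(log d) * poly(n d)`, so is the threshold for the characteristic, and the running time is
`w ^ O(log d)` times a polynomial in `n`, `d`, `w` and the number of nodes of `T`. -/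
theorem mainTheorem3 :
    ∃ (P : UPT.Prog) (a b c : ℕ), ∀ (n d w : ℕ) (T : UPT.RTree UPT.Kind),
      1 ≤ n → 1 ≤ d → 1 ≤ w →
      ∃ H : List (Fin n → Matrix (Fin (d + 1)) (Fin (d + 1)) ℕ),
        P.eval (UPT.encodeInput n d T w) = UPT.encodePoints H ∧
        P.cost (UPT.encodeInput n d T w) ≤
          a * (n * d * w * T.size) ^ b * w ^ (c * Nat.log 2 d) ∧
        H.length ≤ a * (n * d) ^ b * w ^ (c * Nat.log 2 d) ∧
        ∀ (F : Type*) [Field F],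
          (ringChar F = 0 ∨ a * (n * d) ^ b * w ^ (c * Nat.log 2 d) < ringChar F) →
          UPT.IsHittingSet (UPT.pointsOver F H) (UPT.uptClass F n d T w) := by
  obtain ⟨k, hk⟩ := UPT.Prog.exists_cost_mainP_le
  have hmono : ∀ {a b c a' b' c' x w l : ℕ}, a ≤ a' → b ≤ b' → c ≤ c' → 1 ≤ x → 1 ≤ w →
      a * x ^ b * w ^ (c * l) ≤ a' * x ^ b' * w ^ (c' * l) := fun ha hb hc hx hw =>
    Nat.mul_le_mul (Nat.mul_le_mul ha (Nat.pow_le_pow_right hx hb))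
      (Nat.pow_le_pow_right hw (Nat.mul_le_mul_right _ hc))
  -- The first entries of the maxima serve the running time, the second ones the number of points
  -- and the characteristic.
  refine ⟨UPT.Prog.mainP, max (3 ^ k) 2, max k 6, max k 10, fun n d w T hn hd hw =>
    ⟨UPT.Prog.hittingPoints n d w (UPT.shapeBT T), UPT.Prog.eval_mainP (by omega), ?_, ?_, ?_⟩⟩
  · refine (hk n d w T hn hd hw).trans
      (hmono (le_max_left _ _) (le_max_left _ _) (le_max_left _ _) ?_ hw)
    have : 0 < T.size := by
      cases T
      rw [UPT.RTree.size]
      omega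
    exact Nat.mul_pos (Nat.mul_pos (Nat.mul_pos hn hd) hw) this
  all_goals
    have hB := (UPT.Prog.numPoints_le hn hd hw).trans
      (hmono (le_max_right (3 ^ k) 2) (le_max_right k 6) (le_max_right k 10)
        (Nat.mul_pos hn hd) hw)
  · refine le_trans ?_ hB
    rw [UPT.Prog.hittingPoints]
    split <;> simp
  · exact fun F _ hF => UPT.Prog.isHittingSet_hittingPoints hw
      (hF.imp_right fun h => hB.trans h.le)
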